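/- **Setting.** Let $V:\mathbb R\to\mathbb R$ be real analytic with $V''\ge -2W$ on $\mathbb R$ for a constant $W\ge 0$, and suppose that for some $a>0$ we have $V(x)>(2+a)\log(1+|x|)$ for all sufficiently large $|x|$. Assume that the equilibrium measure of $V$, i.e. the minimizer of $\int V\,d\nu-\iint\log|t-s|\,d\nu(s)\,d\nu(t)$ over probability measures $\nu$ on $\mathbb R$, has a continuous density $\rho$ which is supported on a single interval $[A,B]$, is positive on $(A,B)$, and satisfies $\rho(t)=s_A\sqrt{t-A}\,(1+O(t-A))$ as $t\to A^+$ and $\rho(t)=s_B\sqrt{B-t}\,(1+O(B-t))$ as $t\to B^-$, with $s_A,s_B>0$. Define $\tilde\gamma_j=\tilde\gamma^{(N)}_j$ by $\int_A^{\tilde\gamma_j}\rho=(j-\tfrac12)/N$, $1\le j\le N$. For $\alpha\ge1$ let $g_\alpha:\mathbb R\to\mathbb R$ be a $C^2$ function, independent of $N$, bounded together with $g_\alpha'$ and $g_\alpha''$, such that $g_\alpha'(\tilde\gamma^{(N)}_k)=\sqrt2\cos\big(2\pi(k-\tfrac12)\tfrac{\alpha}{2N}\big)$ for all $N$ and $1\le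 k\le N$, and put $X_\alpha(\lambda)=N^{-1/2}\sum_{j=1}^N\big(g_\alpha(\lambda_j)-g_\alpha(\tilde\gamma_j)\big)$. Let $\theta:\mathbb R\to\mathbb R$ be continuous and nonnegative, with $\theta=0$ on $[-1,1]$, and twice differentiable with $\theta''\ge1$ on $\{|x|>1\}$ (for example $\theta(x)=(|x|-1)^2\mathbf 1_{|x|>1}$). For $\varepsilon>0$ let $$R_{k,l}=\frac1N\,\frac{\varepsilon^{2/3}}{d(k,l)^2/N^2+\varepsilon^2},\qquad Q_{i,j}=R_{i,j}+R_{1-i,j}+R_{i,1-j}+R_{1-i,1-j}\quad(1\le i,j\le N),$$ where $d$ is the distance on $\mathbb Z/2N\mathbb Z$, $d(k,l)=\min_{n\in\mathbb Z}|k-l-2Nn|$. For $c_1,s>0$ and an integer $\ell\ge1$ define, on $\{\lambda_1<\dots<\lambda_N\}$, $$\mathcal H_\nu=\frac12\sum_{k}V(\lambda_k)-\frac1N\sum_{i<j}\log(\lambda_j-\lambda_i)+N\theta\Big(\frac sN\sum_i(\lambda_i-\tilde\gamma_i)^2\Big)+\sum_{i,j}\frac1N\theta\big(\sqrt{c_1NQ_{i,j}}\,(\lambda_i-\lambda_j)\big)+(W+1)\sum_{\alpha=1}^{\ell}X_\alpha^2,$$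 up to the additive constant that normalizes $d\nu^{(s,\ell)}=e^{-\beta N\mathcal H_\nu}d\lambda$, where $\beta>0$. **Lemma.** Functions $g_\alpha$ as above exist. For any choice of them and every constant $c_1>0$ the following holds for all sufficiently small $\varepsilon>0$ (the threshold depending only on $V,W,(g_\alpha),c_1$). There are constants $c,s>0$, an integer $\ell\ge1$ and an integer $N_0$, depending only on $V$ (through the choices of $W$, $(g_\alpha)$, $c_1$, $\varepsilon$ made for $V$), such that for all $N\ge N_0$, all $\beta>0$ and all $\theta$ as above: 1. at every $\lambda$ with $\lambda_1<\dots<\lambda_N$ at which none of the arguments of $\theta$ in $\mathcal H_\nu$ equals $\pm1$, $\mathcal H_\nu$ is twice differentiable and $$\langle v,(\nabla^2\mathcal H_\nu)(\lambda)\,v\rangle\ \ge\ c\,\|v\|^2\qquad\text{for all }v\in\mathbb R^N;$$ 2. across the remaining configurations, where $\theta''$ need not exist, the same bound holds in the sense that $\lambda\mapsto\mathcal H_\nu(\lambda)-\frac c2\|\lambda\|^2$ is convex on the whole open simplex $\{\lambda_1<\dots<\lambda_N\}$. -/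

import Mathlib

open Set Filter Topology MeasureTheory Asymptotics

noncomputable section

namespace LogGas

/-! ### Equilibrium measure of a potential -/

/-- The probability measures on which the energy functional is finite. Atoms have to be excluded
by hand, since the logarithmic energy of an atom is infinite while `Real.log 0 = 0`. -/
def HasFiniteLogEnergy (V : ℝ → ℝ) (ν : Measure ℝ) : Prop :=
  Integrable V ν ∧ (∀ x, ν {x} = 0) ∧
    Integrable (fun p : ℝ × ℝ => Real.log |p.1 - p.2|) (ν.prod ν)

/-- `I(ν) = ∫ V dν - ∬ log |t - s| dν(s) dν(t)`, for `ν` of finite energy. -/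
def logEnergy (V : ℝ → ℝ) (ν : Measure ℝ) : ℝ :=
  (∫ t, V t ∂ν) - ∫ p : ℝ × ℝ, Real.log |p.1 - p.2| ∂(ν.prod ν)

/-- `μ` minimizes `I` among all probability measures on `ℝ` (`I = ∞` off finite energy). -/
def IsEquilibriumMeasure (V : ℝ → ℝ) (μ : Measure ℝ) : Prop :=
  IsProbabilityMeasure μ ∧ HasFiniteLogEnergy V μ ∧
    ∀ ν : Measure ℝ, IsProbabilityMeasure ν → HasFiniteLogEnergy V ν →
      logEnergy V μ ≤ logEnergy V ν

/-- `V` is regular with one cut: its equilibrium measure has a continuous density `ρ`, supported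
on the single interval `[A, B]`, positive on `(A, B)`, with square-root vanishing
`ρ t = s_A √(t - A) (1 + O(t - A))`, `ρ t = s_B √(B - t) (1 + O(B - t))` at the endpoints. -/
structure IsRegularEquilibriumDensity (V ρ : ℝ → ℝ) (A B : ℝ) : Prop where
  lt : A < B
  continuous : Continuous ρ
  isEquilibrium :
    IsEquilibriumMeasure V (volume.withDensity fun x => ENNReal.ofReal (ρ x))
  pos : ∀ t ∈ Ioo A B, 0 < ρ t
  eq_zero : ∀ t, t ∉ Icc A B → ρ t = 0
  left_edge : ∃ sA : ℝ, 0 < sA ∧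
    (fun t => ρ t / (sA * √(t - A)) - 1) =O[𝓝[>] A] fun t => t - A
  right_edge : ∃ sB : ℝ, 0 < sB ∧
    (fun t => ρ t / (sB * √(B - t)) - 1) =O[𝓝[<] B] fun t => B - t

/-! ### Classical locations -/

/-- The point `x ≥ A` with `∫_A^x ρ = p`. -/
def quantile (ρ : ℝ → ℝ) (A p : ℝ) : ℝ :=
  sInf {x | A ≤ x ∧ p ≤ ∫ u in A..x, ρ u}

theorem integral_quantile {ρ : ℝ → ℝ} {A B p : ℝ} (hρ : Continuous ρ) (hAB : A ≤ B)
    (h0 : 0 ≤ p) (h1 : p ≤ ∫ u in A..B, ρ u) :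
    ∫ u in A..quantile ρ A p, ρ u = p := by
  have hcont : Continuous fun x => ∫ u in A..x, ρ u :=
    intervalIntegral.continuous_primitive (fun a b => hρ.intervalIntegrable a b) A
  have hclosed : IsClosed {x | A ≤ x ∧ p ≤ ∫ u in A..x, ρ u} :=
    (isClosed_le continuous_const continuous_id).inter (isClosed_le continuous_const hcont)
  have hbdd : BddBelow {x | A ≤ x ∧ p ≤ ∫ u in A..x, ρ u} := ⟨A, fun x hx => hx.1⟩
  have hmem : quantile ρ A p ∈ {x | A ≤ x ∧ p ≤ ∫ u in A..x, ρ u} :=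
    hclosed.csInf_mem ⟨B, hAB, h1⟩ hbdd
  obtain ⟨y, hy, hyp⟩ := intermediate_value_Icc hmem.1 hcont.continuousOn
    (show p ∈ Icc (∫ u in A..A, ρ u) (∫ u in A..quantile ρ A p, ρ u) from
      ⟨by simpa using h0, hmem.2⟩)
  have hle : quantile ρ A p ≤ y := csInf_le hbdd ⟨hy.1, hyp.ge⟩
  rwa [le_antisymm hy.2 hle] at hyp

/-- The shifted classical location `γ̃_j`, defined by `∫_A^γ̃_j ρ = (j - 1/2) / N` for
`j = 1, …, N`; the index `j : Fin N` stands for `j + 1`. -/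
def gammaTilde (ρ : ℝ → ℝ) (A : ℝ) (N : ℕ) (j : Fin N) : ℝ :=
  quantile ρ A (((j : ℝ) + 1 - 1 / 2) / N)

/-! ### Slow modes -/

/-- `g` is an admissible function `g_α`: it does not depend on `N`, is bounded with its first two
derivatives, and `g' (γ̃_k) = √2 cos (2π (k - 1/2) α / (2N))` for all `N` and `k = 1, …, N`. -/
structure IsSlowMode (ρ : ℝ → ℝ) (A : ℝ) (α : ℕ) (g : ℝ → ℝ) : Prop where
  contDiff : ContDiff ℝ 2 g
  bounded : ∃ C : ℝ, ∀ x, |g x| ≤ C ∧ |deriv g x| ≤ C ∧ |deriv (deriv g) x| ≤ C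
  deriv_gammaTilde : ∀ (N : ℕ) (k : Fin N), deriv g (gammaTilde ρ A N k) =
    √2 * Real.cos (2 * Real.pi * ((k : ℝ) + 1 - 1 / 2) * (α / (2 * N)))

/-! ### The matrix `Q` -/

/-- The representative of `n` modulo `2N` in `{-N+1, …, N}`. -/
def centeredMod (N : ℕ) (n : ℤ) : ℤ := (n + ((N : ℤ) - 1)) % (2 * N) - ((N : ℤ) - 1)

/-- The distance on the discrete circle `ℤ / 2N`. -/
def circDist (N : ℕ) (k l : ℤ) : ℤ := |centeredMod N (k - l)|

/-- `R_{k,l} = (1/N) ε^{2/3} / (d(k,l)² / N² + ε²)`. -/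
def matR (N : ℕ) (ε : ℝ) (k l : ℤ) : ℝ :=
  1 / N * (ε ^ (2 / 3 : ℝ) / ((circDist N k l : ℝ) ^ 2 / (N : ℝ) ^ 2 + ε ^ 2))

/-- `Q_{i,j} = R_{i,j} + R_{1-i,j} + R_{i,1-j} + R_{1-i,1-j}` for integers `i`, `j`. -/
def matQInt (N : ℕ) (ε : ℝ) (i j : ℤ) : ℝ :=
  matR N ε i j + matR N ε (1 - i) j + matR N ε i (1 - j) + matR N ε (1 - i) (1 - j)

/-- `Q_{i,j}`, `1 ≤ i, j ≤ N`; the index `i : Fin N` stands for `i + 1`. -/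
def matQ (N : ℕ) (ε : ℝ) (i j : Fin N) : ℝ := matQInt N ε ((i : ℤ) + 1) ((j : ℤ) + 1)

/-! ### The convexified Hamiltonian -/

/-- Continuous, nonnegative, zero on `[-1, 1]`, with `θ'' ≥ 1` for `|x| > 1`; for instance
`(x - 1)²` for `x > 1`, `(x + 1)²` for `x < -1`. -/
structure IsConfining (θ : ℝ → ℝ) : Prop where
  continuous : Continuous θ
  nonneg : ∀ x, 0 ≤ θ x
  eq_zero : ∀ x, |x| ≤ 1 → θ x = 0
  differentiableAt : ∀ x, 1 < |x| → DifferentiableAt ℝ θ x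
  differentiableAt_deriv : ∀ x, 1 < |x| → DifferentiableAt ℝ (deriv θ) x
  one_le : ∀ x, 1 < |x| → 1 ≤ deriv (deriv θ) x

/-- The open simplex `λ_1 < λ_2 < ⋯ < λ_N`. -/
def openSimplex (N : ℕ) : Set (EuclideanSpace ℝ (Fin N)) := {x | ∀ i j : Fin N, i < j → x i < x j}

/-- `H(λ) = ½ ∑ V(λ_k) - (1/N) ∑_{i<j} log (λ_j - λ_i)`. -/
def hamiltonian (V : ℝ → ℝ) (N : ℕ) (x : EuclideanSpace ℝ (Fin N)) : ℝ :=
  (∑ k, 1 / 2 * V (x k)) - 1 / N * ∑ i, ∑ j ∈ Finset.Ioi i, Real.log (x j - x i)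

/-- `X_α(λ) = N^{-1/2} ∑_j (g_α(λ_j) - g_α(γ̃_j))`, for `g = g_α`. -/
def linStat (ρ : ℝ → ℝ) (A : ℝ) (g : ℝ → ℝ) (N : ℕ) (x : EuclideanSpace ℝ (Fin N)) : ℝ :=
  (√(N : ℝ))⁻¹ * ∑ j, (g (x j) - g (gammaTilde ρ A N j))

/-- The argument `(s/N) ∑_i (λ_i - γ̃_i)²` of `θ` in `ψ^{(s)}`. -/
def globalArg (ρ : ℝ → ℝ) (A s : ℝ) (N : ℕ) (x : EuclideanSpace ℝ (Fin N)) : ℝ :=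
  s / N * ∑ i, (x i - gammaTilde ρ A N i) ^ 2

/-- The argument `√(c₁ N Q_{i,j}) (λ_i - λ_j)` of `θ` in `ψ_{i,j}`. -/
def pairArg (c₁ ε : ℝ) (N : ℕ) (i j : Fin N) (x : EuclideanSpace ℝ (Fin N)) : ℝ :=
  √(c₁ * N * matQ N ε i j) * (x i - x j)

/-- `ψ^{(s)}(λ) = N θ((s/N) ∑_i (λ_i - γ̃_i)²)`. -/
def psiGlobal (ρ : ℝ → ℝ) (A : ℝ) (θ : ℝ → ℝ) (s : ℝ) (N : ℕ)
    (x : EuclideanSpace ℝ (Fin N)) : ℝ :=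
  N * θ (globalArg ρ A s N x)

/-- `ψ_{i,j}(λ) = (1/N) θ(√(c₁ N Q_{i,j}) (λ_i - λ_j))`. -/
def psiPair (θ : ℝ → ℝ) (c₁ ε : ℝ) (N : ℕ) (i j : Fin N)
    (x : EuclideanSpace ℝ (Fin N)) : ℝ :=
  1 / N * θ (pairArg c₁ ε N i j x)

/-- The Hamiltonian of `ν^{(s,ℓ)}` before normalization:
`H + ψ^{(s)} + ∑_{i,j} ψ_{i,j} + (W+1) ∑_{α=1}^ℓ X_α²`. -/
def rawHamiltonianNu (V ρ : ℝ → ℝ) (A W : ℝ) (g : ℕ → ℝ → ℝ) (θ : ℝ → ℝ) (c₁ ε s : ℝ)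
    (ℓ N : ℕ) (x : EuclideanSpace ℝ (Fin N)) : ℝ :=
  hamiltonian V N x + psiGlobal ρ A θ s N x + (∑ i, ∑ j, psiPair θ c₁ ε N i j x)
    + (W + 1) * ∑ α ∈ Finset.Icc 1 ℓ, linStat ρ A (g α) N x ^ 2

/-- The normalizing constant `∫_{λ_1 < ⋯ < λ_N} e^{-β N H_ν} dλ`. -/
def partitionNu (V ρ : ℝ → ℝ) (A W : ℝ) (g : ℕ → ℝ → ℝ) (θ : ℝ → ℝ) (c₁ ε s β : ℝ)
    (ℓ N : ℕ) : ℝ :=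
  ∫ x in openSimplex N, Real.exp (-β * N * rawHamiltonianNu V ρ A W g θ c₁ ε s ℓ N x)

/-- The Hamiltonian `H_ν` of `ν = ν^{(s,ℓ)}`, normalized by an additive constant so that
`dν = e^{-β N H_ν} dλ` on the simplex. -/
def hamiltonianNu (V ρ : ℝ → ℝ) (A W : ℝ) (g : ℕ → ℝ → ℝ) (θ : ℝ → ℝ) (c₁ ε s β : ℝ)
    (ℓ N : ℕ) (x : EuclideanSpace ℝ (Fin N)) : ℝ :=
  rawHamiltonianNu V ρ A W g θ c₁ ε s ℓ N x
    + 1 / (β * N) * Real.log (partitionNu V ρ A W g θ c₁ ε s β ℓ N)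

/-- No argument of `θ` in `H_ν` equals `±1`; at such configurations `H_ν` is twice
differentiable, while `θ''` need not exist at `±1`. -/
def OffKinks (ρ : ℝ → ℝ) (A c₁ ε s : ℝ) (N : ℕ) (x : EuclideanSpace ℝ (Fin N)) : Prop :=
  |globalArg ρ A s N x| ≠ 1 ∧ ∀ i j : Fin N, |pairArg c₁ ε N i j x| ≠ 1

/-- `H` is differentiable near `x` and its derivative is differentiable at `x`. -/
def TwiceDifferentiableAt {N : ℕ} (H : EuclideanSpace ℝ (Fin N) → ℝ)
    (x : EuclideanSpace ℝ (Fin N)) : Prop :=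
  (∀ᶠ y in 𝓝 x, DifferentiableAt ℝ H y) ∧ DifferentiableAt ℝ (fderiv ℝ H) x

/-- The quadratic form `⟨v, (∇²H)(x) v⟩`. -/
def hessianForm {N : ℕ} (H : EuclideanSpace ℝ (Fin N) → ℝ)
    (x v : EuclideanSpace ℝ (Fin N)) : ℝ :=
  fderiv ℝ (fderiv ℝ H) x v v

end LogGas

end

namespace LogGas

/-! ### Lower bounds on symmetric second differences -/

/-! The Hessian of the log gas in direction `v` is the sum of `½ V''(λ_k) v_k²` and the repulsion
`(1/N) ∑_{i<j} (v_i - v_j)² / (λ_i - λ_j)²`. Since `V` need not be convex, the negative part of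
`V''` has to be paid for by the repulsion and by the three added terms. Each of them takes care of
its own range of configurations or modes.

At the classical locations the repulsion nearly pays by itself. The Euler–Lagrange conditions give
`U ≤ (V - m)/2` with equality on `[A, B]`, where `U` is the logarithmic potential of `ρ`. Combined
with the square-root edges, this produces a function `E` with `E'' = V''/2` on `[A, B]`, with `E''`
compactly supported, and with `E - U` convex (`exists_majorant`). Averaging `U'' ≤ E''` against the
Poisson kernel at height `δ` gives `-∫ k_δ(x - y) ρ(y) dy ≤ V''(x)/2 + τ` on the support, with `k_δ
= conjKernel δ`. Two facts convert this into a bound on the quadratic form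
(`le_pairHessian_of_conjKernel`): `-k_δ` is positive definite, being a cosine transform of a
positive density, and `k_δ ≤ 1/(t² + δ²) ≤ 1/t²`. Replacing the integral by a Riemann sum costs
`O(1/N)`, so the Hessian truncated at scale `δ` is at least `-τ` (`exists_neg_le_pairHessian`).

The penalty on the modes `α ≥ 1` cannot see the constant mode. There the form is governed by `½ ∫
V'' ρ`, which is positive: perturbing the constant vector in the direction of `V''` would otherwise
make the form negative, and `V''` does not vanish identically because `V` is analytic and grows at
both ends (`integral_mul_pos`). A Schur-complement argument then yields a strictly positive form at
the classical locations once every non-constant mode is penalized (`exists_le_pairHessian`).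

At a general configuration `v` is split into the cosine modes `0, …, ℓ` and the rest. Low modes are
delocalized, so moving from the classical locations to `λ` costs a multiple of the root mean square
displacement `b`; the statistics `X_α` provide the mode penalty with errors linear and quadratic in
`b`; and `ψ^{(s)}` absorbs these errors once `s` is large. For high modes, a fraction `η` of the
repulsion is sacrificed: for each pair either `θ` is active, or the particles are so close that the
repulsion itself dominates `c₁ Q_{i,j}`. In both cases a multiple of the form of `Q` is available,
and that form is at least `ε^{-1/3}` on modes above `2/ε` (`le_sum_matQ_mul_sub_sq`), which beats
any constant for small `ε`.

Since `θ` need not be differentiable at `±1`, all bounds are proved for lower symmetric second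
differences. These add up, hold at the kinks because `θ` is minimal there, and give both the Hessian
bound and strong convexity. -/

/-- The lower symmetric second derivative of `H` at `x` in the direction `v` is at least `m`. -/
def SecondDiffGE {E : Type*} [AddCommGroup E] [Module ℝ E] (H : E → ℝ) (x v : E) (m : ℝ) : Prop :=
  ∀ η : ℝ, 0 < η → ∀ᶠ r in 𝓝[>] (0 : ℝ),
    (m - η) * r ^ 2 ≤ H (x + r • v) + H (x - r • v) - 2 * H x

section
variable {E : Type*} [AddCommGroup E] [Module ℝ E] {H H₁ H₂ : E → ℝ} {x v : E} {m m₁ m₂ : ℝ}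

theorem SecondDiffGE.mono (h : SecondDiffGE H x v m₁) (hm : m₂ ≤ m₁) : SecondDiffGE H x v m₂ := by
  intro η hη
  filter_upwards [h η hη] with r hr
  nlinarith [sq_nonneg r]

theorem SecondDiffGE.add (h₁ : SecondDiffGE H₁ x v m₁) (h₂ : SecondDiffGE H₂ x v m₂) :
    SecondDiffGE (fun y => H₁ y + H₂ y) x v (m₁ + m₂) := by
  intro η hη
  filter_upwards [h₁ (η / 2) (half_pos hη), h₂ (η / 2) (half_pos hη)] with r hr₁ hr₂
  linarith

theorem SecondDiffGE.const (c : ℝ) : SecondDiffGE (fun _ : E => c) x v 0 := by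
  intro η hη
  refine Eventually.of_forall fun r => ?_
  nlinarith [sq_nonneg r]

theorem SecondDiffGE.add_const (h : SecondDiffGE H x v m) (c : ℝ) :
    SecondDiffGE (fun y => H y + c) x v m := by
  simpa using h.add (SecondDiffGE.const c)

theorem SecondDiffGE.sum {ι : Type*} (s : Finset ι) {F : ι → E → ℝ} {M : ι → ℝ}
    (h : ∀ i ∈ s, SecondDiffGE (F i) x v (M i)) :
    SecondDiffGE (fun y => ∑ i ∈ s, F i y) x v (∑ i ∈ s, M i) := by
  classical
  induction s using Finset.induction_on with
  | empty => simpa using SecondDiffGE.const (E := E) 0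
  | insert a s ha ih =>
    simp only [Finset.sum_insert ha]
    exact (h a (Finset.mem_insert_self a s)).add
      (ih fun i hi => h i (Finset.mem_insert_of_mem hi))

theorem SecondDiffGE.const_mul (h : SecondDiffGE H x v m) {c : ℝ} (hc : 0 < c) :
    SecondDiffGE (fun y => c * H y) x v (c * m) := by
  intro η hη
  filter_upwards [h (η / c) (div_pos hη hc)] with r hr
  have := mul_le_mul_of_nonneg_left hr hc.le
  have e : c * ((m - η / c) * r ^ 2) = (c * m - η) * r ^ 2 := by field_simp
  linarith

theorem SecondDiffGE.of_isMin (h : ∀ᶠ r in 𝓝[>] (0 : ℝ), 2 * H x ≤ H (x + r • v) + H (x - r • v)) :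
    SecondDiffGE H x v 0 := by
  intro η hη
  filter_upwards [h] with r hr
  nlinarith [sq_nonneg r]

theorem SecondDiffGE.of_line (h : SecondDiffGE (fun t : ℝ => H (x + t • v)) 0 1 m) :
    SecondDiffGE H x v m := by
  intro η hη
  filter_upwards [h η hη] with r hr
  simpa [sub_eq_add_neg] using hr

theorem SecondDiffGE.line {t : ℝ} (h : SecondDiffGE H (x + t • v) v m) :
    SecondDiffGE (fun t : ℝ => H (x + t • v)) t 1 m := by
  intro η hη
  filter_upwards [h η hη] with r hr
  have e1 : x + (t + r • (1 : ℝ)) • v = x + t • v + r • v := by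
    simp [add_smul, add_assoc]
  have e2 : x + (t - r • (1 : ℝ)) • v = x + t • v - r • v := by
    simp [sub_smul, add_sub_assoc]
  simp only [e1, e2]
  exact hr

end

/-- Only differentiability of `h'` at the single point `t` is used, which is what is available for
compositions with `θ`. -/
theorem SecondDiffGE.of_hasDerivAt {h h' : ℝ → ℝ} {t m : ℝ}
    (h1 : ∀ᶠ s in 𝓝 t, HasDerivAt h (h' s) s) (h2 : HasDerivAt h' m t) :
    SecondDiffGE h t 1 m := by
  intro η hη
  have h3 := (hasDerivAt_iff_isLittleO.1 h2).def (half_pos hη)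
  obtain ⟨δ, hδ, hb⟩ := Metric.eventually_nhds_iff.1 (h1.and h3)
  filter_upwards [Ioo_mem_nhdsGT hδ] with r hr
  -- `G` has derivative `h'(t + s) - h'(t - s) - 2 (m - η) s`, nonnegative for small `s` by the
  -- expansion of `h'` at `t`; comparing `G r` with `G 0 = 2 h t` gives the claim.
  set G : ℝ → ℝ := fun r => h (t + r) + h (t - r) - (m - η) * r ^ 2 with hG
  have hd : ∀ s ∈ Icc 0 r, HasDerivAt G (h' (t + s) - h' (t - s) - (m - η) * (2 * s)) s := by
    intro s hs
    have d1 : HasDerivAt h (h' (t + s)) (t + s) :=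
      (hb (by simp [abs_of_nonneg hs.1]; linarith [hs.2, hr.2])).1
    have d2 : HasDerivAt h (h' (t - s)) (t - s) :=
      (hb (by simp [abs_of_nonneg hs.1]; linarith [hs.2, hr.2])).1
    have e1 := d1.comp_const_add t s
    have e2 := d2.comp_const_sub t s
    have e3 := ((hasDerivAt_pow 2 s).const_mul (m - η))
    exact ((e1.add e2).sub e3).congr_deriv (by push_cast; ring)
  have hmono : MonotoneOn G (Icc 0 r) := by
    apply monotoneOn_of_deriv_nonneg (convex_Icc 0 r)
    · exact fun s hs => (hd s hs).continuousAt.continuousWithinAt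
    · intro s hs
      rw [interior_Icc] at hs
      exact (hd s (Ioo_subset_Icc_self hs)).differentiableAt.differentiableWithinAt
    · intro s hs
      rw [interior_Icc] at hs
      rw [(hd s (Ioo_subset_Icc_self hs)).deriv]
      have b1 := (hb (y := t + s) (by simp [abs_of_nonneg hs.1.le]; linarith [hs.2, hr.2])).2
      have b2 := (hb (y := t - s)
        (by simp [abs_of_nonneg hs.1.le]; linarith [hs.2, hr.2])).2
      simp only [smul_eq_mul, add_sub_cancel_left, Real.norm_eq_abs, abs_of_pos hs.1] at b1
      have e : t - s - t = -s := by ring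
      rw [e] at b2
      simp only [smul_eq_mul, Real.norm_eq_abs, abs_neg, abs_of_pos hs.1] at b2
      rw [abs_le] at b1 b2
      nlinarith [b1.1, b2.2, hs.1]
  have := hmono (left_mem_Icc.2 hr.1.le) (right_mem_Icc.2 hr.1.le) hr.1.le
  simp only [hG] at this
  simp only [smul_eq_mul, mul_one]
  simp at this
  linarith

/-- The bounds for `h` and for `-h` add up to a second difference that is identically zero. -/
theorem SecondDiffGE.le_deriv {h h' : ℝ → ℝ} {t m M : ℝ} (h0 : SecondDiffGE h t 1 m)
    (h1 : ∀ᶠ s in 𝓝 t, HasDerivAt h (h' s) s) (h2 : HasDerivAt h' M t) : m ≤ M := by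
  have h3 : SecondDiffGE (fun s => -h s) t 1 (-M) :=
    SecondDiffGE.of_hasDerivAt (h' := fun s => -h' s) (h1.mono fun s hs => hs.neg) h2.neg
  refine le_of_forall_pos_le_add fun η hη => ?_
  obtain ⟨r, hr⟩ := (((h0 (η / 2) (half_pos hη)).and (h3 (η / 2) (half_pos hη))).and
    self_mem_nhdsWithin).exists
  obtain ⟨⟨a, b⟩, hr⟩ := hr
  have hr : 0 < r ^ 2 := pow_pos hr 2
  have : (m - M - η) * r ^ 2 ≤ 0 := by nlinarith
  nlinarith [nonpos_of_mul_nonpos_left this hr]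

/-- A maximum principle: after subtracting a small multiple of `(s - a) (b - s)` all second
differences are eventually strictly positive, which is impossible at an interior maximum. -/
theorem nonpos_of_secondDiffGE {g : ℝ → ℝ} {a b : ℝ} (hg : ContinuousOn g (Icc a b))
    (hsd : ∀ t ∈ Ioo a b, SecondDiffGE g t 1 0) (ha : g a ≤ 0) (hb : g b ≤ 0) :
    ∀ t ∈ Icc a b, g t ≤ 0 := by
  intro t ht
  by_contra! hpos
  have hab : a ≤ b := ht.1.trans ht.2
  obtain ⟨η, hη, hη'⟩ : ∃ η : ℝ, 0 < η ∧ η * ((t - a) * (b - t)) < g t := by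
    refine ⟨g t / (2 * ((t - a) * (b - t) + 1)), ?_, ?_⟩
    · have := mul_nonneg (sub_nonneg.2 ht.1) (sub_nonneg.2 ht.2)
      positivity
    · have := mul_nonneg (sub_nonneg.2 ht.1) (sub_nonneg.2 ht.2)
      rw [div_mul_eq_mul_div, div_lt_iff₀ (by positivity)]
      nlinarith
  set k : ℝ → ℝ := fun s => g s - η * ((s - a) * (b - s)) with hk
  have hkc : ContinuousOn k (Icc a b) := hg.sub (by fun_prop)
  obtain ⟨z, hz, hmax⟩ := isCompact_Icc.exists_isMaxOn ⟨t, ht⟩ hkc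
  have hkz : 0 < k z := lt_of_lt_of_le (by simp only [hk]; linarith) (hmax ht)
  have hza : z ≠ a := by
    rintro rfl
    simp [hk] at hkz; linarith
  have hzb : z ≠ b := by
    rintro rfl
    simp [hk] at hkz; linarith
  have hzo : z ∈ Ioo a b := ⟨lt_of_le_of_ne hz.1 hza.symm, lt_of_le_of_ne hz.2 hzb⟩
  have hev : ∀ᶠ r in 𝓝[>] (0 : ℝ), r < min (z - a) (b - z) ∧ 0 < r := by
    have h0 : 0 < min (z - a) (b - z) := lt_min (sub_pos.2 hzo.1) (sub_pos.2 hzo.2)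
    filter_upwards [Ioo_mem_nhdsGT h0] with r hr using ⟨hr.2, hr.1⟩
  obtain ⟨r, hr1, hr2, hr3⟩ := ((hsd z hzo η hη).and hev).exists
  have hr4 := lt_min_iff.1 hr2
  have m1 : k (z + r) ≤ k z := hmax (by constructor <;> linarith)
  have m2 : k (z - r) ≤ k z := hmax (by constructor <;> linarith)
  simp only [hk] at m1 m2
  simp only [smul_eq_mul, mul_one] at hr1
  have hrr : 0 < r ^ 2 := by positivity
  nlinarith

theorem convexOn_of_secondDiffGE {E : Type*} [AddCommGroup E] [Module ℝ E] [TopologicalSpace E]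
    [ContinuousAdd E] [ContinuousSMul ℝ E] {s : Set E} (hs : Convex ℝ s) {f : E → ℝ}
    (hf : ContinuousOn f s) (hsd : ∀ x ∈ s, ∀ v, SecondDiffGE f x v 0) : ConvexOn ℝ s f := by
  refine ⟨hs, fun x hx y hy a b ha hb hab => ?_⟩
  have hline : ∀ t ∈ Icc (0 : ℝ) 1, x + t • (y - x) ∈ s := by
    intro t ht
    have := hs hx hy (sub_nonneg.2 ht.2) ht.1 (by ring)
    convert this using 1
    simp [sub_smul, smul_sub]; abel
  -- Subtracting the chord makes `g` vanish at both endpoints without changing second differences.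
  set g : ℝ → ℝ := fun t => f (x + t • (y - x)) + (-(f x) + t * (f x - f y)) with hg
  have hgc : ContinuousOn g (Icc 0 1) := by
    refine ContinuousOn.add (hf.comp (by fun_prop) hline) (by fun_prop)
  have key := nonpos_of_secondDiffGE hgc (fun t ht => ?_) (by simp [hg])
    (by simp only [hg, one_smul, add_sub_cancel]; linarith) b
    ⟨hb, by linarith⟩
  · simp only [hg] at key
    have e : x + b • (y - x) = a • x + b • y := by
      rw [← eq_sub_iff_add_eq] at hab
      rw [hab]; simp [sub_smul, smul_sub]; abel
    rw [e] at key
    simp only [smul_eq_mul]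
    have : a = 1 - b := by linarith
    subst this
    linarith
  · have h1 := (hsd _ (hline t (Ioo_subset_Icc_self ht)) (y - x)).line
    have h2 : SecondDiffGE (fun t : ℝ => -(f x) + t * (f x - f y)) t 1 0 := by
      apply SecondDiffGE.of_isMin
      refine Eventually.of_forall fun r => le_of_eq ?_
      simp; ring
    simpa using h1.add h2

theorem strongConvexOn_of_secondDiffGE {E : Type*} [NormedAddCommGroup E] [InnerProductSpace ℝ E]
    {s : Set E} (hs : Convex ℝ s) {f : E → ℝ} {c : ℝ} (hf : ContinuousOn f s)
    (hsd : ∀ x ∈ s, ∀ v, SecondDiffGE f x v (c * ‖v‖ ^ 2)) : StrongConvexOn s c f := by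
  rw [strongConvexOn_iff_convex]
  refine convexOn_of_secondDiffGE hs (hf.sub (by fun_prop)) fun x hx v => ?_
  intro η hη
  filter_upwards [hsd x hx v η hη] with r hr
  have e : ‖x + r • v‖ ^ 2 + ‖x - r • v‖ ^ 2 = 2 * ‖x‖ ^ 2 + 2 * (r ^ 2 * ‖v‖ ^ 2) := by
    have := parallelogram_law_with_norm ℝ x (r • v)
    rw [norm_smul] at this
    have h2 : ‖r‖ ^ 2 = r ^ 2 := by simp
    nlinarith [this]
  have e2 := congrArg (fun z => c / 2 * z) e
  nlinarith [e2]

/-! ### Logarithmic potentials of continuous compactly supported densities -/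

theorem locallyIntegrable_log : LocallyIntegrable Real.log := by
  intro x
  refine ⟨Icc (x - 1) (x + 1), Icc_mem_nhds (by linarith) (by linarith), ?_⟩
  have := (intervalIntegral.intervalIntegrable_log' (a := x - 1) (b := x + 1))
  rwa [intervalIntegrable_iff_integrableOn_Icc_of_le (by linarith)] at this

/-- On the product of the supports the difference `p.1 - p.2` is bounded, so the logarithm may be
cut off to an integrable function, and the product becomes a convolution integrand times a bounded
factor. `Real.log` is even, hence no absolute value is needed. -/
theorem integrable_log_sub_mul {φ χ : ℝ → ℝ} (hφ : Continuous φ) (hφs : HasCompactSupport φ)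
    (hχ : Continuous χ) (hχs : HasCompactSupport χ) :
    Integrable (fun p : ℝ × ℝ => Real.log (p.1 - p.2) * (φ p.1 * χ p.2)) := by
  obtain ⟨R, hR⟩ := ((hφs.isCompact.prod hχs.isCompact).image
    (f := fun p : ℝ × ℝ => |p.1 - p.2|) (by fun_prop)).bddAbove
  obtain ⟨Cφ, hC⟩ := hφs.exists_bound_of_continuous hφ
  have hlog : Integrable (indicator (Icc (-R) R) Real.log) :=
    (integrable_indicator_iff measurableSet_Icc).2
      (locallyIntegrable_log.integrableOn_isCompact isCompact_Icc)
  have hconv := (hχ.integrable_of_hasCompactSupport hχs (μ := volume)).convolution_integrand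
    (ContinuousLinearMap.mul ℝ ℝ) hlog
  have hb := hconv.bdd_mul (f := fun p => φ p.1) (c := Cφ)
    (hφ.comp continuous_fst).aestronglyMeasurable (Eventually.of_forall fun p => hC p.1)
  refine hb.congr (Eventually.of_forall fun p => ?_)
  simp only [ContinuousLinearMap.mul_apply']
  by_cases h : p ∈ tsupport φ ×ˢ tsupport χ
  · have h1 : |p.1 - p.2| ≤ R := hR (mem_image_of_mem _ h)
    rw [indicator_of_mem (mem_Icc.2 (abs_le.1 h1))]
    ring
  · rw [mem_prod, not_and_or] at h
    rcases h with h | h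
    · simp [image_eq_zero_of_notMem_tsupport h]
    · simp [image_eq_zero_of_notMem_tsupport h]

/-- `U(x) = ∫ log |x - y| ρ(y) dy`. -/
noncomputable def logPotential (ρ : ℝ → ℝ) (x : ℝ) : ℝ := ∫ y, Real.log (x - y) * ρ y

theorem integrable_log_sub {ρ : ℝ → ℝ} (hρ : Continuous ρ) (hρs : HasCompactSupport ρ) (x : ℝ) :
    Integrable fun y => Real.log (x - y) * ρ y := by
  have h2 : Integrable fun y => ρ (x - y) * Real.log y := by
    have := locallyIntegrable_log.integrable_smul_left_of_hasCompactSupport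
      (g := fun y => ρ (x - y)) (by fun_prop)
      (hρs.comp_homeomorph (Homeomorph.subLeft x))
    simpa using this
  have := h2.comp_sub_left x
  refine this.congr (Eventually.of_forall fun y => ?_)
  simp [mul_comm]

theorem continuous_logPotential {ρ : ℝ → ℝ} (hρ : Continuous ρ) (hρs : HasCompactSupport ρ) :
    Continuous (logPotential ρ) := by
  have := hρs.continuous_convolution_right (ContinuousLinearMap.mul ℝ ℝ) locallyIntegrable_log hρ
  convert this using 1
  ext x
  simp only [logPotential, convolution, ContinuousLinearMap.mul_apply']
  rw [← integral_sub_left_eq_self _ _ x]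
  simp

/-- `∬ log |x - y| φ(x) χ(y) dx dy`. -/
noncomputable def logPairing (φ χ : ℝ → ℝ) : ℝ :=
  ∫ p : ℝ × ℝ, Real.log (p.1 - p.2) * (φ p.1 * χ p.2)

theorem logPairing_eq {φ χ : ℝ → ℝ} (hφ : Continuous φ) (hφs : HasCompactSupport φ)
    (hχ : Continuous χ) (hχs : HasCompactSupport χ) :
    logPairing φ χ = ∫ x, logPotential χ x * φ x := by
  rw [logPairing, Measure.volume_eq_prod, integral_prod _ (integrable_log_sub_mul hφ hφs hχ hχs)]
  congr 1; ext x
  rw [logPotential, ← integral_mul_const]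
  congr 1; ext y; ring

theorem logPairing_comm (φ χ : ℝ → ℝ) : logPairing φ χ = logPairing χ φ := by
  rw [logPairing, logPairing, Measure.volume_eq_prod, ← integral_prod_swap]
  congr 1; ext p
  simp only [Prod.fst_swap, Prod.snd_swap]
  rw [← Real.log_abs, abs_sub_comm, Real.log_abs]; ring

theorem logPairing_interpolate {ρ σ : ℝ → ℝ} (hρ : Continuous ρ) (hρs : HasCompactSupport ρ)
    (hσ : Continuous σ) (hσs : HasCompactSupport σ) (t : ℝ) :
    logPairing (fun x => (1 - t) * ρ x + t * σ x) (fun x => (1 - t) * ρ x + t * σ x) =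
      (1 - t) ^ 2 * logPairing ρ ρ + 2 * t * (1 - t) * logPairing σ ρ + t ^ 2 * logPairing σ σ := by
  have i1 := (integrable_log_sub_mul hρ hρs hρ hρs).const_mul ((1 - t) ^ 2)
  have i2 := (integrable_log_sub_mul hσ hσs hρ hρs).const_mul (t * (1 - t))
  have i3 := (integrable_log_sub_mul hρ hρs hσ hσs).const_mul (t * (1 - t))
  have i4 := (integrable_log_sub_mul hσ hσs hσ hσs).const_mul (t ^ 2)
  have e : 2 * t * (1 - t) * logPairing σ ρ =
      t * (1 - t) * logPairing σ ρ + t * (1 - t) * logPairing ρ σ := by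
    rw [logPairing_comm ρ σ]; ring
  rw [e]
  simp only [logPairing, ← integral_const_mul]
  have i23 : Integrable (fun p : ℝ × ℝ => t * (1 - t) * (Real.log (p.1 - p.2) * (σ p.1 * ρ p.2)) +
    t * (1 - t) * (Real.log (p.1 - p.2) * (ρ p.1 * σ p.2))) := i2.add i3
  have i123 : Integrable (fun p : ℝ × ℝ => (1 - t) ^ 2 * (Real.log (p.1 - p.2) * (ρ p.1 * ρ p.2)) +
    (t * (1 - t) * (Real.log (p.1 - p.2) * (σ p.1 * ρ p.2)) +
    t * (1 - t) * (Real.log (p.1 - p.2) * (ρ p.1 * σ p.2)))) := i1.add i23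
  rw [← integral_add i2 i3, ← integral_add i1 i23, ← integral_add i123 i4]
  congr 1; ext p
  ring

section
variable {φ : ℝ → ℝ}

theorem integrable_withDensity_ofReal (hφ : Continuous φ) (h0 : ∀ x, 0 ≤ φ x) {f : ℝ → ℝ} :
    Integrable f (volume.withDensity fun x => ENNReal.ofReal (φ x)) ↔
      Integrable fun x => f x * φ x := by
  rw [integrable_withDensity_iff_integrable_smul' (by fun_prop) (by simp)]
  simp [ENNReal.toReal_ofReal (h0 _), mul_comm]

theorem integral_withDensity_ofReal (hφ : Continuous φ) (h0 : ∀ x, 0 ≤ φ x) (f : ℝ → ℝ) :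
    ∫ x, f x ∂(volume.withDensity fun x => ENNReal.ofReal (φ x)) = ∫ x, f x * φ x := by
  rw [integral_withDensity_eq_integral_toReal_smul (by fun_prop) (by simp)]
  simp [ENNReal.toReal_ofReal (h0 _), mul_comm]

theorem isProbabilityMeasure_withDensity_ofReal (hφ : Continuous φ) (h0 : ∀ x, 0 ≤ φ x)
    (hs : HasCompactSupport φ) :
    IsProbabilityMeasure (volume.withDensity fun x => ENNReal.ofReal (φ x)) ↔
      ∫ x, φ x = 1 := by
  rw [isProbabilityMeasure_iff, withDensity_apply _ MeasurableSet.univ, Measure.restrict_univ,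
    ← ofReal_integral_eq_lintegral_ofReal (hφ.integrable_of_hasCompactSupport hs)
      (Eventually.of_forall h0)]
  simp

theorem integrable_log_withDensity_prod (hφ : Continuous φ) (h0 : ∀ x, 0 ≤ φ x)
    (hs : HasCompactSupport φ) :
    Integrable (fun p : ℝ × ℝ => Real.log |p.1 - p.2|)
      ((volume.withDensity fun x => ENNReal.ofReal (φ x)).prod
        (volume.withDensity fun x => ENNReal.ofReal (φ x))) := by
  rw [prod_withDensity (by fun_prop) (by fun_prop), integrable_withDensity_iff_integrable_smul'
    (by fun_prop) (Eventually.of_forall fun p => ENNReal.mul_lt_top (by simp) (by simp))]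
  refine (integrable_log_sub_mul hφ hs hφ hs).congr (Eventually.of_forall fun p => ?_)
  simp [ENNReal.toReal_ofReal (h0 _), mul_comm]

theorem integral_log_withDensity_prod (hφ : Continuous φ) (h0 : ∀ x, 0 ≤ φ x) :
    ∫ p : ℝ × ℝ, Real.log |p.1 - p.2|
      ∂((volume.withDensity fun x => ENNReal.ofReal (φ x)).prod
        (volume.withDensity fun x => ENNReal.ofReal (φ x))) = logPairing φ φ := by
  rw [prod_withDensity (by fun_prop) (by fun_prop), integral_withDensity_eq_integral_toReal_smul
    (by fun_prop) (Eventually.of_forall fun p => ENNReal.mul_lt_top (by simp) (by simp))]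
  rw [logPairing]
  congr 1; ext p
  simp [ENNReal.toReal_ofReal (h0 _), mul_comm]

theorem hasFiniteLogEnergy_withDensity {V : ℝ → ℝ} (hV : Continuous V) (hφ : Continuous φ)
    (h0 : ∀ x, 0 ≤ φ x) (hs : HasCompactSupport φ) :
    HasFiniteLogEnergy V (volume.withDensity fun x => ENNReal.ofReal (φ x)) := by
  refine ⟨(integrable_withDensity_ofReal hφ h0).2
    ((hV.mul hφ).integrable_of_hasCompactSupport hs.mul_left),
    fun x => withDensity_absolutelyContinuous _ _ (by simp),
    integrable_log_withDensity_prod hφ h0 hs⟩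

theorem logEnergy_withDensity (V : ℝ → ℝ) (hφ : Continuous φ) (h0 : ∀ x, 0 ≤ φ x) :
    logEnergy V (volume.withDensity fun x => ENNReal.ofReal (φ x)) =
      (∫ x, V x * φ x) - logPairing φ φ := by
  rw [logEnergy, integral_withDensity_ofReal hφ h0, integral_log_withDensity_prod hφ h0]

end

/-! ### Euler–Lagrange conditions -/

/-- The variational inequality for the minimizer of the logarithmic energy. -/
theorem integral_le_of_isEquilibriumMeasure {V ρ σ : ℝ → ℝ} (hV : Continuous V)
    (hρ : Continuous ρ) (hρ0 : ∀ x, 0 ≤ ρ x) (hρs : HasCompactSupport ρ)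
    (hmin : IsEquilibriumMeasure V (volume.withDensity fun x => ENNReal.ofReal (ρ x)))
    (hσ : Continuous σ) (hσ0 : ∀ x, 0 ≤ σ x) (hσs : HasCompactSupport σ) (hσ1 : ∫ x, σ x = 1) :
    ∫ x, (V x - 2 * logPotential ρ x) * ρ x ≤ ∫ x, (V x - 2 * logPotential ρ x) * σ x := by
  have hρ1 := (isProbabilityMeasure_withDensity_ofReal hρ hρ0 hρs).1 hmin.1
  have hU := continuous_logPotential hρ hρs
  have iVρ : Integrable fun x => V x * ρ x :=
    (hV.mul hρ).integrable_of_hasCompactSupport hρs.mul_left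
  have iVσ : Integrable fun x => V x * σ x :=
    (hV.mul hσ).integrable_of_hasCompactSupport hσs.mul_left
  have iUρ : Integrable fun x => 2 * (logPotential ρ x * ρ x) :=
    ((hU.mul hρ).integrable_of_hasCompactSupport hρs.mul_left).const_mul 2
  have iUσ : Integrable fun x => 2 * (logPotential ρ x * σ x) :=
    ((hU.mul hσ).integrable_of_hasCompactSupport hσs.mul_left).const_mul 2
  -- The energy of `(1 - t) ρ + t σ` is quadratic in `t` and minimal at `t = 0`; this is the
  -- difference of energies divided by `t`. Only its value as `t → 0⁺` matters.
  have key : ∀ t ∈ Ioc (0 : ℝ) 1, 0 ≤ ((∫ x, V x * σ x) - (∫ x, V x * ρ x)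
      + 2 * logPairing ρ ρ - 2 * logPairing σ ρ)
      + t * (-logPairing ρ ρ + 2 * logPairing σ ρ - logPairing σ σ) := by
    intro t ht
    have hψ : Continuous fun x => (1 - t) * ρ x + t * σ x := by fun_prop
    have hψ0 : ∀ x, 0 ≤ (1 - t) * ρ x + t * σ x := fun x =>
      add_nonneg (mul_nonneg (by linarith [ht.2]) (hρ0 x)) (mul_nonneg ht.1.le (hσ0 x))
    have hψs : HasCompactSupport fun x => (1 - t) * ρ x + t * σ x :=
      (hρs.mul_left (f := fun _ => 1 - t)).add (hσs.mul_left (f := fun _ => t))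
    have iρ := hρ.integrable_of_hasCompactSupport hρs (μ := volume)
    have iσ := hσ.integrable_of_hasCompactSupport hσs (μ := volume)
    have hψ1 : ∫ x, ((1 - t) * ρ x + t * σ x) = 1 := by
      rw [integral_add (iρ.const_mul _) (iσ.const_mul _), integral_const_mul, integral_const_mul,
        hρ1, hσ1]; ring
    have h := hmin.2.2 _ ((isProbabilityMeasure_withDensity_ofReal hψ hψ0 hψs).2 hψ1)
      (hasFiniteLogEnergy_withDensity hV hψ hψ0 hψs)
    rw [logEnergy_withDensity V hρ hρ0, logEnergy_withDensity V hψ hψ0,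
      logPairing_interpolate hρ hρs hσ hσs] at h
    have e : ∫ x, V x * ((1 - t) * ρ x + t * σ x) =
        (1 - t) * (∫ x, V x * ρ x) + t * ∫ x, V x * σ x := by
      rw [← integral_const_mul, ← integral_const_mul,
        ← integral_add (iVρ.const_mul (1 - t)) (iVσ.const_mul t)]
      congr 1; ext x; ring
    rw [e] at h
    refine nonneg_of_mul_nonneg_right (a := t) ?_ ht.1
    linarith
  have hlim : 0 ≤ (∫ x, V x * σ x) - (∫ x, V x * ρ x)
      + 2 * logPairing ρ ρ - 2 * logPairing σ ρ := by
    refine ge_of_tendsto (x := 𝓝[>] (0 : ℝ))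
      (f := fun t : ℝ => ((∫ x, V x * σ x) - (∫ x, V x * ρ x)
      + 2 * logPairing ρ ρ - 2 * logPairing σ ρ)
      + t * (-logPairing ρ ρ + 2 * logPairing σ ρ - logPairing σ σ)) ?_ ?_
    · refine tendsto_nhdsWithin_of_tendsto_nhds ?_
      exact Continuous.tendsto' (by fun_prop) _ _ (by simp)
    · filter_upwards [Ioc_mem_nhdsGT (zero_lt_one' ℝ)] with t ht using key t ht
  rw [logPairing_eq hρ hρs hρ hρs, logPairing_eq hσ hσs hρ hρs] at hlim
  simp only [sub_mul, mul_assoc]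
  rw [integral_sub iVρ iUρ, integral_sub iVσ iUσ, integral_const_mul, integral_const_mul]
  linarith

namespace IsRegularEquilibriumDensity
variable {V ρ : ℝ → ℝ} {A B : ℝ}

theorem nonneg (h : IsRegularEquilibriumDensity V ρ A B) (x : ℝ) : 0 ≤ ρ x := by
  by_cases hx : x ∈ Icc A B
  · have : Icc A B ⊆ {x | 0 ≤ ρ x} := by
      rw [← closure_Ioo h.lt.ne]
      exact closure_minimal (fun y hy => (h.pos y hy).le)
        (isClosed_le continuous_const h.continuous)
    exact this hx
  · exact (h.eq_zero x hx).ge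

theorem hasCompactSupport (h : IsRegularEquilibriumDensity V ρ A B) : HasCompactSupport ρ :=
  HasCompactSupport.intro isCompact_Icc h.eq_zero

theorem integral_eq_one (h : IsRegularEquilibriumDensity V ρ A B) : ∫ x, ρ x = 1 :=
  (isProbabilityMeasure_withDensity_ofReal h.continuous h.nonneg h.hasCompactSupport).1
    h.isEquilibrium.1

/-- The Euler–Lagrange conditions for the equilibrium measure. -/
theorem exists_eulerLagrange (h : IsRegularEquilibriumDensity V ρ A B) (hV : Continuous V) :
    ∃ m : ℝ, (∀ x, m ≤ V x - 2 * logPotential ρ x) ∧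
      ∀ x ∈ Icc A B, V x - 2 * logPotential ρ x = m := by
  have hU := continuous_logPotential h.continuous h.hasCompactSupport
  set Ψ : ℝ → ℝ := fun x => V x - 2 * logPotential ρ x with hΨ
  have hΨc : Continuous Ψ := by fun_prop
  have hle : ∀ x, ∫ y, Ψ y * ρ y ≤ Ψ x := by
    intro x
    refine le_of_forall_pos_le_add fun η hη => ?_
    obtain ⟨δ, hδ, hb⟩ := Metric.continuous_iff.1 hΨc x η hη
    -- Testing minimality against a normalized bump concentrated at `x` gives the pointwise
    -- inequality, by continuity of `Ψ`.
    let f : ContDiffBump x := ⟨δ / 2, δ, half_pos hδ, half_lt_self hδ⟩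
    have hf : Continuous (f.normed volume) := f.continuous_normed
    have hfs : HasCompactSupport (f.normed volume) := f.hasCompactSupport_normed
    refine (integral_le_of_isEquilibriumMeasure hV h.continuous h.nonneg h.hasCompactSupport
      h.isEquilibrium hf (fun y => f.nonneg_normed y) hfs f.integral_normed).trans ?_
    calc ∫ y, Ψ y * f.normed volume y ≤ ∫ y, (Ψ x + η) * f.normed volume y := by
          refine integral_mono ((hΨc.mul hf).integrable_of_hasCompactSupport hfs.mul_left)
            ((continuous_const.mul hf).integrable_of_hasCompactSupport hfs.mul_left) fun y => ?_
          by_cases hy : y ∈ Function.support (f.normed volume)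
          · rw [f.support_normed_eq] at hy
            refine mul_le_mul_of_nonneg_right ?_ (f.nonneg_normed y)
            have := (abs_lt.1 (hb y hy)).2
            linarith
          · rw [Function.notMem_support] at hy
            simp [hy]
      _ = Ψ x + η := by rw [integral_const_mul, f.integral_normed, mul_one]
  refine ⟨∫ y, Ψ y * ρ y, hle, ?_⟩
  set m := ∫ y, Ψ y * ρ y with hm
  have hint : ∫ y, (Ψ y - m) * ρ y = 0 := by
    simp only [sub_mul]
    have i1 : Integrable fun y => Ψ y * ρ y := (hΨc.mul
      h.continuous).integrable_of_hasCompactSupport h.hasCompactSupport.mul_left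
    have i2 : Integrable ρ := h.continuous.integrable_of_hasCompactSupport h.hasCompactSupport
    rw [integral_sub i1 (i2.const_mul m), integral_const_mul, h.integral_eq_one]
    simp [hm]
  -- `(Ψ - m) ρ` is continuous, nonnegative and has integral zero, so it vanishes, and `ρ > 0` on
  -- the open interval.
  have hIoo : Ioo A B ⊆ {x | Ψ x = m} := by
    intro x hx
    by_contra hne
    have hc : Continuous fun y => (Ψ y - m) * ρ y := (hΨc.sub continuous_const).mul h.continuous
    have := hc.integral_pos_of_hasCompactSupport_nonneg_nonzero (μ := volume) (x := x)
      h.hasCompactSupport.mul_left (fun y => mul_nonneg (sub_nonneg.2 (hle y)) (h.nonneg y))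
      (mul_ne_zero (sub_ne_zero.2 hne) (h.pos x hx).ne')
    exact this.ne' hint
  have := closure_minimal hIoo (isClosed_eq hΨc continuous_const)
  rw [closure_Ioo h.lt.ne] at this
  exact fun x hx => this hx

end IsRegularEquilibriumDensity

/-! ### Comparison principles for second differences. -/

theorem SecondDiffGE.of_le {E : Type*} [AddCommGroup E] [Module ℝ E] {H K : E → ℝ} {x v : E}
    {m : ℝ} (h : SecondDiffGE K x v m) (hle : ∀ y, K y ≤ H y) (hx : H x = K x) :
    SecondDiffGE H x v m := by
  intro η hη
  filter_upwards [h η hη] with r hr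
  linarith [hle (x + r • v), hle (x - r • v)]

/-- With `q ≤ M`, the function `M y² / 2 - E` is convex on the interval, and midpoint convexity is
the claim. -/
theorem secondDiff_le_of_hasDerivAt {E E₁ q : ℝ → ℝ} (h0 : ∀ x, HasDerivAt E (E₁ x) x)
    (h1 : ∀ x, HasDerivAt E₁ (q x) x) {x h M : ℝ} (hh : 0 ≤ h)
    (hM : ∀ y ∈ Icc (x - h) (x + h), q y ≤ M) :
    E (x + h) + E (x - h) - 2 * E x ≤ M * h ^ 2 := by
  have e1 : ∀ y, HasDerivAt (fun y => M / 2 * y ^ 2 - E y) (M * y - E₁ y) y := fun y =>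
    (((hasDerivAt_pow 2 y).const_mul (M / 2)).sub (h0 y)).congr_deriv (by push_cast; ring)
  have e2 : ∀ y, HasDerivAt (fun y => M * y - E₁ y) (M - q y) y := fun y =>
    (((hasDerivAt_id y).const_mul M).sub (h1 y)).congr_deriv (by ring)
  have d1 : deriv (fun y => M / 2 * y ^ 2 - E y) = fun y => M * y - E₁ y :=
    funext fun y => (e1 y).deriv
  have hc : ConvexOn ℝ (Icc (x - h) (x + h)) fun y => M / 2 * y ^ 2 - E y := by
    apply convexOn_of_deriv2_nonneg' (convex_Icc _ _)
    · exact fun y _ => (e1 y).differentiableAt.differentiableWithinAt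
    · rw [d1]; exact fun y _ => (e2 y).differentiableAt.differentiableWithinAt
    · intro y hy
      simp only [Function.iterate_succ, Function.iterate_zero, Function.comp_apply, id]
      rw [d1, (e2 y).deriv]
      linarith [hM y hy]
  have := hc.2 (left_mem_Icc.2 (by linarith)) (right_mem_Icc.2 (by linarith))
    (by norm_num : (0 : ℝ) ≤ 1 / 2) (by norm_num : (0 : ℝ) ≤ 1 / 2) (by norm_num)
  simp only [smul_eq_mul] at this
  have e : 1 / 2 * (x - h) + 1 / 2 * (x + h) = x := by ring
  rw [e] at this
  nlinarith

theorem le_secondDiff_of_hasDerivAt {E E₁ q : ℝ → ℝ} (h0 : ∀ x, HasDerivAt E (E₁ x) x)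
    (h1 : ∀ x, HasDerivAt E₁ (q x) x) {x h M : ℝ} (hh : 0 ≤ h)
    (hM : ∀ y ∈ Icc (x - h) (x + h), M ≤ q y) :
    M * h ^ 2 ≤ E (x + h) + E (x - h) - 2 * E x := by
  have := secondDiff_le_of_hasDerivAt (fun y => (h0 y).neg) (fun y => (h1 y).neg) (M := -M) hh
    fun y hy => neg_le_neg (hM y hy)
  simp only [Pi.neg_apply] at this
  linarith

theorem ConvexOn.secondDiff_nonneg {f : ℝ → ℝ} (hf : ConvexOn ℝ univ f) (x h : ℝ) :
    0 ≤ f (x + h) + f (x - h) - 2 * f x := by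
  have := hf.2 (mem_univ (x - h)) (mem_univ (x + h))
    (by norm_num : (0 : ℝ) ≤ 1 / 2) (by norm_num : (0 : ℝ) ≤ 1 / 2) (by norm_num)
  simp only [smul_eq_mul] at this
  have e : 1 / 2 * (x - h) + 1 / 2 * (x + h) = x := by ring
  rw [e] at this
  linarith

/-! ### Second differences of the potential off the support -/

/-- Off the support `U'' = -∫ ρ(y) / (x - y)² dy`; any integrable minorant `φ` of that integrand
suffices. This makes `-U` convex off the support (`φ = 0`) and strongly convex near the edges. -/
theorem secondDiffGE_neg_logPotential {ρ φ : ℝ → ℝ} {A B : ℝ} (hρ : Continuous ρ)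
    (hρ0 : ∀ x, 0 ≤ ρ x) (hsupp : ∀ t, t ∉ Icc A B → ρ t = 0) {x : ℝ} (hx : x ∉ Icc A B)
    (hφ : Integrable φ) (hle : ∀ y ∈ Icc A B, φ y ≤ ρ y / (x - y) ^ 2)
    (hle' : ∀ y, y ∉ Icc A B → φ y ≤ 0) :
    SecondDiffGE (fun z => -logPotential ρ z) x 1 (∫ y, φ y) := by
  have hs : HasCompactSupport ρ := HasCompactSupport.intro isCompact_Icc hsupp
  obtain ⟨d, hd, hball⟩ := Metric.isOpen_iff.1 isClosed_Icc.isOpen_compl x hx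
  intro η hη
  filter_upwards [Ioo_mem_nhdsGT hd] with r hr
  have i1 := integrable_log_sub hρ hs (x + r)
  have i2 := integrable_log_sub hρ hs (x - r)
  have i3 := integrable_log_sub hρ hs x
  simp only [smul_eq_mul, mul_one, logPotential]
  have key : r ^ 2 * ∫ y, φ y ≤ ∫ y, (2 * (Real.log (x - y) * ρ y)
      - (Real.log (x + r - y) * ρ y + Real.log (x - r - y) * ρ y)) := by
    rw [← integral_const_mul]
    refine integral_mono (hφ.const_mul _) ((i3.const_mul 2).sub (i1.add i2)) fun y => ?_
    show r ^ 2 * φ y ≤ 2 * (Real.log (x - y) * ρ y)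
      - (Real.log (x + r - y) * ρ y + Real.log (x - r - y) * ρ y)
    by_cases hy : y ∈ Icc A B
    · have hxy : r < |x - y| := by
        by_contra! hcon
        have : y ∈ Metric.ball x d := by
          rw [Metric.mem_ball, dist_comm, Real.dist_eq]; linarith [hr.2]
        exact hball this hy
      have hr2 : r ^ 2 < (x - y) ^ 2 := by
        rw [← sq_abs (x - y)]; exact pow_lt_pow_left₀ hxy hr.1.le two_ne_zero
      have hpos : 0 < (x - y) ^ 2 := lt_of_le_of_lt (sq_nonneg r) hr2
      have hne : x - y ≠ 0 := fun h => by simp [h] at hpos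
      have hprod : (x + r - y) * (x - r - y) = (x - y) ^ 2 - r ^ 2 := by ring
      have hne1 : x + r - y ≠ 0 := fun h => by rw [h] at hprod; linarith
      have hne2 : x - r - y ≠ 0 := fun h => by rw [h] at hprod; linarith
      -- The three logarithms combine to `log (1 - r² / (x - y)²)`, and `log u ≤ u - 1`.
      have e : Real.log (x + r - y) + Real.log (x - r - y) - 2 * Real.log (x - y) ≤
          -(r ^ 2 / (x - y) ^ 2) := by
        rw [← Real.log_mul hne1 hne2, hprod]
        have : 2 * Real.log (x - y) = Real.log ((x - y) ^ 2) := by simp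
        rw [this, ← Real.log_div (by linarith) hpos.ne']
        refine (Real.log_le_sub_one_of_pos (div_pos (by linarith) hpos)).trans (le_of_eq ?_)
        field_simp; ring
      have h1 := mul_le_mul_of_nonneg_left (hle y hy) (sq_nonneg r)
      have h2 := mul_le_mul_of_nonneg_right e (hρ0 y)
      have h3 : r ^ 2 * (ρ y / (x - y) ^ 2) = r ^ 2 / (x - y) ^ 2 * ρ y := by ring
      rw [h3] at h1
      nlinarith
    · rw [hsupp y hy]
      nlinarith [hle' y hy, sq_nonneg r]
  have i12 : Integrable fun y => Real.log (x + r - y) * ρ y + Real.log (x - r - y) * ρ y :=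
    i1.add i2
  rw [integral_sub (i3.const_mul 2) i12, integral_const_mul, integral_add i1 i2] at key
  nlinarith [sq_nonneg r]

/-- Square-root vanishing at the left edge makes `∫ ρ(y) / (x - y)² dy` large near the edge. -/
theorem exists_le_integral_of_sqrt_le {ρ : ℝ → ℝ} {e c r₀ : ℝ} (hρ0 : ∀ x, 0 ≤ ρ x)
    (hc : 0 < c) (hr₀ : 0 < r₀) (hsqrt : ∀ t ∈ Ioo 0 r₀, c * √t ≤ ρ (e + t)) (M : ℝ) :
    ∃ r > 0, ∀ t ∈ Ioo 0 r, ∃ φ : ℝ → ℝ, Integrable φ ∧ M ≤ ∫ y, φ y ∧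
      (∀ y, φ y ≤ ρ y / (e - t - y) ^ 2) ∧ ∀ y, y ∉ Icc (e + t) (e + 2 * t) → φ y = 0 := by
  -- On `[e + t, e + 2t]` the density is at least `c √t` and the distance to `e - t` at most `3t`,
  -- so this piece contributes `c / (9 √t)`, which exceeds `|M| + 1` for `t` below the second bound.
  -- The first bound keeps `2t < r₀`.
  refine ⟨min (r₀ / 2) ((c / (9 * (|M| + 1))) ^ 2), by positivity, fun t ht => ?_⟩
  have ht0 := ht.1
  obtain ⟨ht1, ht2⟩ := lt_min_iff.1 ht.2
  refine ⟨indicator (Icc (e + t) (e + 2 * t)) fun _ => c * √t / (9 * t ^ 2), ?_, ?_, ?_, ?_⟩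
  · exact (integrable_indicator_iff measurableSet_Icc).2 (by simp)
  · rw [integral_indicator measurableSet_Icc, setIntegral_const]
    have hs : 0 < √t := Real.sqrt_pos.2 ht0
    have h1 : √t ≤ c / (9 * (|M| + 1)) := by
      rw [Real.sqrt_le_left (by positivity)]; exact ht2.le
    have e1 : volume.real (Icc (e + t) (e + 2 * t)) = t := by
      rw [Real.volume_real_Icc_of_le (by linarith)]; ring
    rw [e1, smul_eq_mul]
    have e2 : t * (c * √t / (9 * t ^ 2)) = c / (9 * √t) := by
      have hsq : √t * √t = t := Real.mul_self_sqrt ht0.le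
      rw [mul_div_assoc', div_eq_div_iff (by positivity) (by positivity)]
      linear_combination 9 * c * t * hsq
    rw [e2, le_div_iff₀ (by positivity)]
    rw [le_div_iff₀ (by positivity)] at h1
    nlinarith [le_abs_self M]
  · intro y
    by_cases hy : y ∈ Icc (e + t) (e + 2 * t)
    · rw [indicator_of_mem hy]
      have h1 := hsqrt (y - e) ⟨by linarith [hy.1], by linarith [hy.2]⟩
      have h2 : √t ≤ √(y - e) := Real.sqrt_le_sqrt (by linarith [hy.1])
      rw [add_sub_cancel] at h1
      have h3 : 0 < (e - t - y) ^ 2 := by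
        have : e - t - y < 0 := by linarith [hy.1]
        exact sq_pos_iff.2 this.ne
      refine div_le_div₀ (hρ0 y) (le_trans (by gcongr) h1) h3 ?_
      nlinarith [hy.1, hy.2]
    · rw [indicator_of_notMem hy]
      exact div_nonneg (hρ0 y) (sq_nonneg _)
  · intro y hy
    exact indicator_of_notMem hy _

namespace IsRegularEquilibriumDensity
variable {V ρ : ℝ → ℝ} {A B : ℝ}

theorem exists_sqrt_le_left (h : IsRegularEquilibriumDensity V ρ A B) :
    ∃ c > 0, ∃ r > 0, ∀ t ∈ Ioo 0 r, c * √t ≤ ρ (A + t) := by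
  obtain ⟨s, hs, hO⟩ := h.left_edge
  have hto : Tendsto (fun t => t - A) (𝓝[>] A) (𝓝 0) :=
    tendsto_nhdsWithin_of_tendsto_nhds (Continuous.tendsto' (by fun_prop) _ _ (by simp))
  have h1 := (hO.trans_tendsto hto).eventually (Ioi_mem_nhds (show (-1 / 2 : ℝ) < 0 by norm_num))
  obtain ⟨u, hu, hsub⟩ := mem_nhdsGT_iff_exists_Ioo_subset.1 h1
  refine ⟨s / 2, half_pos hs, u - A, sub_pos.2 hu, fun t ht => ?_⟩
  have h2 : -1 / 2 < ρ (A + t) / (s * √(A + t - A)) - 1 :=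
    hsub (show A + t ∈ Ioo A u from ⟨by linarith [ht.1], by linarith [ht.2]⟩)
  rw [add_sub_cancel_left] at h2
  have h3 : 0 < s * √t := mul_pos hs (Real.sqrt_pos.2 ht.1)
  have h4 : 1 / 2 < ρ (A + t) / (s * √t) := by linarith
  rw [lt_div_iff₀ h3] at h4
  linarith

theorem exists_sqrt_le_right (h : IsRegularEquilibriumDensity V ρ A B) :
    ∃ c > 0, ∃ r > 0, ∀ t ∈ Ioo 0 r, c * √t ≤ ρ (B - t) := by
  obtain ⟨s, hs, hO⟩ := h.right_edge
  have hto : Tendsto (fun t => B - t) (𝓝[<] B) (𝓝 0) :=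
    tendsto_nhdsWithin_of_tendsto_nhds (Continuous.tendsto' (by fun_prop) _ _ (by simp))
  have h1 := (hO.trans_tendsto hto).eventually (Ioi_mem_nhds (show (-1 / 2 : ℝ) < 0 by norm_num))
  obtain ⟨u, hu, hsub⟩ := mem_nhdsLT_iff_exists_Ioo_subset.1 h1
  refine ⟨s / 2, half_pos hs, B - u, sub_pos.2 hu, fun t ht => ?_⟩
  have h2 : -1 / 2 < ρ (B - t) / (s * √(B - (B - t))) - 1 :=
    hsub (show B - t ∈ Ioo u B from ⟨by linarith [ht.2], by linarith [ht.1]⟩)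
  rw [sub_sub_cancel] at h2
  have h3 : 0 < s * √t := mul_pos hs (Real.sqrt_pos.2 ht.1)
  have h4 : 1 / 2 < ρ (B - t) / (s * √t) := by linarith
  rw [lt_div_iff₀ h3] at h4
  linarith

/-- Just outside the support the potential is as concave as desired. -/
theorem exists_secondDiffGE_near_edges (h : IsRegularEquilibriumDensity V ρ A B) (M : ℝ) :
    ∃ r > 0, ∀ x, x ∈ Ioo (A - r) A ∨ x ∈ Ioo B (B + r) →
      SecondDiffGE (fun z => -logPotential ρ z) x 1 M := by
  obtain ⟨c, hc, r₀, hr₀, hsq⟩ := h.exists_sqrt_le_left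
  obtain ⟨c', hc', r₀', hr₀', hsq'⟩ := h.exists_sqrt_le_right
  obtain ⟨r, hr, H⟩ := exists_le_integral_of_sqrt_le h.nonneg hc hr₀ hsq M
  -- The right edge is the left edge of the reflected density.
  obtain ⟨r', hr', H'⟩ := exists_le_integral_of_sqrt_le (ρ := fun y => ρ (-y)) (e := -B)
    (fun x => h.nonneg _) hc' hr₀' (fun t ht => by
      have := hsq' t ht
      rwa [show -(-B + t) = B - t by ring]) M
  have hAB : 0 < B - A := sub_pos.2 h.lt
  -- The bound `(B - A) / 2` keeps the intervals `[A + t, A + 2t]` and `[B - 2t, B - t]` inside the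
  -- support.
  refine ⟨min (min r r') ((B - A) / 2), by positivity, fun x hx => ?_⟩
  rcases hx with hx | hx
  · have ht : A - x < min (min r r') ((B - A) / 2) := by linarith [hx.1]
    obtain ⟨ht1, ht2⟩ := lt_min_iff.1 ht
    obtain ⟨φ, hφ, hM, hle, hz⟩ := H (A - x) ⟨by linarith [hx.2], (lt_min_iff.1 ht1).1⟩
    refine (secondDiffGE_neg_logPotential h.continuous h.nonneg h.eq_zero
      (fun hx' => absurd hx'.1 (not_le.2 hx.2)) hφ (fun y _ => ?_) fun y hy => ?_).mono hM
    · simpa using hle y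
    · refine (hz y fun hy' => hy ⟨?_, ?_⟩).le
      · linarith [hy'.1, hx.2]
      · linarith [hy'.2]
  · have ht : x - B < min (min r r') ((B - A) / 2) := by linarith [hx.2]
    obtain ⟨ht1, ht2⟩ := lt_min_iff.1 ht
    obtain ⟨φ, hφ, hM, hle, hz⟩ := H' (x - B) ⟨by linarith [hx.1], (lt_min_iff.1 ht1).2⟩
    refine (secondDiffGE_neg_logPotential (φ := fun y => φ (-y)) h.continuous h.nonneg h.eq_zero
      (fun hx' => absurd hx'.2 (not_le.2 hx.1)) hφ.comp_neg (fun y _ => ?_) fun y hy => ?_).mono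
      (by rwa [integral_neg_eq_self φ volume])
    · have := hle (-y)
      rw [neg_neg] at this
      refine this.trans (le_of_eq ?_)
      congr 1; ring
    · refine (hz _ fun hy' => hy ⟨?_, ?_⟩).le
      · linarith [hy'.2]
      · linarith [hy'.1, hx.1]

end IsRegularEquilibriumDensity

/-! ### A majorant of the logarithmic potential with controlled second derivative. -/

theorem SecondDiffGE.smul_direction {f : ℝ → ℝ} {x : ℝ} (h : SecondDiffGE f x 1 0) (v : ℝ) :
    SecondDiffGE f x v 0 := by
  rcases eq_or_ne v 0 with rfl | hv
  · exact SecondDiffGE.of_isMin (Eventually.of_forall fun r => by simp; linarith)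
  intro η hη
  have hv' : 0 < |v| := abs_pos.2 hv
  have hto : Tendsto (fun r : ℝ => r * |v|) (𝓝[>] 0) (𝓝[>] 0) := by
    refine tendsto_nhdsWithin_iff.2 ⟨tendsto_nhdsWithin_of_tendsto_nhds
      (Continuous.tendsto' (by fun_prop) _ _ (by simp)), ?_⟩
    filter_upwards [self_mem_nhdsWithin] with r hr using mul_pos hr hv'
  filter_upwards [hto.eventually (h (η / v ^ 2) (by positivity))] with r hr
  simp only [smul_eq_mul, mul_one] at hr ⊢
  have e : (0 - η / v ^ 2) * (r * |v|) ^ 2 = (0 - η) * r ^ 2 := by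
    rw [mul_pow, sq_abs]; field_simp; ring
  rw [e] at hr
  rcases abs_cases v with ⟨h1, -⟩ | ⟨h1, -⟩
  · rwa [h1] at hr
  · rw [h1] at hr
    have e1 : x + r * -v = x - r * v := by ring
    have e2 : x - r * -v = x + r * v := by ring
    rw [e1, e2] at hr
    linarith

/-- The extension of `q|[A, B]` to `ℝ` decaying linearly to zero at distance `r`. -/
noncomputable def edgeExtension (q : ℝ → ℝ) (A B r x : ℝ) : ℝ :=
  q (max A (min x B)) * max 0 (1 - |x - max A (min x B)| / r)

section
variable {q : ℝ → ℝ} {A B r : ℝ}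

theorem continuous_edgeExtension (hq : Continuous q) : Continuous (edgeExtension q A B r) := by
  unfold edgeExtension
  fun_prop

theorem edgeExtension_of_mem {x : ℝ} (hx : x ∈ Icc A B) : edgeExtension q A B r x = q x := by
  simp [edgeExtension, min_eq_left hx.2, max_eq_right hx.1]

theorem edgeExtension_of_far (hr : 0 < r) (hAB : A ≤ B) {x : ℝ}
    (hx : x ∉ Icc A B) (hx1 : x ∉ Ioo (A - r) A) (hx2 : x ∉ Ioo B (B + r)) :
    edgeExtension q A B r x = 0 := by
  have h0 : 1 - |x - max A (min x B)| / r ≤ 0 := by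
    rw [sub_nonpos, le_div_iff₀ hr, one_mul]
    rcases lt_or_ge x A with h | h
    · rw [min_eq_left (by linarith), max_eq_left h.le, abs_of_neg (by linarith)]
      by_contra! hcon
      exact hx1 ⟨by linarith, h⟩
    · have hB : B < x := by
        by_contra! hcon
        exact hx ⟨h, hcon⟩
      rw [min_eq_right hB.le, max_eq_right hAB, abs_of_pos (by linarith)]
      by_contra! hcon
      exact hx2 ⟨hB, by linarith⟩
  simp [edgeExtension, max_eq_left h0]

theorem hasCompactSupport_edgeExtension (hr : 0 < r) (hAB : A ≤ B) :
    HasCompactSupport (edgeExtension q A B r) := by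
  refine HasCompactSupport.intro (isCompact_Icc (a := A - r) (b := B + r)) fun x hx => ?_
  refine edgeExtension_of_far hr hAB (fun h => hx ⟨by linarith [h.1], by linarith [h.2]⟩)
    (fun h => hx ⟨by linarith [h.1], by linarith [h.2]⟩)
    (fun h => hx ⟨by linarith [h.1], by linarith [h.2]⟩)

/-- The extension multiplies a value of `q` by a factor in `[0, 1]`, and `-W ≤ 0`. -/
theorem le_edgeExtension {W : ℝ} (hW : 0 ≤ W) (hr : 0 < r) (hq : ∀ x, -W ≤ q x) (x : ℝ) :
    -W ≤ edgeExtension q A B r x := by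
  have h1 : 0 ≤ max 0 (1 - |x - max A (min x B)| / r) := le_max_left _ _
  have h2 : max 0 (1 - |x - max A (min x B)| / r) ≤ 1 := by
    refine max_le zero_le_one ?_
    have : 0 ≤ |x - max A (min x B)| / r := by positivity
    linarith
  unfold edgeExtension
  nlinarith [hq (max A (min x B))]

end

namespace IsRegularEquilibriumDensity
variable {V ρ : ℝ → ℝ} {A B W : ℝ}

/-- The potential of the equilibrium measure is, up to a concave function, a function whose second
derivative is a compactly supported extension of `V'' / 2` from `[A, B]`. -/
theorem exists_majorant (h : IsRegularEquilibriumDensity V ρ A B) (hV : ContDiff ℝ 2 V)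
    (hW : 0 ≤ W) (hVW : ∀ x, -2 * W ≤ deriv (deriv V) x) :
    ∃ E E₁ q : ℝ → ℝ, (∀ x, HasDerivAt E (E₁ x) x) ∧ (∀ x, HasDerivAt E₁ (q x) x) ∧
      Continuous q ∧ HasCompactSupport q ∧ (∀ x ∈ Icc A B, q x = deriv (deriv V) x / 2) ∧
      ∀ x r, logPotential ρ (x + r) + logPotential ρ (x - r) - 2 * logPotential ρ x ≤
        E (x + r) + E (x - r) - 2 * E x := by
  have hU := continuous_logPotential h.continuous h.hasCompactSupport
  obtain ⟨m, hm, hm'⟩ := h.exists_eulerLagrange hV.continuous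
  obtain ⟨r, hr, hedge⟩ := h.exists_secondDiffGE_near_edges W
  have hV1 : ContDiff ℝ 1 (deriv V) := hV.deriv'
  have hV2 : Continuous (deriv (deriv V)) := hV1.continuous_deriv_one
  have d0 : ∀ x, HasDerivAt V (deriv V x) x := fun x =>
    (hV.differentiable (by norm_num) x).hasDerivAt
  have d1 : ∀ x, HasDerivAt (deriv V) (deriv (deriv V) x) x := fun x =>
    (hV1.differentiable (by norm_num) x).hasDerivAt
  set q : ℝ → ℝ := edgeExtension (fun x => deriv (deriv V) x / 2) A B r with hq
  have hqc : Continuous q := continuous_edgeExtension (by fun_prop)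
  have hqW : ∀ x, -W ≤ q x := le_edgeExtension hW hr fun x => by linarith [hVW x]
  have hqeq : ∀ x ∈ Icc A B, q x = deriv (deriv V) x / 2 := fun x hx => edgeExtension_of_mem hx
  set E₁ : ℝ → ℝ := fun y => deriv V A / 2 + ∫ z in A..y, q z with hE₁
  have e1 : ∀ x, HasDerivAt E₁ (q x) x := fun x =>
    ((hqc.integral_hasStrictDerivAt A x).hasDerivAt).const_add _
  have hE₁c : Continuous E₁ := continuous_iff_continuousAt.2 fun x => (e1 x).continuousAt
  -- The constants of integration, with `m` the Euler–Lagrange constant, make `E = (V - m) / 2` on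
  -- `[A, B]`, which is `U` there.
  set E : ℝ → ℝ := fun x => (V A - m) / 2 + ∫ y in A..x, E₁ y with hE
  have e0 : ∀ x, HasDerivAt E (E₁ x) x := fun x =>
    ((hE₁c.integral_hasStrictDerivAt A x).hasDerivAt).const_add _
  have hE₁eq : ∀ x ∈ Icc A B, E₁ x = deriv V x / 2 := by
    intro x hx
    have : ∫ z in A..x, q z = ∫ z in A..x, deriv (deriv V) z / 2 := by
      refine intervalIntegral.integral_congr fun z hz => ?_
      rw [uIcc_of_le hx.1] at hz
      exact hqeq z ⟨hz.1, hz.2.trans hx.2⟩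
    simp only [hE₁]
    rw [this, intervalIntegral.integral_div, intervalIntegral.integral_eq_sub_of_hasDerivAt
      (fun z _ => d1 z) (hV2.intervalIntegrable _ _)]
    ring
  have hEeq : ∀ x ∈ Icc A B, E x = (V x - m) / 2 := by
    intro x hx
    have : ∫ z in A..x, E₁ z = ∫ z in A..x, deriv V z / 2 := by
      refine intervalIntegral.integral_congr fun z hz => ?_
      rw [uIcc_of_le hx.1] at hz
      exact hE₁eq z ⟨hz.1, hz.2.trans hx.2⟩
    simp only [hE]
    rw [this, intervalIntegral.integral_div, intervalIntegral.integral_eq_sub_of_hasDerivAt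
      (fun z _ => d0 z) (hV1.continuous.intervalIntegrable _ _)]
    ring
  -- Three regions. On the support `E - U` is touched from below by `E - (V - m) / 2`, whose second
  -- derivative at `x` vanishes. Within distance `r` of the edges, the second differences of `-U`
  -- are at least `W`, which compensates `q ≥ -W`. Farther out `q = 0` and `-U` is convex.
  have hsd : ∀ x, SecondDiffGE (fun y => E y + -logPotential ρ y) x 1 0 := by
    intro x
    by_cases hx : x ∈ Icc A B
    · have hK : SecondDiffGE (fun y => E y - (V y - m) / 2) x 1 0 := by
        refine SecondDiffGE.of_hasDerivAt (h' := fun y => E₁ y - deriv V y / 2)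
          (Eventually.of_forall fun y => (e0 y).sub (((d0 y).sub_const m).div_const 2)) ?_
        exact ((e1 x).sub ((d1 x).div_const 2)).congr_deriv (by rw [hqeq x hx]; ring)
      refine hK.of_le (fun y => ?_) ?_
      · linarith [hm y]
      · linarith [hm' x hx]
    · have hE2 : SecondDiffGE E x 1 (q x) :=
        SecondDiffGE.of_hasDerivAt (Eventually.of_forall e0) (e1 x)
      by_cases hx' : x ∈ Ioo (A - r) A ∨ x ∈ Ioo B (B + r)
      · exact (hE2.add (hedge x hx')).mono (by linarith [hqW x])
      · rw [not_or] at hx'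
        have hq0 : q x = 0 := edgeExtension_of_far hr h.lt.le hx hx'.1 hx'.2
        have := secondDiffGE_neg_logPotential (φ := fun _ => 0) h.continuous h.nonneg h.eq_zero hx
          (integrable_zero _ _ _) (fun y _ => div_nonneg (h.nonneg y) (sq_nonneg _))
          fun _ _ => le_rfl
        exact (hE2.add this).mono (by simp [hq0])
  have hEc : Continuous E := continuous_iff_continuousAt.2 fun x => (e0 x).continuousAt
  have hconv : ConvexOn ℝ univ fun y => E y + -logPotential ρ y :=
    convexOn_of_secondDiffGE convex_univ (hEc.add hU.neg).continuousOn
      fun x _ v => (hsd x).smul_direction v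
  refine ⟨E, E₁, q, e0, e1, hqc, hasCompactSupport_edgeExtension hr h.lt.le, hqeq, fun x s => ?_⟩
  have := ConvexOn.secondDiff_nonneg hconv x s
  linarith

end IsRegularEquilibriumDensity

/-! ### The Poisson formula for the logarithmic potential -/

theorem periodic_log_sin : Function.Periodic (fun x => Real.log (Real.sin x)) Real.pi := by
  intro x
  simp [Real.sin_add_pi]

theorem intervalIntegrable_log_sin_sub (a b c : ℝ) :
    IntervalIntegrable (fun φ => Real.log (Real.sin (c - φ))) volume a b := by
  have h : IntervalIntegrable (fun x => Real.log (Real.sin x)) volume (c - a) (c - b) :=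
    intervalIntegrable_log_sin
  simpa using h.comp_sub_left c

/-- The interval is a full period of `log |sin|`, so the shift is irrelevant. The function `F` is
used as the identity for the exact formula and as the absolute value for domination. -/
theorem integral_comp_log_sin_sub (F : ℝ → ℝ) (c : ℝ) :
    ∫ φ in -(Real.pi / 2)..(Real.pi / 2), F (Real.log (Real.sin (c - φ))) =
      ∫ φ in 0..Real.pi, F (Real.log (Real.sin φ)) := by
  have hp : Function.Periodic (fun x => F (Real.log (Real.sin x))) Real.pi := fun x => by
    have := periodic_log_sin x
    simp only at this
    simp only [this]
  rw [intervalIntegral.integral_comp_sub_left (fun x => F (Real.log (Real.sin x)))]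
  have := hp.intervalIntegral_add_eq (c - Real.pi / 2) 0
  rw [zero_add] at this
  rw [← this]
  congr 1
  ring

/-- `t - δ tan φ = √(t² + δ²) sin (arctan (t/δ) - φ) / cos φ`. The two trigonometric logarithms have
the same integral over a period, leaving the Poisson formula. -/
theorem log_sub_mul_tan {δ t φ : ℝ} (hδ : 0 < δ)
    (hφ : φ ∈ Ioo (-(Real.pi / 2)) (Real.pi / 2)) (hne : Real.sin (Real.arctan (t / δ) - φ) ≠ 0) :
    Real.log (t - δ * Real.tan φ) = Real.log (t ^ 2 + δ ^ 2) / 2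
      + Real.log (Real.sin (Real.arctan (t / δ) - φ)) - Real.log (Real.sin (Real.pi / 2 - φ)) := by
  rw [Real.sin_pi_div_two_sub]
  have hc : 0 < Real.cos φ := Real.cos_pos_of_mem_Ioo hφ
  have hs : 0 < √(1 + (t / δ) ^ 2) := Real.sqrt_pos.2 (by positivity)
  have e : t - δ * Real.tan φ =
      √(t ^ 2 + δ ^ 2) * Real.sin (Real.arctan (t / δ) - φ) / Real.cos φ := by
    have h1 : √(t ^ 2 + δ ^ 2) = δ * √(1 + (t / δ) ^ 2) := by
      rw [show t ^ 2 + δ ^ 2 = δ ^ 2 * (1 + (t / δ) ^ 2) by field_simp; ring,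
        Real.sqrt_mul (sq_nonneg δ), Real.sqrt_sq hδ.le]
    rw [h1, Real.sin_sub, Real.sin_arctan, Real.cos_arctan, Real.tan_eq_sin_div_cos]
    field_simp
  rw [e, Real.log_div (mul_ne_zero (Real.sqrt_pos.2 (by positivity)).ne' hne) hc.ne',
    Real.log_mul (Real.sqrt_pos.2 (by positivity)).ne' hne, Real.log_sqrt (by positivity)]

theorem ae_log_sub_mul_tan {δ : ℝ} (hδ : 0 < δ) (t : ℝ) :
    ∀ᵐ φ ∂(volume.restrict (Ioc (-(Real.pi / 2)) (Real.pi / 2))),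
      Real.log (t - δ * Real.tan φ) = Real.log (t ^ 2 + δ ^ 2) / 2
      + Real.log (Real.sin (Real.arctan (t / δ) - φ)) - Real.log (Real.sin (Real.pi / 2 - φ)) := by
  rw [ae_restrict_iff' measurableSet_Ioc]
  have h1 : ∀ᵐ φ : ℝ, φ ≠ Real.pi / 2 := by simp [ae_iff]
  have h2 : ∀ᵐ φ : ℝ, φ ≠ Real.arctan (t / δ) := by simp [ae_iff]
  filter_upwards [h1, h2] with φ h1 h2 hφ
  have hφ' : φ ∈ Ioo (-(Real.pi / 2)) (Real.pi / 2) := ⟨hφ.1, lt_of_le_of_ne hφ.2 h1⟩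
  refine log_sub_mul_tan hδ hφ' fun h0 => h2 ?_
  have b1 := Real.neg_pi_div_two_lt_arctan (t / δ)
  have b2 := Real.arctan_lt_pi_div_two (t / δ)
  have := (Real.sin_eq_zero_iff_of_lt_of_lt (by linarith [hφ'.2]) (by linarith [hφ'.1])).1 h0
  linarith

theorem intervalIntegrable_log_sub_mul_tan {δ : ℝ} (hδ : 0 < δ) (t : ℝ) :
    IntervalIntegrable (fun φ => Real.log (t - δ * Real.tan φ)) volume
      (-(Real.pi / 2)) (Real.pi / 2) := by
  have h : IntervalIntegrable (fun φ => Real.log (t ^ 2 + δ ^ 2) / 2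
      + Real.log (Real.sin (Real.arctan (t / δ) - φ)) - Real.log (Real.sin (Real.pi / 2 - φ)))
      volume (-(Real.pi / 2)) (Real.pi / 2) :=
    (intervalIntegrable_const.add (intervalIntegrable_log_sin_sub _ _ _)).sub
      (intervalIntegrable_log_sin_sub _ _ _)
  rw [intervalIntegrable_iff_integrableOn_Ioc_of_le (by linarith [Real.pi_pos])] at h ⊢
  exact h.congr ((ae_log_sub_mul_tan hδ t).mono fun φ hφ => hφ.symm)

theorem integral_log_sub_mul_tan {δ : ℝ} (hδ : 0 < δ) (t : ℝ) :
    ∫ φ in -(Real.pi / 2)..(Real.pi / 2), Real.log (t - δ * Real.tan φ) =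
      Real.pi * (Real.log (t ^ 2 + δ ^ 2) / 2) := by
  have hle : -(Real.pi / 2) ≤ Real.pi / 2 := by linarith [Real.pi_pos]
  have e : ∫ φ in -(Real.pi / 2)..(Real.pi / 2), Real.log (t - δ * Real.tan φ) =
      ∫ φ in -(Real.pi / 2)..(Real.pi / 2), (Real.log (t ^ 2 + δ ^ 2) / 2
      + Real.log (Real.sin (Real.arctan (t / δ) - φ)) - Real.log (Real.sin (Real.pi / 2 - φ))) := by
    rw [intervalIntegral.integral_of_le hle, intervalIntegral.integral_of_le hle]
    exact integral_congr_ae (ae_log_sub_mul_tan hδ t)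
  have i1 := intervalIntegrable_log_sin_sub (-(Real.pi / 2)) (Real.pi / 2) (Real.arctan (t / δ))
  have i2 := intervalIntegrable_log_sin_sub (-(Real.pi / 2)) (Real.pi / 2) (Real.pi / 2)
  have j1 := integral_comp_log_sin_sub id (Real.arctan (t / δ))
  have j2 := integral_comp_log_sin_sub id (Real.pi / 2)
  simp only [id] at j1 j2
  rw [e, intervalIntegral.integral_sub (intervalIntegrable_const.add i1) i2,
    intervalIntegral.integral_add intervalIntegrable_const i1, j1, j2,
    intervalIntegral.integral_const, smul_eq_mul]
  ring

/-- The bound is continuous in `t`, which supplies the domination needed for Fubini in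
`integrable_log_tan_prod`. -/
theorem integral_abs_log_sub_mul_tan_le {δ : ℝ} (hδ : 0 < δ) (t : ℝ) :
    ∫ φ in -(Real.pi / 2)..(Real.pi / 2), |Real.log (t - δ * Real.tan φ)| ≤
      Real.pi * |Real.log (t ^ 2 + δ ^ 2) / 2|
        + 2 * ∫ φ in 0..Real.pi, |Real.log (Real.sin φ)| := by
  have hle : -(Real.pi / 2) ≤ Real.pi / 2 := by linarith [Real.pi_pos]
  have i1 := (intervalIntegrable_log_sin_sub (-(Real.pi / 2)) (Real.pi / 2)
    (Real.arctan (t / δ))).abs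
  have i2 := (intervalIntegrable_log_sin_sub (-(Real.pi / 2)) (Real.pi / 2) (Real.pi / 2)).abs
  have j1 := integral_comp_log_sin_sub (fun x => |x|) (Real.arctan (t / δ))
  have j2 := integral_comp_log_sin_sub (fun x => |x|) (Real.pi / 2)
  calc _ ≤ ∫ φ in -(Real.pi / 2)..(Real.pi / 2), (|Real.log (t ^ 2 + δ ^ 2) / 2|
      + |Real.log (Real.sin (Real.arctan (t / δ) - φ))|
      + |Real.log (Real.sin (Real.pi / 2 - φ))|) := by
        refine intervalIntegral.integral_mono_ae_restrict hle
          (intervalIntegrable_log_sub_mul_tan hδ t).abs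
          ((intervalIntegrable_const.add i1).add i2) ?_
        rw [← restrict_Ioc_eq_restrict_Icc]
        filter_upwards [ae_log_sub_mul_tan hδ t] with φ hφ
        rw [hφ]
        exact (abs_sub _ _).trans (add_le_add_left (abs_add_le _ _) _)
    _ = _ := by
        rw [intervalIntegral.integral_add (intervalIntegrable_const.add i1) i2,
          intervalIntegral.integral_add intervalIntegrable_const i1, j1, j2,
          intervalIntegral.integral_const, smul_eq_mul]
        ring

/-- `∫ ½ log ((x - y)² + δ²) ρ(y) dy`, the harmonic extension of the logarithmic potential. -/
noncomputable def smoothPotential (ρ : ℝ → ℝ) (δ x : ℝ) : ℝ :=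
  ∫ y, Real.log ((x - y) ^ 2 + δ ^ 2) / 2 * ρ y

theorem integrable_log_tan_prod {ρ : ℝ → ℝ} {δ : ℝ} (hρ : Continuous ρ)
    (hρs : HasCompactSupport ρ) (hδ : 0 < δ) (x : ℝ) :
    Integrable (fun p : ℝ × ℝ => Real.log (x - δ * Real.tan p.1 - p.2) * ρ p.2)
      ((volume.restrict (Ioc (-(Real.pi / 2)) (Real.pi / 2))).prod volume) := by
  have hle : -(Real.pi / 2) ≤ Real.pi / 2 := by linarith [Real.pi_pos]
  have htan : Measurable Real.tan := by
    have : Real.tan = fun x => Real.sin x / Real.cos x := funext Real.tan_eq_sin_div_cos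
    rw [this]; fun_prop
  have hmeas : Measurable fun p : ℝ × ℝ => Real.log (x - δ * Real.tan p.1 - p.2) * ρ p.2 := by
    refine Measurable.mul (Real.measurable_log.comp ?_) (hρ.measurable.comp measurable_snd)
    exact (measurable_const.sub ((htan.comp measurable_fst).const_mul δ)).sub measurable_snd
  have hcomm : ∀ φ y, x - δ * Real.tan φ - y = x - y - δ * Real.tan φ := fun φ y => by ring
  rw [integrable_prod_iff' hmeas.aestronglyMeasurable]
  refine ⟨Eventually.of_forall fun y => ?_, ?_⟩
  · simp only [hcomm]
    have := intervalIntegrable_log_sub_mul_tan hδ (x - y)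
    rw [intervalIntegrable_iff_integrableOn_Ioc_of_le hle] at this
    exact this.mul_const _
  · have hc : Continuous fun y => (Real.pi * |Real.log ((x - y) ^ 2 + δ ^ 2) / 2|
        + 2 * ∫ φ in 0..Real.pi, |Real.log (Real.sin φ)|) * |ρ y| := by
      have : ∀ y, (x - y) ^ 2 + δ ^ 2 ≠ 0 := fun y => by positivity
      fun_prop (disch := assumption)
    refine (hc.integrable_of_hasCompactSupport hρs.abs.mul_left (μ := volume)).mono'
      ?_ (Eventually.of_forall fun y => ?_)
    · exact (hmeas.norm.stronglyMeasurable.integral_prod_left).aestronglyMeasurable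
    · simp only [hcomm, norm_mul, Real.norm_eq_abs]
      rw [integral_mul_const, abs_mul, abs_abs, abs_of_nonneg (integral_nonneg fun _ => abs_nonneg _)]
      refine mul_le_mul_of_nonneg_right ?_ (abs_nonneg _)
      rw [← intervalIntegral.integral_of_le hle]
      exact integral_abs_log_sub_mul_tan_le hδ (x - y)

theorem intervalIntegrable_logPotential_tan {ρ : ℝ → ℝ} {δ : ℝ} (hρ : Continuous ρ)
    (hρs : HasCompactSupport ρ) (hδ : 0 < δ) (x : ℝ) :
    IntervalIntegrable (fun φ => logPotential ρ (x - δ * Real.tan φ)) volume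
      (-(Real.pi / 2)) (Real.pi / 2) := by
  rw [intervalIntegrable_iff_integrableOn_Ioc_of_le (by linarith [Real.pi_pos])]
  exact (integrable_log_tan_prod hρ hρs hδ x).integral_prod_left

/-- In the variable `y = δ tan φ` the Poisson kernel at height `δ` becomes `dφ / π`; the formula for
a single logarithm is integrated against `ρ`. -/
theorem integral_logPotential_tan {ρ : ℝ → ℝ} {δ : ℝ} (hρ : Continuous ρ)
    (hρs : HasCompactSupport ρ) (hδ : 0 < δ) (x : ℝ) :
    ∫ φ in -(Real.pi / 2)..(Real.pi / 2), logPotential ρ (x - δ * Real.tan φ) =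
      Real.pi * smoothPotential ρ δ x := by
  have hle : -(Real.pi / 2) ≤ Real.pi / 2 := by linarith [Real.pi_pos]
  rw [intervalIntegral.integral_of_le hle]
  simp only [logPotential]
  rw [integral_integral_swap (integrable_log_tan_prod hρ hρs hδ x), smoothPotential,
    ← integral_const_mul]
  congr 1; ext y
  have hcomm : ∀ φ, x - δ * Real.tan φ - y = x - y - δ * Real.tan φ := fun φ => by ring
  simp only [hcomm]
  rw [integral_mul_const, ← intervalIntegral.integral_of_le hle, integral_log_sub_mul_tan hδ]
  ring

/-! ### The regularized kernels -/

/-- `1 / (t² + δ²)`. -/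
noncomputable def cauchyKernel (δ t : ℝ) : ℝ := 1 / (t ^ 2 + δ ^ 2)

/-- `-Re (t + iδ)⁻²`, up to sign the second derivative of `½ log (t² + δ²)`. -/
noncomputable def conjKernel (δ t : ℝ) : ℝ := (t ^ 2 - δ ^ 2) / (t ^ 2 + δ ^ 2) ^ 2

section
variable {δ : ℝ}

theorem cauchyKernel_pos (hδ : 0 < δ) (t : ℝ) : 0 < cauchyKernel δ t := by
  unfold cauchyKernel; positivity

theorem cauchyKernel_le (hδ : 0 < δ) (t : ℝ) : cauchyKernel δ t ≤ 1 / δ ^ 2 := by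
  unfold cauchyKernel
  exact one_div_le_one_div_of_le (by positivity) (by nlinarith [sq_nonneg t])

theorem conjKernel_eq (hδ : 0 < δ) (t : ℝ) :
    conjKernel δ t = cauchyKernel δ t - 2 * δ ^ 2 * cauchyKernel δ t ^ 2 := by
  have : t ^ 2 + δ ^ 2 ≠ 0 := by positivity
  unfold conjKernel cauchyKernel
  field_simp; ring

theorem conjKernel_le (hδ : 0 < δ) (t : ℝ) : conjKernel δ t ≤ cauchyKernel δ t := by
  rw [conjKernel_eq hδ]
  have := sq_nonneg (δ * cauchyKernel δ t)
  nlinarith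

/-- The difference factors as `(t - s) (t + s)` times the two kernels, and `|u| / (u² + δ²) ≤ 1 /
(2δ)`. -/
theorem abs_cauchyKernel_sub_le (hδ : 0 < δ) (s t : ℝ) :
    |cauchyKernel δ s - cauchyKernel δ t| ≤ 1 / δ ^ 3 * |s - t| := by
  have hb : ∀ u : ℝ, |u| * cauchyKernel δ u ≤ 1 / (2 * δ) := by
    intro u
    unfold cauchyKernel
    rw [mul_one_div, div_le_div_iff₀ (by positivity) (by positivity)]
    nlinarith [sq_nonneg (|u| - δ), sq_abs u]
  have e : cauchyKernel δ s - cauchyKernel δ t =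
      (t - s) * ((t + s) * (cauchyKernel δ s * cauchyKernel δ t)) := by
    have : s ^ 2 + δ ^ 2 ≠ 0 := by positivity
    have : t ^ 2 + δ ^ 2 ≠ 0 := by positivity
    unfold cauchyKernel
    field_simp; ring
  have ps := cauchyKernel_pos hδ s
  have pt := cauchyKernel_pos hδ t
  rw [e, abs_mul, abs_sub_comm t s, mul_comm (1 / δ ^ 3)]
  refine mul_le_mul_of_nonneg_left ?_ (abs_nonneg _)
  rw [abs_mul, abs_of_pos (mul_pos ps pt)]
  calc |t + s| * (cauchyKernel δ s * cauchyKernel δ t)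
      ≤ (|t| + |s|) * (cauchyKernel δ s * cauchyKernel δ t) :=
        mul_le_mul_of_nonneg_right (abs_add_le _ _) (mul_pos ps pt).le
    _ = (|t| * cauchyKernel δ t) * cauchyKernel δ s + (|s| * cauchyKernel δ s) * cauchyKernel δ t := by
        ring
    _ ≤ 1 / (2 * δ) * (1 / δ ^ 2) + 1 / (2 * δ) * (1 / δ ^ 2) :=
        add_le_add (mul_le_mul (hb t) (cauchyKernel_le hδ s) ps.le (by positivity))
          (mul_le_mul (hb s) (cauchyKernel_le hδ t) pt.le (by positivity))
    _ = 1 / δ ^ 3 := by field_simp; ring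

/-- By `conjKernel_eq` the kernel is a polynomial in `cauchyKernel`, and the extra factor in the
difference lies in `[-3, 1]`; the constant `5` is generous. -/
theorem abs_conjKernel_sub_le (hδ : 0 < δ) (s t : ℝ) :
    |conjKernel δ s - conjKernel δ t| ≤ 5 / δ ^ 3 * |s - t| := by
  have h := abs_cauchyKernel_sub_le hδ s t
  have ps := cauchyKernel_pos hδ s
  have pt := cauchyKernel_pos hδ t
  have bs := cauchyKernel_le hδ s
  have bt := cauchyKernel_le hδ t
  rw [conjKernel_eq hδ, conjKernel_eq hδ]
  have e : cauchyKernel δ s - 2 * δ ^ 2 * cauchyKernel δ s ^ 2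
      - (cauchyKernel δ t - 2 * δ ^ 2 * cauchyKernel δ t ^ 2) =
      (cauchyKernel δ s - cauchyKernel δ t)
        * (1 - 2 * (δ ^ 2 * cauchyKernel δ s + δ ^ 2 * cauchyKernel δ t)) := by ring
  have hδ2 : 0 < δ ^ 2 := by positivity
  have b1 : δ ^ 2 * cauchyKernel δ s ≤ 1 := by
    rw [le_div_iff₀ hδ2] at bs; linarith
  have b2 : δ ^ 2 * cauchyKernel δ t ≤ 1 := by
    rw [le_div_iff₀ hδ2] at bt; linarith
  have p1 := mul_pos hδ2 ps
  have p2 := mul_pos hδ2 pt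
  rw [e, abs_mul]
  calc _ ≤ (1 / δ ^ 3 * |s - t|) * 5 := by
        refine mul_le_mul h (abs_le.2 ⟨?_, ?_⟩) (abs_nonneg _) (by positivity) <;> linarith
    _ = _ := by ring

theorem continuous_conjKernel (hδ : 0 < δ) : Continuous (conjKernel δ) := by
  have : ∀ t : ℝ, (t ^ 2 + δ ^ 2) ^ 2 ≠ 0 := fun t => by positivity
  unfold conjKernel
  fun_prop (disch := assumption)

theorem hasDerivAt_log_sq_add_sq (hδ : 0 < δ) (t : ℝ) :
    HasDerivAt (fun t => Real.log (t ^ 2 + δ ^ 2) / 2) (t / (t ^ 2 + δ ^ 2)) t := by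
  have h : t ^ 2 + δ ^ 2 ≠ 0 := by positivity
  have := ((((hasDerivAt_pow 2 t).add_const (δ ^ 2)).log h).div_const 2)
  exact this.congr_deriv (by field_simp; simp; ring)

theorem hasDerivAt_div_sq_add_sq (hδ : 0 < δ) (t : ℝ) :
    HasDerivAt (fun t => t / (t ^ 2 + δ ^ 2)) (-conjKernel δ t) t := by
  have h : t ^ 2 + δ ^ 2 ≠ 0 := by positivity
  have := (hasDerivAt_id t).div ((hasDerivAt_pow 2 t).add_const (δ ^ 2)) h
  refine this.congr_deriv ?_
  unfold conjKernel
  simp only [id, Nat.cast_ofNat]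
  field_simp; ring

end

/-! ### Second derivative of the regularized potential and its bound on the support. -/

theorem secondDiffGE_smoothPotential {ρ : ℝ → ℝ} {δ : ℝ} (hρ : Continuous ρ) (hρ0 : ∀ x, 0 ≤ ρ x)
    (hρs : HasCompactSupport ρ) (hρ1 : ∫ x, ρ x = 1) (hδ : 0 < δ) (x : ℝ) :
    SecondDiffGE (smoothPotential ρ δ) x 1 (-∫ y, conjKernel δ (x - y) * ρ y) := by
  intro η hη
  have hL : 0 < 5 / δ ^ 3 := by positivity
  -- The Lipschitz constant of `conjKernel δ` turns `r < η / L` into an error `η` uniform in `y`,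
  -- which integrates to `η` because `ρ` has mass one.
  filter_upwards [Ioo_mem_nhdsGT (div_pos hη hL)] with r hr
  have hi : ∀ z, Integrable fun y => Real.log ((z - y) ^ 2 + δ ^ 2) / 2 * ρ y := fun z => by
    have : ∀ y, (z - y) ^ 2 + δ ^ 2 ≠ 0 := fun y => by positivity
    have hc : Continuous fun y => Real.log ((z - y) ^ 2 + δ ^ 2) / 2 * ρ y := by
      fun_prop (disch := assumption)
    exact hc.integrable_of_hasCompactSupport hρs.mul_left
  have hk : Integrable fun y => conjKernel δ (x - y) * ρ y := by
    have := continuous_conjKernel hδ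
    have hc : Continuous fun y => conjKernel δ (x - y) * ρ y := by fun_prop
    exact hc.integrable_of_hasCompactSupport hρs.mul_left
  have hρi := hρ.integrable_of_hasCompactSupport hρs (μ := volume)
  simp only [smul_eq_mul, mul_one, smoothPotential]
  have i12 : Integrable fun y => Real.log ((x + r - y) ^ 2 + δ ^ 2) / 2 * ρ y +
    Real.log ((x - r - y) ^ 2 + δ ^ 2) / 2 * ρ y := (hi (x + r)).add (hi (x - r))
  rw [← integral_add (hi _) (hi _), ← integral_const_mul 2, ← integral_sub i12 ((hi x).const_mul 2)]
  have hneg : Integrable fun y => -(conjKernel δ (x - y) * ρ y) := hk.neg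
  have e : (-(∫ y, conjKernel δ (x - y) * ρ y) - η) * r ^ 2 =
      ∫ y, r ^ 2 * (-(conjKernel δ (x - y) * ρ y) - η * ρ y) := by
    rw [integral_const_mul, integral_sub hneg (hρi.const_mul η), integral_const_mul, hρ1,
      integral_neg]
    ring
  rw [e]
  refine integral_mono ((hneg.sub (hρi.const_mul η)).const_mul _)
    (i12.sub ((hi x).const_mul 2)) fun y => ?_
  have key := le_secondDiff_of_hasDerivAt (hasDerivAt_log_sq_add_sq hδ)
    (hasDerivAt_div_sq_add_sq hδ) (x := x - y) (M := -conjKernel δ (x - y) - η) hr.1.le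
    fun z hz => by
      have h1 := (abs_le.1 (abs_conjKernel_sub_le hδ z (x - y))).2
      have h2 : |z - (x - y)| ≤ r := abs_le.2 ⟨by linarith [hz.1], by linarith [hz.2]⟩
      have h3 := mul_le_mul_of_nonneg_left (h2.trans hr.2.le) hL.le
      rw [mul_div_cancel₀ _ hL.ne'] at h3
      linarith
  have h4 := mul_le_mul_of_nonneg_right key (hρ0 y)
  have e1 : x - y + r = x + r - y := by ring
  have e2 : x - y - r = x - r - y := by ring
  rw [e1, e2] at h4
  simp only
  linarith

namespace IsRegularEquilibriumDensity
variable {V ρ : ℝ → ℝ} {A B W : ℝ}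

/-- On the support, `V'' / 2` dominates the regularized interaction up to an arbitrarily small
error. -/
theorem exists_neg_integral_conjKernel_le (h : IsRegularEquilibriumDensity V ρ A B)
    (hV : ContDiff ℝ 2 V) (hW : 0 ≤ W) (hVW : ∀ x, -2 * W ≤ deriv (deriv V) x) {τ : ℝ}
    (hτ : 0 < τ) :
    ∃ δ > 0, ∀ x ∈ Icc A B,
      -∫ y, conjKernel δ (x - y) * ρ y ≤ deriv (deriv V) x / 2 + τ := by
  obtain ⟨E, E₁, q, e0, e1, hqc, hqs, hqeq, hmaj⟩ := h.exists_majorant hV hW hVW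
  have hρ := h.continuous
  have hρs := h.hasCompactSupport
  obtain ⟨M, hM⟩ := hqs.exists_bound_of_continuous hqc
  have hM0 : 0 ≤ M := (norm_nonneg _).trans (hM 0)
  obtain ⟨r, hr, hunif⟩ := Metric.uniformContinuous_iff.1
    (hqs.uniformContinuous_of_continuous hqc) (τ / 2) (half_pos hτ)
  -- In the angle variable the Poisson measure is uniform, so the part beyond `±arctan y` is small.
  -- The threshold is matched to the bound `2M` for the oscillation of `q`.
  obtain ⟨y, hy, hy0⟩ : ∃ y, Real.pi / 2 - τ / (8 * (M + 1)) < Real.arctan y ∧ 0 < y := by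
    have hlt : Real.pi / 2 - τ / (8 * (M + 1)) < Real.pi / 2 := by
      have : 0 < τ / (8 * (M + 1)) := by positivity
      linarith
    have h1 : ∀ᶠ y in atTop, Real.pi / 2 - τ / (8 * (M + 1)) < Real.arctan y :=
      (tendsto_nhds_of_tendsto_nhdsWithin Real.tendsto_arctan_atTop).eventually
        (Ioi_mem_nhds hlt)
    exact (h1.and (eventually_gt_atTop 0)).exists
  set α := Real.arctan y with hα
  have hα0 : 0 < α := Real.arctan_pos.2 hy0
  have hα1 : α < Real.pi / 2 := Real.arctan_lt_pi_div_two y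
  have hle : -(Real.pi / 2) ≤ Real.pi / 2 := by linarith [Real.pi_pos]
  -- With this height, `|φ| ≤ arctan y` means a displacement `δ |tan φ|` of at most `r / 2`;
  -- together with `s < r / 2` it stays within the modulus of continuity of `q`.
  refine ⟨r / (2 * y), by positivity, fun x hx => ?_⟩
  set δ := r / (2 * y) with hδdef
  have hδ : 0 < δ := by positivity
  rw [← hqeq x hx]
  have hsmooth := secondDiffGE_smoothPotential hρ h.nonneg hρs h.integral_eq_one hδ x
  have hbound : ∀ s ∈ Ioo 0 (r / 2), smoothPotential ρ δ (x + s) + smoothPotential ρ δ (x - s)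
      - 2 * smoothPotential ρ δ x ≤ (q x + τ) * s ^ 2 := by
    intro s hs
    -- The bound on second differences of `U` at `x - δ tan φ`: `q x + τ / 2` for central angles,
    -- with an extra `2M` in the tails.
    set b : ℝ → ℝ := fun φ => s ^ 2 * ((q x + τ / 2) + (indicator (Ioi α) (fun _ => 2 * M) φ
      + indicator (Iio (-α)) (fun _ => 2 * M) φ)) with hb
    have hmono : ∀ φ ∈ Ioo (-(Real.pi / 2)) (Real.pi / 2),
        logPotential ρ (x + s - δ * Real.tan φ) + logPotential ρ (x - s - δ * Real.tan φ)
          - 2 * logPotential ρ (x - δ * Real.tan φ) ≤ b φ := by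
      intro φ hφ
      have h1 := hmaj (x - δ * Real.tan φ) s
      have e1' : x - δ * Real.tan φ + s = x + s - δ * Real.tan φ := by ring
      have e2' : x - δ * Real.tan φ - s = x - s - δ * Real.tan φ := by ring
      rw [e1', e2'] at h1
      refine h1.trans ?_
      rw [← e1', ← e2', hb]
      simp only
      rw [mul_comm (s ^ 2)]
      refine secondDiff_le_of_hasDerivAt e0 e1 hs.1.le fun z hz => ?_
      have n1 : 0 ≤ indicator (Ioi α) (fun _ => 2 * M) φ :=
        indicator_nonneg (fun _ _ => by positivity) _
      have n2 : 0 ≤ indicator (Iio (-α)) (fun _ => 2 * M) φ :=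
        indicator_nonneg (fun _ _ => by positivity) _
      by_cases hφα : |φ| ≤ α
      · obtain ⟨g1, g2⟩ := abs_le.1 hφα
        have t1 : Real.tan φ ≤ y := by
          rw [← Real.tan_arctan y]
          exact (Real.strictMonoOn_tan.le_iff_le hφ (Real.arctan_mem_Ioo y)).2 g2
        have t2 : -y ≤ Real.tan φ := by
          rw [← Real.tan_arctan y, ← Real.tan_neg]
          exact (Real.strictMonoOn_tan.le_iff_le ⟨by linarith, by linarith⟩ hφ).2 g1
        have d1 : δ * y = r / 2 := by rw [hδdef]; field_simp
        have d2 : |δ * Real.tan φ| ≤ r / 2 := by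
          rw [abs_le]
          constructor <;> nlinarith
        have d3 : dist z x < r := by
          rw [Real.dist_eq, abs_lt]
          obtain ⟨k1, k2⟩ := abs_le.1 d2
          constructor <;> linarith [hz.1, hz.2, hs.2]
        have := (abs_lt.1 (hunif d3)).2
        linarith
      · rw [not_le] at hφα
        have k : 2 * M ≤ indicator (Ioi α) (fun _ => 2 * M) φ
            + indicator (Iio (-α)) (fun _ => 2 * M) φ := by
          rcases lt_abs.1 hφα with g | g
          · rw [indicator_of_mem (show φ ∈ Ioi α from g)]; linarith
          · rw [indicator_of_mem (show φ ∈ Iio (-α) from by simp; linarith)]; linarith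
        have k1 := (abs_le.1 (hM z)).2
        have k2 := (abs_le.1 (hM x)).1
        linarith
    have I := fun z => intervalIntegrable_logPotential_tan hρ hρs hδ z
    have ib1 : ∀ S : Set ℝ, MeasurableSet S → IntervalIntegrable (indicator S fun _ => 2 * M)
        volume (-(Real.pi / 2)) (Real.pi / 2) := by
      intro S hS
      rw [intervalIntegrable_iff_integrableOn_Ioc_of_le hle]
      exact (integrable_const _).indicator hS
    have ib : IntervalIntegrable b volume (-(Real.pi / 2)) (Real.pi / 2) :=
      (intervalIntegrable_const.add ((ib1 _ measurableSet_Ioi).add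
        (ib1 _ measurableSet_Iio))).const_mul _
    have hint := intervalIntegral.integral_mono_on_of_le_Ioo hle
      (((I (x + s)).add (I (x - s))).sub ((I x).const_mul 2)) ib hmono
    rw [intervalIntegral.integral_sub ((I (x + s)).add (I (x - s))) ((I x).const_mul 2),
      intervalIntegral.integral_add (I (x + s)) (I (x - s)), intervalIntegral.integral_const_mul,
      integral_logPotential_tan hρ hρs hδ, integral_logPotential_tan hρ hρs hδ,
      integral_logPotential_tan hρ hρs hδ] at hint
    have hind : ∀ S : Set ℝ, MeasurableSet S → ∀ a c : ℝ, a ≤ c →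
        S ∩ Ioc (-(Real.pi / 2)) (Real.pi / 2) ⊆ Icc a c →
        ∫ φ in -(Real.pi / 2)..(Real.pi / 2), indicator S (fun _ => 2 * M) φ ≤
          2 * M * (c - a) := by
      intro S hS a c hac hsub
      rw [intervalIntegral.integral_of_le hle, integral_indicator hS, setIntegral_const,
        smul_eq_mul, mul_comm]
      refine mul_le_mul_of_nonneg_left ?_ (by positivity)
      rw [measureReal_restrict_apply hS, ← Real.volume_real_Icc_of_le hac]
      exact measureReal_mono hsub measure_Icc_lt_top.ne
    have j1 := hind (Ioi α) measurableSet_Ioi α (Real.pi / 2) hα1.le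
      fun z hz => ⟨le_of_lt hz.1, hz.2.2⟩
    have j2 := hind (Iio (-α)) measurableSet_Iio (-(Real.pi / 2)) (-α) (by linarith)
      fun z hz => ⟨hz.2.1.le, le_of_lt hz.1⟩
    have hbi : ∫ φ in -(Real.pi / 2)..(Real.pi / 2), b φ ≤ s ^ 2 * (Real.pi * (q x + τ)) := by
      rw [hb, intervalIntegral.integral_const_mul, intervalIntegral.integral_add
        intervalIntegrable_const ((ib1 _ measurableSet_Ioi).add (ib1 _ measurableSet_Iio)),
        intervalIntegral.integral_add (ib1 _ measurableSet_Ioi) (ib1 _ measurableSet_Iio),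
        intervalIntegral.integral_const, smul_eq_mul]
      refine mul_le_mul_of_nonneg_left ?_ (sq_nonneg s)
      have k1 : 4 * M * (Real.pi / 2 - α) ≤ τ / 2 := by
        have k2 : Real.pi / 2 - α ≤ τ / (8 * (M + 1)) := by linarith
        have k3 : 4 * M * (Real.pi / 2 - α) ≤ 4 * (M + 1) * (τ / (8 * (M + 1))) :=
          mul_le_mul (by linarith) k2 (by linarith) (by linarith)
        refine k3.trans (le_of_eq ?_)
        field_simp; ring
      have k4 : τ / 2 ≤ Real.pi * (τ / 2) := by nlinarith [Real.pi_gt_three]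
      nlinarith
    have hfin := hint.trans hbi
    have e3 : Real.pi * smoothPotential ρ δ (x + s) + Real.pi * smoothPotential ρ δ (x - s)
        - 2 * (Real.pi * smoothPotential ρ δ x) = Real.pi * (smoothPotential ρ δ (x + s)
        + smoothPotential ρ δ (x - s) - 2 * smoothPotential ρ δ x) := by ring
    have e4 : s ^ 2 * (Real.pi * (q x + τ)) = Real.pi * ((q x + τ) * s ^ 2) := by ring
    rw [e3, e4] at hfin
    exact le_of_mul_le_mul_left hfin Real.pi_pos
  -- Only one small step `s` is needed, at which the lower bound for the regularized second
  -- difference meets the upper one.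
  refine le_of_forall_pos_le_add fun η hη => ?_
  obtain ⟨s, hs1, hs2⟩ := ((hsmooth η hη).and (Ioo_mem_nhdsGT (half_pos hr))).exists
  have := hbound s hs2
  simp only [smul_eq_mul, mul_one] at hs1
  have hs3 : 0 < s ^ 2 := pow_pos hs2.1 2
  have := le_of_mul_le_mul_right (hs1.trans this) hs3
  linarith

end IsRegularEquilibriumDensity

/-! ### Quantiles and Riemann sums -/

namespace IsRegularEquilibriumDensity
variable {V ρ : ℝ → ℝ} {A B : ℝ}

theorem integral_mul_eq (h : IsRegularEquilibriumDensity V ρ A B) (f : ℝ → ℝ) :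
    ∫ x, f x * ρ x = ∫ x in A..B, f x * ρ x := by
  rw [intervalIntegral.integral_of_le h.lt.le, ← integral_Icc_eq_integral_Ioc,
    setIntegral_eq_integral_of_forall_compl_eq_zero fun x hx => by rw [h.eq_zero x hx, mul_zero]]

theorem intervalIntegral_eq_one (h : IsRegularEquilibriumDensity V ρ A B) :
    ∫ x in A..B, ρ x = 1 := by
  have := h.integral_mul_eq fun _ => 1
  simp only [one_mul] at this
  rw [← this, h.integral_eq_one]

theorem bddBelow_quantile_set (ρ : ℝ → ℝ) (A p : ℝ) :
    BddBelow {x | A ≤ x ∧ p ≤ ∫ u in A..x, ρ u} := ⟨A, fun _ hx => hx.1⟩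

theorem quantile_mem (h : IsRegularEquilibriumDensity V ρ A B) {p : ℝ} (hp : p ≤ 1) :
    quantile ρ A p ∈ Icc A B := by
  have hB : B ∈ {x | A ≤ x ∧ p ≤ ∫ u in A..x, ρ u} :=
    ⟨h.lt.le, by rw [h.intervalIntegral_eq_one]; exact hp⟩
  exact ⟨le_csInf ⟨B, hB⟩ fun x hx => hx.1, csInf_le (bddBelow_quantile_set ρ A p) hB⟩

theorem integral_quantile (h : IsRegularEquilibriumDensity V ρ A B) {p : ℝ} (hp0 : 0 ≤ p)
    (hp : p ≤ 1) : ∫ u in A..quantile ρ A p, ρ u = p :=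
  LogGas.integral_quantile h.continuous h.lt.le hp0 (by rwa [h.intervalIntegral_eq_one])

theorem quantile_mono (h : IsRegularEquilibriumDensity V ρ A B) {p p' : ℝ} (hpp : p ≤ p')
    (hp : p' ≤ 1) : quantile ρ A p ≤ quantile ρ A p' :=
  csInf_le_csInf (bddBelow_quantile_set ρ A p)
    ⟨B, h.lt.le, by rw [h.intervalIntegral_eq_one]; exact hp⟩ fun _ hx => ⟨hx.1, hpp.trans hx.2⟩

theorem gammaTilde_mem (h : IsRegularEquilibriumDensity V ρ A B) {N : ℕ} (k : Fin N) :
    gammaTilde ρ A N k ∈ Icc A B := by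
  refine h.quantile_mem ?_
  have hN : (0 : ℝ) < N := by exact_mod_cast k.pos
  have : (k : ℝ) + 1 ≤ N := by exact_mod_cast k.2
  rw [div_le_one hN]; linarith

theorem abs_integral_sub_le (h : IsRegularEquilibriumDensity V ρ A B) {f : ℝ → ℝ} {L : ℝ}
    (hf : Continuous f) (hL : ∀ x y, |f x - f y| ≤ L * |x - y|) {a b c : ℝ} (hc : c ∈ Icc a b) :
    |f c * (∫ x in a..b, ρ x) - ∫ x in a..b, f x * ρ x| ≤ L * (b - a) * ∫ x in a..b, ρ x := by
  have hab : a ≤ b := hc.1.trans hc.2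
  have hρ := h.continuous
  have hL0 : 0 ≤ L := by
    have := (abs_nonneg _).trans (hL 1 0)
    simpa using this
  have i0 : IntervalIntegrable ρ volume a b := hρ.intervalIntegrable _ _
  have i1 : IntervalIntegrable (fun x => f x * ρ x) volume a b := (hf.mul hρ).intervalIntegrable _ _
  rw [← intervalIntegral.integral_const_mul, ← intervalIntegral.integral_const_mul,
    ← intervalIntegral.integral_sub (i0.const_mul _) i1]
  refine (intervalIntegral.abs_integral_le_integral_abs hab).trans ?_
  refine intervalIntegral.integral_mono_on hab ((i0.const_mul _).sub i1).abs (i0.const_mul _)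
    fun x hx => ?_
  rw [← sub_mul, abs_mul, abs_of_nonneg (h.nonneg x)]
  refine mul_le_mul_of_nonneg_right ((hL c x).trans (mul_le_mul_of_nonneg_left ?_ hL0)) (h.nonneg x)
  rw [abs_le]
  constructor <;> linarith [hc.1, hc.2, hx.1, hx.2]

/-- Consecutive quantiles `k/N` cut the support into cells of mass `1/N`, each containing one
classical location. The error in a cell is at most `L / N` times its length, and the lengths
telescope. -/
theorem abs_average_sub_integral_le (h : IsRegularEquilibriumDensity V ρ A B) {f : ℝ → ℝ} {L : ℝ}
    (hL : ∀ x y, |f x - f y| ≤ L * |x - y|) {N : ℕ} (hN : 0 < N) :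
    |(∑ k, f (gammaTilde ρ A N k)) / N - ∫ x, f x * ρ x| ≤ L * (B - A) / N := by
  have hL0 : 0 ≤ L := by
    have := (abs_nonneg _).trans (hL 1 0)
    simpa using this
  have hf : Continuous f := by
    refine (LipschitzWith.of_dist_le_mul (K := ⟨L, hL0⟩) fun x y => ?_).continuous
    exact hL x y
  have hN' : (0 : ℝ) < N := by exact_mod_cast hN
  have hρ := h.continuous
  set x : ℕ → ℝ := fun k => quantile ρ A (k / N) with hx
  set g : ℕ → ℝ := fun k => quantile ρ A ((k + 1 - 1 / 2) / N) with hg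
  have hi : ∀ a b : ℝ, IntervalIntegrable (fun x => f x * ρ x) volume a b := fun a b =>
    (hf.mul hρ).intervalIntegrable _ _
  have hcell : ∀ k < N, ∫ u in x k..x (k + 1), ρ u = 1 / N := by
    intro k hk
    have hk1 : (k : ℝ) + 1 ≤ N := by exact_mod_cast hk
    have e1 := h.integral_quantile (p := k / N) (by positivity) (by rw [div_le_one hN']; linarith)
    have e2 := h.integral_quantile (p := (k + 1 : ℕ) / N) (by positivity)
      (by rw [div_le_one hN']; push_cast; linarith)
    have := intervalIntegral.integral_interval_sub_left (hρ.intervalIntegrable (μ := volume) A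
      (x (k + 1))) (hρ.intervalIntegrable A (x k))
    rw [← this]
    simp only [hx]
    rw [e1, e2]
    push_cast; ring
  have hmem : ∀ k < N, g k ∈ Icc (x k) (x (k + 1)) := by
    intro k hk
    have hk1 : (k : ℝ) + 1 ≤ N := by exact_mod_cast hk
    refine ⟨h.quantile_mono ?_ ?_, h.quantile_mono ?_ ?_⟩
    · gcongr; linarith
    · rw [div_le_one hN']; linarith
    · push_cast; gcongr; linarith
    · rw [div_le_one hN']; push_cast; linarith
  have hx0 : A ≤ x 0 := (h.quantile_mem (by simp)).1
  have hx0' : ∫ u in A..x 0, ρ u = 0 := by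
    have := h.integral_quantile (p := (0 : ℕ) / N) (by simp) (by simp)
    simpa [hx] using this
  have hxN : x N ≤ B := (h.quantile_mem (by rw [div_self hN'.ne'])).2
  have hxN' : ∫ u in x N..B, ρ u = 0 := by
    have e1 := h.integral_quantile (p := N / N) (by positivity) (by rw [div_self hN'.ne'])
    have := intervalIntegral.integral_interval_sub_left (hρ.intervalIntegrable (μ := volume) A B)
      (hρ.intervalIntegrable A (x N))
    rw [← this, h.intervalIntegral_eq_one]
    simp only [hx]
    rw [e1, div_self hN'.ne', sub_self]
  -- The leftover intervals `[A, x 0]` and `[x N, B]` carry no mass, so they do not contribute;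
  -- there is no need to identify `x 0` with `A` or `x N` with `B`.
  have z0 : ∫ u in A..x 0, f u * ρ u = 0 := by
    have := h.abs_integral_sub_le hf hL (left_mem_Icc.2 hx0)
    rw [hx0'] at this
    simpa using this
  have zN : ∫ u in x N..B, f u * ρ u = 0 := by
    have := h.abs_integral_sub_le hf hL (left_mem_Icc.2 hxN)
    rw [hxN'] at this
    simpa using this
  have hsum : ∫ u, f u * ρ u = ∑ k ∈ Finset.range N, ∫ u in x k..x (k + 1), f u * ρ u := by
    rw [h.integral_mul_eq, intervalIntegral.sum_integral_adjacent_intervals fun k _ => hi _ _,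
      ← intervalIntegral.integral_add_adjacent_intervals (hi A (x 0)) (hi _ _),
      ← intervalIntegral.integral_add_adjacent_intervals (hi (x 0) (x N)) (hi _ _), z0, zN]
    ring
  have hfin : ∑ k, f (gammaTilde ρ A N k) = ∑ k ∈ Finset.range N, f (g k) :=
    Fin.sum_univ_eq_sum_range (fun k => f (g k)) N
  rw [hfin, hsum, Finset.sum_div, ← Finset.sum_sub_distrib]
  calc _ ≤ ∑ k ∈ Finset.range N, |f (g k) / N - ∫ u in x k..x (k + 1), f u * ρ u| :=
        Finset.abs_sum_le_sum_abs _ _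
    _ ≤ ∑ k ∈ Finset.range N, L / N * (x (k + 1) - x k) := by
        refine Finset.sum_le_sum fun k hk => ?_
        have hk := Finset.mem_range.1 hk
        have := h.abs_integral_sub_le hf hL (hmem k hk)
        rw [hcell k hk] at this
        have e : L / N * (x (k + 1) - x k) = L * (x (k + 1) - x k) * (1 / N) := by ring
        rw [e, div_eq_mul_one_div]
        exact this
    _ = L / N * (x N - x 0) := by rw [← Finset.mul_sum, Finset.sum_range_sub]
    _ ≤ L / N * (B - A) := by gcongr
    _ = _ := by ring

end IsRegularEquilibriumDensity

/-! ### Positive definiteness of the regularized kernel -/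

theorem integral_mul_cexp {r : ℂ} (hr : 0 < r.re) :
    IntegrableOn (fun ξ : ℝ => (ξ : ℂ) * Complex.exp (-(r * ξ))) (Ioi 0) ∧
    ∫ ξ in Ioi (0 : ℝ), (ξ : ℂ) * Complex.exp (-(r * ξ)) = 1 / r ^ 2 := by
  have hr0 : r ≠ 0 := fun h => hr.ne' (by simp [h])
  have hnorm : ∀ ξ : ℝ, ‖Complex.exp (-(r * ξ))‖ = Real.exp (-r.re * ξ) := fun ξ => by
    rw [Complex.norm_exp]; simp
  have hint : IntegrableOn (fun ξ : ℝ => (ξ : ℂ) * Complex.exp (-(r * ξ))) (Ioi 0) := by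
    have h1 := integrableOn_rpow_mul_exp_neg_mul_rpow (p := 1) (s := 1) (by norm_num) one_pos hr
    simp only [Real.rpow_one] at h1
    refine Integrable.mono' h1 (by fun_prop) ?_
    filter_upwards [ae_restrict_mem measurableSet_Ioi] with ξ hξ
    rw [norm_mul, hnorm, Complex.norm_real, Real.norm_of_nonneg (le_of_lt hξ)]
  refine ⟨hint, ?_⟩
  -- An explicit antiderivative, vanishing at infinity, with value `-1 / r²` at the origin.
  have hd : ∀ ξ ∈ Ici (0 : ℝ), HasDerivAt
      (fun ξ : ℝ => -((ξ : ℂ) / r + 1 / r ^ 2) * Complex.exp (-(r * ξ)))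
      ((ξ : ℂ) * Complex.exp (-(r * ξ))) ξ := by
    intro ξ _
    have d1 : HasDerivAt (fun ξ : ℝ => (ξ : ℂ)) 1 ξ := Complex.ofRealCLM.hasDerivAt
    have d2 := ((d1.div_const r).add_const (1 / r ^ 2)).neg
    have d3 := ((d1.const_mul r).neg).cexp
    refine (d2.mul d3).congr_deriv ?_
    simp only [Pi.neg_apply]
    field_simp; ring
  have ht : Tendsto (fun ξ : ℝ => -((ξ : ℂ) / r + 1 / r ^ 2) * Complex.exp (-(r * ξ))) atTop
      (𝓝 0) := by
    have t1 := (tendsto_rpow_mul_exp_neg_mul_atTop_nhds_zero 1 r.re hr).const_mul (1 / ‖r‖)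
    have t0 := (tendsto_rpow_mul_exp_neg_mul_atTop_nhds_zero 0 r.re hr).const_mul (1 / ‖r‖ ^ 2)
    have t2 := t1.add t0
    simp only [Real.rpow_one, Real.rpow_zero, mul_zero, add_zero, one_mul] at t2
    refine squeeze_zero_norm' ?_ t2
    filter_upwards [eventually_ge_atTop 0] with ξ hξ
    rw [norm_mul, hnorm, norm_neg]
    calc _ ≤ (‖(ξ : ℂ) / r‖ + ‖1 / r ^ 2‖) * Real.exp (-r.re * ξ) :=
          mul_le_mul_of_nonneg_right (norm_add_le _ _) (Real.exp_pos _).le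
      _ = _ := by
          rw [norm_div, norm_div, norm_pow, Complex.norm_real, Real.norm_of_nonneg hξ, norm_one]
          ring
  rw [integral_Ioi_of_hasDerivAt_of_tendsto' hd hint ht]
  simp

/-- The real part of the Laplace transform of `ξ` at `δ + it`, where `Re (δ + it)⁻² = -conjKernel δ
t`. -/
theorem integral_mul_exp_mul_cos {δ : ℝ} (hδ : 0 < δ) (t : ℝ) :
    IntegrableOn (fun ξ => ξ * Real.exp (-(δ * ξ)) * Real.cos (t * ξ)) (Ioi 0) ∧
    ∫ ξ in Ioi 0, ξ * Real.exp (-(δ * ξ)) * Real.cos (t * ξ) = -conjKernel δ t := by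
  set r : ℂ := ⟨δ, t⟩ with hr
  obtain ⟨hint, h1⟩ := integral_mul_cexp (r := r) hδ
  have hre : ∀ ξ : ℝ, ((ξ : ℂ) * Complex.exp (-(r * ξ))).re =
      ξ * Real.exp (-(δ * ξ)) * Real.cos (t * ξ) := by
    intro ξ
    rw [Complex.re_ofReal_mul, Complex.exp_re]
    simp [hr, Real.cos_neg]
    ring
  have hi : IntegrableOn (fun ξ : ℝ => ((ξ : ℂ) * Complex.exp (-(r * ξ))).re) (Ioi 0) := hint.re
  have h2 : ∫ ξ in Ioi (0 : ℝ), ((ξ : ℂ) * Complex.exp (-(r * ξ))).re = (1 / r ^ 2).re := by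
    rw [← h1]; exact integral_re hint
  simp only [hre] at hi h2
  refine ⟨hi, h2.trans ?_⟩
  have e : (1 / r ^ 2).re = (δ ^ 2 - t ^ 2) / (δ ^ 2 + t ^ 2) ^ 2 := by
    rw [one_div, Complex.inv_re, map_pow, Complex.normSq_apply, pow_two r, Complex.mul_re]
    simp only [hr]
    ring_nf
  rw [e, conjKernel]
  have : t ^ 2 + δ ^ 2 ≠ 0 := by positivity
  have : δ ^ 2 + t ^ 2 ≠ 0 := by positivity
  field_simp; ring

/-- Positive definiteness of `-conjKernel`: its cosine transform has the nonnegative density `ξ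
e^{-δξ}`, so the double sum is minus an integral of sums of two squares. -/
theorem sum_conjKernel_nonpos {ι : Type*} [Fintype ι] {δ : ℝ} (hδ : 0 < δ) (x v : ι → ℝ) :
    ∑ i, ∑ j, conjKernel δ (x i - x j) * (v i * v j) ≤ 0 := by
  have hi := fun i j => (integral_mul_exp_mul_cos hδ (x i - x j)).1.mul_const (v i * v j)
  have e : ∑ i, ∑ j, conjKernel δ (x i - x j) * (v i * v j) =
      -∫ ξ in Ioi (0 : ℝ), ∑ i, ∑ j,
        ξ * Real.exp (-(δ * ξ)) * Real.cos ((x i - x j) * ξ) * (v i * v j) := by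
    rw [integral_finsetSum _ fun i _ => integrable_finsetSum _ fun j _ => hi i j,
      ← Finset.sum_neg_distrib]
    refine Finset.sum_congr rfl fun i _ => ?_
    rw [integral_finsetSum _ fun j _ => hi i j, ← Finset.sum_neg_distrib]
    refine Finset.sum_congr rfl fun j _ => ?_
    rw [integral_mul_const, (integral_mul_exp_mul_cos hδ (x i - x j)).2]
    ring
  rw [e, neg_nonpos]
  refine setIntegral_nonneg measurableSet_Ioi fun ξ hξ => ?_
  have e2 : ∑ i, ∑ j, ξ * Real.exp (-(δ * ξ)) * Real.cos ((x i - x j) * ξ) * (v i * v j) =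
      ξ * Real.exp (-(δ * ξ)) * ((∑ i, Real.cos (x i * ξ) * v i) ^ 2
        + (∑ i, Real.sin (x i * ξ) * v i) ^ 2) := by
    rw [pow_two, pow_two, Finset.sum_mul_sum, Finset.sum_mul_sum, ← Finset.sum_add_distrib,
      Finset.mul_sum]
    refine Finset.sum_congr rfl fun i _ => ?_
    rw [← Finset.sum_add_distrib, Finset.mul_sum]
    refine Finset.sum_congr rfl fun j _ => ?_
    rw [sub_mul, Real.cos_sub]
    ring
  rw [e2]
  have : (0 : ℝ) < ξ := hξ
  positivity

/-! ### The truncated Hessian at the classical locations. -/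

/-- The quadratic form `∑ q(x_i) v_i² + (1 / 2N) ∑_{i,j} K(x_i - x_j) (v_i - v_j)²`. -/
noncomputable def pairHessian (q K : ℝ → ℝ) {N : ℕ} (x v : Fin N → ℝ) : ℝ :=
  ∑ i, q (x i) * v i ^ 2 + (∑ i, ∑ j, K (x i - x j) * (v i - v j) ^ 2) / (2 * N)

/-- Expanding `(v_i - v_j)²` with the smaller kernel `conjKernel` gives a diagonal term with
coefficients `∑_j conjKernel` and an off-diagonal term whose sign is favorable by positive
definiteness. Thus a pointwise bound on the diagonal controls the whole form. -/
theorem le_pairHessian_of_conjKernel {q : ℝ → ℝ} {δ τ : ℝ} (hδ : 0 < δ) {N : ℕ} (hN : 0 < N)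
    (x v : Fin N → ℝ) (h : ∀ i, -τ ≤ q (x i) + (∑ j, conjKernel δ (x i - x j)) / N) :
    -τ * ∑ i, v i ^ 2 ≤ pairHessian q (cauchyKernel δ) x v := by
  have hN' : (0 : ℝ) < N := by exact_mod_cast hN
  have hsymm : ∀ i j, conjKernel δ (x i - x j) = conjKernel δ (x j - x i) := fun i j => by
    unfold conjKernel
    rw [← neg_sub (x j) (x i), neg_sq]
  have h1 : ∑ i, ∑ j, conjKernel δ (x i - x j) * (v i - v j) ^ 2 ≤
      ∑ i, ∑ j, cauchyKernel δ (x i - x j) * (v i - v j) ^ 2 :=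
    Finset.sum_le_sum fun i _ => Finset.sum_le_sum fun j _ =>
      mul_le_mul_of_nonneg_right (conjKernel_le hδ _) (sq_nonneg _)
  have h2 : ∑ i, ∑ j, conjKernel δ (x i - x j) * (v i - v j) ^ 2 =
      2 * ∑ i, (∑ j, conjKernel δ (x i - x j)) * v i ^ 2
        - 2 * ∑ i, ∑ j, conjKernel δ (x i - x j) * (v i * v j) := by
    have e1 : ∑ i, ∑ j, conjKernel δ (x i - x j) * v j ^ 2 =
        ∑ i, (∑ j, conjKernel δ (x i - x j)) * v i ^ 2 := by
      rw [Finset.sum_comm]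
      refine Finset.sum_congr rfl fun i _ => ?_
      rw [Finset.sum_mul]
      exact Finset.sum_congr rfl fun j _ => by rw [hsymm]
    have e2 : ∑ i, ∑ j, conjKernel δ (x i - x j) * (v i - v j) ^ 2 =
        ∑ i, ∑ j, conjKernel δ (x i - x j) * v i ^ 2
        + ∑ i, ∑ j, conjKernel δ (x i - x j) * v j ^ 2
        - 2 * ∑ i, ∑ j, conjKernel δ (x i - x j) * (v i * v j) := by
      simp only [Finset.mul_sum, ← Finset.sum_add_distrib, ← Finset.sum_sub_distrib]
      exact Finset.sum_congr rfl fun i _ => Finset.sum_congr rfl fun j _ => by ring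
    rw [e2, e1]
    simp only [← Finset.sum_mul]
    ring
  have h3 := sum_conjKernel_nonpos hδ x v
  have h4 : ∑ i, (∑ j, conjKernel δ (x i - x j)) * v i ^ 2 ≤
      (∑ i, ∑ j, cauchyKernel δ (x i - x j) * (v i - v j) ^ 2) / 2 := by linarith
  have h5 : ∑ i, (∑ j, conjKernel δ (x i - x j)) / N * v i ^ 2 ≤
      (∑ i, ∑ j, cauchyKernel δ (x i - x j) * (v i - v j) ^ 2) / (2 * N) := by
    simp only [div_mul_eq_mul_div]
    rw [← Finset.sum_div, div_le_div_iff₀ hN' (by positivity)]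
    nlinarith
  calc -τ * ∑ i, v i ^ 2 = ∑ i, -τ * v i ^ 2 := Finset.mul_sum _ _ _
    _ ≤ ∑ i, (q (x i) + (∑ j, conjKernel δ (x i - x j)) / N) * v i ^ 2 :=
        Finset.sum_le_sum fun i _ => mul_le_mul_of_nonneg_right (h i) (sq_nonneg _)
    _ = ∑ i, q (x i) * v i ^ 2 + ∑ i, (∑ j, conjKernel δ (x i - x j)) / N * v i ^ 2 := by
        simp only [add_mul, Finset.sum_add_distrib]
    _ ≤ _ := by unfold pairHessian; linarith

/-- A bounded Lipschitz minorant of `V'' / 2`, equal to `V'' / 2` on `[A, B]`. -/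
theorem exists_lipschitz_minorant {V : ℝ → ℝ} {A B W : ℝ} (hAB : A < B) (hV : ContDiff ℝ 3 V)
    (hVW : ∀ x, -2 * W ≤ deriv (deriv V) x) :
    ∃ (q : ℝ → ℝ) (K L : ℝ), (∀ x, |q x| ≤ K) ∧ (∀ x y, |q x - q y| ≤ L * |x - y|) ∧
      (∀ x, q x ≤ deriv (deriv V) x / 2) ∧ ∀ x ∈ Icc A B, q x = deriv (deriv V) x / 2 := by
  let χ : ContDiffBump ((A + B) / 2) := ⟨(B - A) / 2, B - A, by linarith, by linarith⟩
  have hV2 : ContDiff ℝ 1 (deriv (deriv V)) := by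
    have h2 : ContDiff ℝ 2 (deriv V) := hV.deriv'
    exact h2.deriv'
  -- Adding `W` makes the function nonnegative before the cutoff, so the cutoff only lowers it and
  -- the result stays a minorant.
  have hfc : ContDiff ℝ 1 fun x => (deriv (deriv V) x / 2 + W) * χ x :=
    ((hV2.div_const 2).add contDiff_const).mul χ.contDiff
  have hfs : HasCompactSupport fun x => (deriv (deriv V) x / 2 + W) * χ x :=
    χ.hasCompactSupport.mul_left
  obtain ⟨C, hC⟩ := hfc.lipschitzWith_of_hasCompactSupport hfs (by norm_num)
  obtain ⟨M, hM⟩ := hfs.exists_bound_of_continuous hfc.continuous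
  refine ⟨fun x => (deriv (deriv V) x / 2 + W) * χ x - W, M + |W|, C, fun x => ?_, fun x y => ?_,
    fun x => ?_, fun x hx => ?_⟩
  · exact (abs_sub _ _).trans (add_le_add_left (hM x) _)
  · have := hC.dist_le_mul x y
    rw [Real.dist_eq, Real.dist_eq] at this
    rwa [sub_sub_sub_cancel_right]
  · have h1 := χ.le_one (x := x)
    have h2 : 0 ≤ deriv (deriv V) x / 2 + W := by linarith [hVW x]
    nlinarith
  · have : χ x = 1 := χ.one_of_mem_closedBall (by
      rw [Metric.mem_closedBall, Real.dist_eq, abs_le]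
      constructor <;> simp only [χ] <;> linarith [hx.1, hx.2])
    simp [this]

namespace IsRegularEquilibriumDensity
variable {V ρ : ℝ → ℝ} {A B W : ℝ}

/-- Half of `τ` pays for the Poisson regularization, the other half for replacing the integral by
the average over classical locations. -/
theorem exists_neg_le_pairHessian (h : IsRegularEquilibriumDensity V ρ A B)
    (hV : ContDiff ℝ 2 V) (hW : 0 ≤ W) (hVW : ∀ x, -2 * W ≤ deriv (deriv V) x) {q : ℝ → ℝ}
    (hq : ∀ x ∈ Icc A B, q x = deriv (deriv V) x / 2) {τ : ℝ} (hτ : 0 < τ) :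
    ∃ δ > 0, ∃ N₁ : ℕ, ∀ N ≥ N₁, ∀ v : Fin N → ℝ,
      -τ * ∑ i, v i ^ 2 ≤ pairHessian q (cauchyKernel δ) (gammaTilde ρ A N) v := by
  obtain ⟨δ, hδ, hker⟩ := h.exists_neg_integral_conjKernel_le hV hW hVW (half_pos hτ)
  set C := 5 / δ ^ 3 * (B - A) with hC
  have hC0 : 0 < C := mul_pos (by positivity) (sub_pos.2 h.lt)
  obtain ⟨n, hn⟩ := exists_nat_gt (C / (τ / 2))
  refine ⟨δ, hδ, n + 1, fun N hN v => le_pairHessian_of_conjKernel hδ (by omega) _ v fun i => ?_⟩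
  have hN' : (n : ℝ) + 1 ≤ N := by exact_mod_cast hN
  have hN0 : (0 : ℝ) < N := by linarith [Nat.cast_nonneg (α := ℝ) n]
  have hmem := h.gammaTilde_mem i
  have h1 := h.abs_average_sub_integral_le (f := fun y => conjKernel δ (gammaTilde ρ A N i - y))
    (L := 5 / δ ^ 3) (fun x y => by
      refine (abs_conjKernel_sub_le hδ _ _).trans (le_of_eq ?_)
      rw [sub_sub_sub_cancel_left, abs_sub_comm]) (N := N) (by omega)
  have h2 := hker _ hmem
  have h3 : C / N ≤ τ / 2 := by
    rw [div_lt_iff₀ (half_pos hτ)] at hn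
    rw [div_le_iff₀ hN0]
    nlinarith
  rw [hq _ hmem]
  have := (abs_le.1 h1).1
  linarith

end IsRegularEquilibriumDensity

/-- An analytic function growing at both infinities is not affine on any interval. -/
theorem exists_deriv_deriv_ne_zero {V : ℝ → ℝ} {A B a r : ℝ} (hAB : A < B)
    (hV : AnalyticOnNhd ℝ V univ) (ha : 0 < a)
    (hgrowth : ∀ x, r ≤ |x| → (2 + a) * Real.log (1 + |x|) < V x) :
    ∃ x ∈ Ioo A B, deriv (deriv V) x ≠ 0 := by
  by_contra! hcon
  have hmid : (A + B) / 2 ∈ Ioo A B := ⟨by linarith, by linarith⟩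
  have hV2 : AnalyticOnNhd ℝ (deriv (deriv V)) univ := hV.deriv.deriv
  have hzero : EqOn (deriv (deriv V)) 0 univ :=
    hV2.eqOn_zero_of_preconnected_of_eventuallyEq_zero isPreconnected_univ (mem_univ _)
      (Filter.eventually_of_mem (Ioo_mem_nhds hmid.1 hmid.2) hcon)
  have d0 : Differentiable ℝ V := fun x => (hV x (mem_univ x)).differentiableAt
  have d1 : Differentiable ℝ (deriv V) := fun x => (hV.deriv x (mem_univ x)).differentiableAt
  have c1 : ∀ x, deriv V x = deriv V 0 := fun x =>
    is_const_of_deriv_eq_zero d1 (fun y => hzero (mem_univ y)) x 0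
  have c0 : ∀ x, V x - deriv V 0 * x = V 0 - deriv V 0 * 0 := fun x => by
    refine is_const_of_deriv_eq_zero (f := fun x => V x - deriv V 0 * x)
      (d0.sub (differentiable_id.const_mul _)) (fun y => ?_) x 0
    have := ((d0 y).hasDerivAt.sub ((hasDerivAt_id y).const_mul (deriv V 0))).deriv
    simp only [mul_one, c1 y, sub_self] at this
    exact this
  -- If `V'' = 0` then `V x + V (-x) = 2 V 0`, contradicting the growth at both `x` and `-x`.
  obtain ⟨x, hx1, hx2, hx3⟩ : ∃ x : ℝ, r ≤ x ∧ 0 ≤ x ∧ V 0 < Real.log (1 + x) := by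
    have ht : Tendsto (fun x : ℝ => Real.log (1 + x)) atTop atTop :=
      Real.tendsto_log_atTop.comp (tendsto_atTop_add_const_left _ 1 tendsto_id)
    exact ((eventually_ge_atTop r).and ((eventually_ge_atTop 0).and
      (ht.eventually_gt_atTop (V 0)))).exists
  have g1 := hgrowth x (by rwa [abs_of_nonneg hx2])
  have g2 := hgrowth (-x) (by rwa [abs_neg, abs_of_nonneg hx2])
  rw [abs_neg] at g2
  rw [abs_of_nonneg hx2] at g1 g2
  have hl : 0 ≤ Real.log (1 + x) := Real.log_nonneg (by linarith)
  have s1 := c0 x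
  have s2 := c0 (-x)
  nlinarith [mul_nonneg ha.le hl]

/-- The interaction is invariant under translations, so a constant only enters through the diagonal
term. -/
theorem pairHessian_const_add {q K : ℝ → ℝ} {N : ℕ} (x w : Fin N → ℝ) (t : ℝ) :
    pairHessian q K x (fun i => t + w i) =
      t ^ 2 * ∑ i, q (x i) + 2 * t * ∑ i, q (x i) * w i + pairHessian q K x w := by
  have e : ∀ i j, K (x i - x j) * (t + w i - (t + w j)) ^ 2 = K (x i - x j) * (w i - w j) ^ 2 :=
    fun i j => by ring
  simp only [pairHessian, e]
  rw [← add_assoc, Finset.mul_sum, Finset.mul_sum, ← Finset.sum_add_distrib,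
    ← Finset.sum_add_distrib]
  congr 1
  exact Finset.sum_congr rfl fun i _ => by ring

namespace IsRegularEquilibriumDensity
variable {V ρ : ℝ → ℝ} {A B W : ℝ}

theorem tendsto_average (h : IsRegularEquilibriumDensity V ρ A B) {f : ℝ → ℝ} {L : ℝ}
    (hL : ∀ x y, |f x - f y| ≤ L * |x - y|) :
    Tendsto (fun N : ℕ => (∑ k, f (gammaTilde ρ A N k)) / N) atTop (𝓝 (∫ x, f x * ρ x)) := by
  rw [tendsto_iff_norm_sub_tendsto_zero]
  refine squeeze_zero' (Eventually.of_forall fun _ => norm_nonneg _) ?_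
    (tendsto_const_div_atTop_nhds_zero_nat (L * (B - A)))
  filter_upwards [eventually_gt_atTop 0] with N hN
  exact h.abs_average_sub_integral_le hL hN

/-- `∫ V'' ρ > 0`: the translation mode is strictly stable. -/
theorem integral_mul_pos (h : IsRegularEquilibriumDensity V ρ A B) (hV : ContDiff ℝ 2 V)
    (hW : 0 ≤ W) (hVW : ∀ x, -2 * W ≤ deriv (deriv V) x) {q : ℝ → ℝ} {K L : ℝ}
    (hqK : ∀ x, |q x| ≤ K) (hqL : ∀ x y, |q x - q y| ≤ L * |x - y|)
    (hq : ∀ x ∈ Icc A B, q x = deriv (deriv V) x / 2)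
    (hne : ∃ x ∈ Ioo A B, deriv (deriv V) x ≠ 0) : 0 < ∫ x, q x * ρ x := by
  have hL0 : 0 ≤ L := by
    have := (abs_nonneg _).trans (hqL 1 0)
    simpa using this
  have hK0 : 0 ≤ K := (abs_nonneg _).trans (hqK 0)
  have hqc : Continuous q :=
    (LipschitzWith.of_dist_le_mul (K := ⟨L, hL0⟩) fun x y => hqL x y).continuous
  have hsqL : ∀ x y, |q x ^ 2 - q y ^ 2| ≤ 2 * K * L * |x - y| := by
    intro x y
    rw [sq_sub_sq, abs_mul]
    have h1 : |q x + q y| ≤ 2 * K := (abs_add_le _ _).trans (by linarith [hqK x, hqK y])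
    calc _ ≤ 2 * K * (L * |x - y|) := mul_le_mul h1 (hqL x y) (abs_nonneg _) (by linarith)
      _ = _ := by ring
  have hQ : 0 < ∫ x, q x ^ 2 * ρ x := by
    obtain ⟨x, hx, hxne⟩ := hne
    have hc : Continuous fun x => q x ^ 2 * ρ x := (hqc.pow 2).mul h.continuous
    refine hc.integral_pos_of_hasCompactSupport_nonneg_nonzero (x := x)
      h.hasCompactSupport.mul_left (fun y => mul_nonneg (sq_nonneg _) (h.nonneg y)) ?_
    refine mul_ne_zero (pow_ne_zero 2 ?_) (h.pos x hx).ne'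
    rw [hq x (Ioo_subset_Icc_self hx)]
    exact div_ne_zero hxne two_ne_zero
  set κ := ∫ x, q x * ρ x with hκ
  set Q := ∫ x, q x ^ 2 * ρ x with hQdef
  have hlim1 := h.tendsto_average hqL
  have hlim2 := h.tendsto_average (f := fun x => q x ^ 2) hsqL
  -- The almost-positivity of the form, tested on `1 + s q(γ̃_i)` and divided by `N → ∞`.
  have key : ∀ τ > 0, ∀ s : ℝ,
      -τ * (1 + |s| * K) ^ 2 ≤ κ + 2 * s * Q + s ^ 2 * (K ^ 3 + L ^ 2 / 2) := by
    intro τ hτ s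
    obtain ⟨δ, hδ, N₁, hN₁⟩ := h.exists_neg_le_pairHessian hV hW hVW hq hτ
    have hlim := (hlim1.add (hlim2.const_mul (2 * s))).add_const (s ^ 2 * (K ^ 3 + L ^ 2 / 2))
    refine ge_of_tendsto hlim ?_
    filter_upwards [eventually_ge_atTop N₁, eventually_gt_atTop 0] with N hN hN0
    have hN' : (0 : ℝ) < N := by exact_mod_cast hN0
    have h1 := hN₁ N hN fun i => 1 + s * q (gammaTilde ρ A N i)
    rw [pairHessian_const_add] at h1
    have b1 : ∑ i : Fin N, (1 + s * q (gammaTilde ρ A N i)) ^ 2 ≤ N * (1 + |s| * K) ^ 2 := by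
      calc _ ≤ ∑ i : Fin N, (1 + |s| * K) ^ 2 := by
            refine Finset.sum_le_sum fun i _ => sq_le_sq' ?_ ?_
            · have := (abs_le.1 (abs_mul s (q (gammaTilde ρ A N i)) ▸
                mul_le_mul_of_nonneg_left (hqK (gammaTilde ρ A N i)) (abs_nonneg s))).1
              nlinarith [mul_nonneg (abs_nonneg s) hK0]
            · have := (abs_le.1 (abs_mul s (q (gammaTilde ρ A N i)) ▸
                mul_le_mul_of_nonneg_left (hqK (gammaTilde ρ A N i)) (abs_nonneg s))).2
              linarith
        _ = _ := by simp
    -- The bound must not depend on `δ`, which depends on `τ`. It does not, because `q` is Lipschitz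
    -- and `t² / (t² + δ²) ≤ 1`.
    have b2 : pairHessian q (cauchyKernel δ) (gammaTilde ρ A N)
        (fun i => s * q (gammaTilde ρ A N i)) ≤ N * (s ^ 2 * (K ^ 3 + L ^ 2 / 2)) := by
      have c1 : ∑ i, q (gammaTilde ρ A N i) * (s * q (gammaTilde ρ A N i)) ^ 2 ≤
          N * (s ^ 2 * K ^ 3) := by
        calc _ ≤ ∑ i : Fin N, s ^ 2 * K ^ 3 := by
              refine Finset.sum_le_sum fun i _ => ?_
              have e : q (gammaTilde ρ A N i) * (s * q (gammaTilde ρ A N i)) ^ 2 =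
                s ^ 2 * q (gammaTilde ρ A N i) ^ 3 := by ring
              rw [e]
              refine mul_le_mul_of_nonneg_left ?_ (sq_nonneg s)
              refine (le_abs_self _).trans ?_
              rw [abs_pow]
              exact pow_le_pow_left₀ (abs_nonneg _) (hqK _) 3
          _ = _ := by simp
      have c2 : ∑ i, ∑ j, cauchyKernel δ (gammaTilde ρ A N i - gammaTilde ρ A N j)
          * (s * q (gammaTilde ρ A N i) - s * q (gammaTilde ρ A N j)) ^ 2 ≤
          N * (N * (s ^ 2 * L ^ 2)) := by
        calc _ ≤ ∑ i : Fin N, ∑ j : Fin N, s ^ 2 * L ^ 2 := by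
              refine Finset.sum_le_sum fun i _ => Finset.sum_le_sum fun j _ => ?_
              set t := gammaTilde ρ A N i - gammaTilde ρ A N j with ht
              have d1 : (q (gammaTilde ρ A N i) - q (gammaTilde ρ A N j)) ^ 2 ≤ L ^ 2 * t ^ 2 := by
                have := pow_le_pow_left₀ (abs_nonneg _)
                  (hqL (gammaTilde ρ A N i) (gammaTilde ρ A N j)) 2
                rwa [sq_abs, mul_pow, sq_abs] at this
              have d2 : cauchyKernel δ t * t ^ 2 ≤ 1 := by
                unfold cauchyKernel
                rw [one_div_mul_eq_div, div_le_one (by positivity)]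
                nlinarith
              have d3 := cauchyKernel_pos hδ t
              calc _ = s ^ 2 * (cauchyKernel δ t *
                    (q (gammaTilde ρ A N i) - q (gammaTilde ρ A N j)) ^ 2) := by ring
                _ ≤ s ^ 2 * (cauchyKernel δ t * (L ^ 2 * t ^ 2)) := by gcongr
                _ = s ^ 2 * L ^ 2 * (cauchyKernel δ t * t ^ 2) := by ring
                _ ≤ s ^ 2 * L ^ 2 * 1 := by gcongr
                _ = _ := mul_one _
          _ = _ := by simp
      have c3 : (∑ i, ∑ j, cauchyKernel δ (gammaTilde ρ A N i - gammaTilde ρ A N j)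
          * (s * q (gammaTilde ρ A N i) - s * q (gammaTilde ρ A N j)) ^ 2) / (2 * N) ≤
          N * (s ^ 2 * L ^ 2 / 2) := by
        rw [div_le_iff₀ (by positivity)]
        linarith
      unfold pairHessian
      linarith
    have e3 : ∑ i, q (gammaTilde ρ A N i) * (s * q (gammaTilde ρ A N i)) =
        s * ∑ i, q (gammaTilde ρ A N i) ^ 2 := by
      rw [Finset.mul_sum]
      exact Finset.sum_congr rfl fun i _ => by ring
    rw [e3] at h1
    have h2 : -τ * (N * (1 + |s| * K) ^ 2) ≤ ∑ i, q (gammaTilde ρ A N i)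
        + 2 * s * ∑ i, q (gammaTilde ρ A N i) ^ 2 + N * (s ^ 2 * (K ^ 3 + L ^ 2 / 2)) := by
      nlinarith
    have e4 : (∑ i, q (gammaTilde ρ A N i)) / N + 2 * s * ((∑ i, q (gammaTilde ρ A N i) ^ 2) / N)
        + s ^ 2 * (K ^ 3 + L ^ 2 / 2) = (∑ i, q (gammaTilde ρ A N i)
        + 2 * s * ∑ i, q (gammaTilde ρ A N i) ^ 2 + N * (s ^ 2 * (K ^ 3 + L ^ 2 / 2))) / N := by
      field_simp
    rw [e4, le_div_iff₀ hN']
    linarith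
  have key2 : ∀ s : ℝ, 0 ≤ κ + 2 * s * Q + s ^ 2 * (K ^ 3 + L ^ 2 / 2) := by
    intro s
    refine ge_of_tendsto (x := 𝓝[>] (0 : ℝ)) (f := fun τ => κ + 2 * s * Q
      + s ^ 2 * (K ^ 3 + L ^ 2 / 2) + τ * (1 + |s| * K) ^ 2) ?_ ?_
    · exact tendsto_nhdsWithin_of_tendsto_nhds (Continuous.tendsto' (by fun_prop) _ _ (by simp))
    · filter_upwards [self_mem_nhdsWithin] with τ hτ
      linarith [key τ hτ s]
  by_contra! hκ0
  set D := K ^ 3 + L ^ 2 / 2 with hD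
  have hD0 : 0 ≤ D := by positivity
  -- A negative `s` of this size makes the linear term `2 s Q` outweigh the quadratic one, so `κ ≤
  -- 0` would be contradictory.
  have := key2 (-(Q / (D + 1)))
  have e : κ + 2 * -(Q / (D + 1)) * Q + (-(Q / (D + 1))) ^ 2 * D =
      κ - Q ^ 2 * (D + 2) / (D + 1) ^ 2 := by
    field_simp; ring
  rw [e] at this
  have : 0 < Q ^ 2 * (D + 2) / (D + 1) ^ 2 := by positivity
  linarith

/-- At the classical locations, the Hessian with truncated interaction becomes strictly positive
once the modes orthogonal to constants are penalized. -/
theorem exists_le_pairHessian (h : IsRegularEquilibriumDensity V ρ A B) (hV : ContDiff ℝ 2 V)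
    (hW : 0 ≤ W) (hVW : ∀ x, -2 * W ≤ deriv (deriv V) x) {q : ℝ → ℝ} {K L : ℝ}
    (hqK : ∀ x, |q x| ≤ K) (hqL : ∀ x y, |q x - q y| ≤ L * |x - y|)
    (hq : ∀ x ∈ Icc A B, q x = deriv (deriv V) x / 2)
    (hne : ∃ x ∈ Ioo A B, deriv (deriv V) x ≠ 0) :
    ∃ c > 0, ∃ δ > 0, ∃ N₁ : ℕ, ∀ N ≥ N₁, ∀ v : Fin N → ℝ,
      c * ∑ i, v i ^ 2 ≤ pairHessian q (cauchyKernel δ) (gammaTilde ρ A N) v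
        + 2 * (∑ i, v i ^ 2 - (∑ i, v i) ^ 2 / N) := by
  set κ := ∫ x, q x * ρ x with hκdef
  have hκ : 0 < κ := h.integral_mul_pos hV hW hVW hqK hqL hq hne
  -- The three smallness conditions are those consumed in the final estimate `2c ‖v‖² ≤ z² / P' +
  -- 2S`.
  obtain ⟨c, hc, hc1, hc2, hc3⟩ : ∃ c > 0, c ≤ 1 / 2 ∧ 2 * c * (4 / κ) ≤ 1 ∧
      2 * c * (8 * K ^ 2 / κ ^ 2) ≤ 1 := by
    refine ⟨1 / (2 + 2 * (4 / κ) + 2 * (8 * K ^ 2 / κ ^ 2)), by positivity, ?_, ?_, ?_⟩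
    · have h1 : 0 ≤ 4 / κ := by positivity
      have h2 : 0 ≤ 8 * K ^ 2 / κ ^ 2 := by positivity
      exact one_div_le_one_div_of_le two_pos (by linarith)
    · have h1 : 0 ≤ 4 / κ := by positivity
      have h2 : 0 ≤ 8 * K ^ 2 / κ ^ 2 := by positivity
      rw [mul_one_div, div_mul_eq_mul_div, div_le_one (by positivity)]
      linarith
    · have h1 : 0 ≤ 4 / κ := by positivity
      have h2 : 0 ≤ 8 * K ^ 2 / κ ^ 2 := by positivity
      rw [mul_one_div, div_mul_eq_mul_div, div_le_one (by positivity)]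
      linarith
  obtain ⟨δ, hδ, N₁, hN₁⟩ := h.exists_neg_le_pairHessian hV hW hVW hq hc
  obtain ⟨N₂, hN₂⟩ := eventually_atTop.1
    ((h.tendsto_average hqL).eventually (Ioi_mem_nhds (half_lt_self hκ)))
  refine ⟨c, hc, δ, hδ, max (max N₁ N₂) 1, fun N hN v => ?_⟩
  have hN0 : (0 : ℝ) < N := by
    have : 0 < N := by omega
    exact_mod_cast this
  have hP := hN₂ N (by omega)
  rw [← hκdef, lt_div_iff₀ hN0] at hP
  set P := ∑ i, q (gammaTilde ρ A N i) with hPdef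
  set m := (∑ i, v i) / N with hm
  set w : Fin N → ℝ := fun i => v i - m with hw
  have hv : v = fun i => m + w i := by ext i; simp [hw]
  have hw0 : ∑ i, w i = 0 := by
    simp [hw, Finset.sum_sub_distrib, hm]
    field_simp; ring
  set S := ∑ i, w i ^ 2 with hS
  have hsq : ∀ t : ℝ, ∑ i, (t + w i) ^ 2 = N * t ^ 2 + S := by
    intro t
    have e : ∀ i, (t + w i) ^ 2 = t ^ 2 + 2 * t * w i + w i ^ 2 := fun i => by ring
    simp only [e, Finset.sum_add_distrib, ← Finset.mul_sum, hw0]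
    simp [hS]
  have hvS : ∑ i, v i ^ 2 = N * m ^ 2 + S := by
    rw [← hsq m]; exact Finset.sum_congr rfl fun i _ => by simp [hw]
  have hvm : (∑ i, v i) ^ 2 / N = N * m ^ 2 := by rw [hm]; field_simp
  set β := ∑ i, q (gammaTilde ρ A N i) * w i with hβ
  have hβ2 : β ^ 2 ≤ N * K ^ 2 * S := by
    refine (Finset.sum_mul_sq_le_sq_mul_sq _ _ _).trans ?_
    refine mul_le_mul_of_nonneg_right ?_ (Finset.sum_nonneg fun i _ => sq_nonneg _)
    calc _ ≤ ∑ i : Fin N, K ^ 2 := Finset.sum_le_sum fun i _ => by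
          rw [← sq_abs]; exact pow_le_pow_left₀ (abs_nonneg _) (hqK _) 2
      _ = _ := by simp
  have hS0 : 0 ≤ S := Finset.sum_nonneg fun i _ => sq_nonneg _
  rw [hvS, hvm, hv, pairHessian_const_add]
  set Φ := pairHessian q (cauchyKernel δ) (gammaTilde ρ A N) w with hΦ
  have hform : ∀ t : ℝ, -c * (N * t ^ 2 + S) ≤ t ^ 2 * P + 2 * t * β + Φ := by
    intro t
    have := hN₁ N (by omega) fun i => t + w i
    rwa [pairHessian_const_add, hsq] at this
  -- After adding `c ‖·‖²` the form is nonnegative, and `P'` is its coefficient on the constant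
  -- mode. Minimizing over that mode (`t = -β / P'`) leaves a nonnegative Schur complement, and `z`
  -- completes the square.
  set P' := P + c * N with hP'
  have hP'0 : N * κ / 2 ≤ P' := by nlinarith
  have hP'pos : 0 < P' := lt_of_lt_of_le (by positivity) hP'0
  have hΦ1 : β ^ 2 / P' ≤ Φ + c * S := by
    have := hform (-(β / P'))
    have e : (-(β / P')) ^ 2 * P' + 2 * (-(β / P')) * β = -(β ^ 2 / P') := by field_simp; ring
    have e2 : (-(β / P')) ^ 2 * P' = (-(β / P')) ^ 2 * P + c * (N * (-(β / P')) ^ 2) := by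
      rw [hP']; ring
    linarith
  set z := m * P' + β with hz
  have hz1 : m ^ 2 * P + 2 * m * β + Φ ≥ z ^ 2 / P' - c * (N * m ^ 2) - c * S := by
    have e : z ^ 2 / P' = m ^ 2 * P' + 2 * m * β + β ^ 2 / P' := by
      rw [hz]; field_simp; ring
    rw [e, hP']; linarith
  -- The mean is recovered from `z` and `β`. The first is controlled by the form, the second by the
  -- penalized part `S`; `P' ≥ N κ / 2` makes the constants independent of `N`.
  have hz2 : N * m ^ 2 ≤ 4 / κ * (z ^ 2 / P') + 8 * K ^ 2 / κ ^ 2 * S := by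
    have e : m = (z - β) / P' := by rw [hz]; field_simp; ring
    have e1 : N * m ^ 2 ≤ 2 * N / P' * (z ^ 2 / P') + 2 * N * β ^ 2 / P' ^ 2 := by
      have : 2 * N / P' * (z ^ 2 / P') + 2 * N * β ^ 2 / P' ^ 2 - N * m ^ 2 =
          N * (z + β) ^ 2 / P' ^ 2 := by rw [e]; field_simp; ring
      have : 0 ≤ N * (z + β) ^ 2 / P' ^ 2 := by positivity
      linarith
    have e2 : 2 * N / P' ≤ 4 / κ := by
      rw [div_le_div_iff₀ hP'pos hκ]; linarith
    have e3 : 2 * N * β ^ 2 / P' ^ 2 ≤ 8 * K ^ 2 / κ ^ 2 * S := by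
      calc 2 * N * β ^ 2 / P' ^ 2 ≤ 2 * N * (N * K ^ 2 * S) / (N * κ / 2) ^ 2 := by gcongr
        _ = _ := by field_simp; ring
    have e4 : 2 * N / P' * (z ^ 2 / P') ≤ 4 / κ * (z ^ 2 / P') :=
      mul_le_mul_of_nonneg_right e2 (by positivity)
    linarith
  have hz3 : 0 ≤ z ^ 2 / P' := by positivity
  have f1 : 2 * c * (N * m ^ 2) ≤ z ^ 2 / P' + S := by
    calc 2 * c * (N * m ^ 2) ≤ 2 * c * (4 / κ * (z ^ 2 / P') + 8 * K ^ 2 / κ ^ 2 * S) := by gcongr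
      _ = 2 * c * (4 / κ) * (z ^ 2 / P') + 2 * c * (8 * K ^ 2 / κ ^ 2) * S := by ring
      _ ≤ 1 * (z ^ 2 / P') + 1 * S := by gcongr
      _ = _ := by ring
  nlinarith

end IsRegularEquilibriumDensity

/-! ### The discrete cosine basis -/

/-- Each term times `2 sin (x/2)` is a difference of consecutive sines, and the sum telescopes. -/
theorem two_mul_sin_mul_sum_cos (x : ℝ) (N : ℕ) :
    2 * Real.sin (x / 2) * ∑ k ∈ Finset.range N, Real.cos (x * (k + 1 / 2)) = Real.sin (x * N) := by
  induction N with
  | zero => simp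
  | succ n ih =>
    rw [Finset.sum_range_succ, mul_add, ih]
    have e1 : x * ((n + 1 : ℕ) : ℝ) = x * (n + 1 / 2) + x / 2 := by push_cast; ring
    have e2 : x * (n : ℝ) = x * (n + 1 / 2) - x / 2 := by ring
    rw [e1, e2, Real.sin_add, Real.sin_sub]
    ring

theorem two_mul_sin_mul_sum_cos_succ (x : ℝ) (D : ℕ) :
    2 * Real.sin (x / 2) * ∑ d ∈ Finset.Icc 1 D, Real.cos (x * d) =
      Real.sin (x * (D + 1 / 2)) - Real.sin (x / 2) := by
  induction D with
  | zero => simp; ring_nf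
  | succ n ih =>
    rw [Finset.sum_Icc_succ_top (by omega), mul_add, ih]
    have e1 : x * (((n + 1 : ℕ) : ℝ) + 1 / 2) = x * ((n + 1 : ℕ) : ℝ) + x / 2 := by ring
    have e2 : x * ((n : ℝ) + 1 / 2) = x * ((n + 1 : ℕ) : ℝ) - x / 2 := by push_cast; ring
    rw [e1, e2, Real.sin_add, Real.sin_sub]
    ring

theorem sum_cos_eq_zero {N n : ℕ} (hn : 0 < n) (hn2 : n < 2 * N) :
    ∑ k : Fin N, Real.cos (Real.pi * n / N * ((k : ℝ) + 1 / 2)) = 0 := by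
  have hN : (0 : ℝ) < N := by
    have : 0 < N := by omega
    exact_mod_cast this
  have h := two_mul_sin_mul_sum_cos (Real.pi * n / N) N
  have e : Real.pi * n / N * N = n * Real.pi := by field_simp
  rw [e, Real.sin_nat_mul_pi] at h
  have hn' : (0 : ℝ) < n := by exact_mod_cast hn
  have hn2' : (n : ℝ) < 2 * N := by exact_mod_cast hn2
  have hs : 0 < Real.sin (Real.pi * n / N / 2) := by
    apply Real.sin_pos_of_pos_of_lt_pi
    · have := Real.pi_pos; positivity
    · rw [div_div, div_lt_iff₀ (by positivity)]
      nlinarith [Real.pi_pos]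
  rw [Fin.sum_univ_eq_sum_range (fun k : ℕ => Real.cos (Real.pi * n / N * ((k : ℝ) + 1 / 2))) N]
  exact (mul_eq_zero.1 h).resolve_left (by positivity)

/-- The discrete cosine modes, an orthonormal basis of `ℝ^N` for `α < N`. -/
noncomputable def cosMode (N α : ℕ) (k : Fin N) : ℝ :=
  (√(N : ℝ))⁻¹ * if α = 0 then 1
    else √2 * Real.cos (2 * Real.pi * ((k : ℝ) + 1 - 1 / 2) * (α / (2 * N)))

theorem cos_arg_eq {N : ℕ} (hN : 0 < N) (α : ℕ) (k : Fin N) :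
    2 * Real.pi * ((k : ℝ) + 1 - 1 / 2) * (α / (2 * N)) =
      Real.pi * α / N * ((k : ℝ) + 1 / 2) := by
  have : (0 : ℝ) < N := by exact_mod_cast hN
  field_simp; ring

theorem sum_cos_mul_cos_of_lt {N α β : ℕ} (hαβ : α < β) (hβ : β < N) :
    ∑ k : Fin N, Real.cos (Real.pi * α / N * ((k : ℝ) + 1 / 2))
      * Real.cos (Real.pi * β / N * ((k : ℝ) + 1 / 2)) = 0 := by
  have e : ∀ k : Fin N, Real.cos (Real.pi * α / N * ((k : ℝ) + 1 / 2))
      * Real.cos (Real.pi * β / N * ((k : ℝ) + 1 / 2)) =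
      (Real.cos (Real.pi * (β - α : ℕ) / N * ((k : ℝ) + 1 / 2))
      + Real.cos (Real.pi * (β + α : ℕ) / N * ((k : ℝ) + 1 / 2))) / 2 := by
    intro k
    rw [Nat.cast_sub hαβ.le, Nat.cast_add]
    have e1 : Real.pi * ((β : ℝ) - α) / N * ((k : ℝ) + 1 / 2) =
      Real.pi * β / N * ((k : ℝ) + 1 / 2) - Real.pi * α / N * ((k : ℝ) + 1 / 2) := by ring
    have e2 : Real.pi * ((β : ℝ) + α) / N * ((k : ℝ) + 1 / 2) =
      Real.pi * β / N * ((k : ℝ) + 1 / 2) + Real.pi * α / N * ((k : ℝ) + 1 / 2) := by ring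
    rw [e1, e2, Real.cos_sub, Real.cos_add]
    ring
  simp only [e, ← Finset.sum_div, Finset.sum_add_distrib]
  rw [sum_cos_eq_zero (by omega) (by omega), sum_cos_eq_zero (by omega) (by omega)]
  simp

theorem sum_cos_sq {N α : ℕ} (hα0 : 0 < α) (hα : α < N) :
    ∑ k : Fin N, Real.cos (Real.pi * α / N * ((k : ℝ) + 1 / 2)) ^ 2 = N / 2 := by
  have e : ∀ k : Fin N, Real.cos (Real.pi * α / N * ((k : ℝ) + 1 / 2)) ^ 2 =
      1 / 2 + Real.cos (Real.pi * (2 * α : ℕ) / N * ((k : ℝ) + 1 / 2)) / 2 := by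
    intro k
    rw [Real.cos_sq]
    congr 3
    push_cast; ring
  simp only [e, ← Finset.sum_div, Finset.sum_add_distrib]
  rw [sum_cos_eq_zero (by omega) (by omega)]
  simp

theorem sum_cosMode_mul_of_lt {N α β : ℕ} (hαβ : α < β) (hβ : β < N) :
    ∑ k : Fin N, cosMode N α k * cosMode N β k = 0 := by
  have hN : 0 < N := by omega
  have h := sum_cos_mul_cos_of_lt hαβ hβ
  have e : ∀ k : Fin N, cosMode N α k * cosMode N β k =
      ((√(N : ℝ))⁻¹ * (√(N : ℝ))⁻¹ * (if α = 0 then 1 else √2) * √2) *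
      (Real.cos (Real.pi * α / N * ((k : ℝ) + 1 / 2))
      * Real.cos (Real.pi * β / N * ((k : ℝ) + 1 / 2))) := by
    intro k
    have hβ0 : β ≠ 0 := by omega
    simp only [cosMode, cos_arg_eq hN, if_neg hβ0]
    by_cases hα : α = 0
    · simp [hα]; ring
    · simp only [if_neg hα]; ring
  simp only [e, ← Finset.mul_sum, h, mul_zero]

theorem sum_cosMode_sq {N α : ℕ} (hα : α < N) : ∑ k : Fin N, cosMode N α k * cosMode N α k = 1 := by
  have hN : 0 < N := by omega
  have hN' : (0 : ℝ) < N := by exact_mod_cast hN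
  have hs : (√(N : ℝ))⁻¹ * (√(N : ℝ))⁻¹ = 1 / N := by
    rw [← mul_inv, Real.mul_self_sqrt hN'.le, one_div]
  by_cases h0 : α = 0
  · simp [cosMode, h0, hs, hN'.ne']
  · have e : ∀ k : Fin N, cosMode N α k * cosMode N α k =
        2 / N * Real.cos (Real.pi * α / N * ((k : ℝ) + 1 / 2)) ^ 2 := by
      intro k
      simp only [cosMode, cos_arg_eq hN, if_neg h0]
      have h2 : √(2 : ℝ) * √2 = 2 := Real.mul_self_sqrt zero_le_two
      linear_combination (Real.cos (Real.pi * α / N * ((k : ℝ) + 1 / 2))) ^ 2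
        * (√2 * √2 * hs + 1 / N * h2)
    simp only [e, ← Finset.mul_sum, sum_cos_sq (Nat.pos_of_ne_zero h0) hα]
    field_simp

theorem sum_cosMode_mul {N α β : ℕ} (hα : α < N) (hβ : β < N) :
    ∑ k : Fin N, cosMode N α k * cosMode N β k = if α = β then 1 else 0 := by
  split_ifs with h
  · subst h; exact sum_cosMode_sq hα
  · rcases lt_or_gt_of_ne h with h | h
    · exact sum_cosMode_mul_of_lt h hβ
    · simp only [mul_comm (cosMode N α _)]
      exact sum_cosMode_mul_of_lt h hα

/-- The coefficient of `v` along the mode `α`. -/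
noncomputable def cosCoeff {N : ℕ} (v : Fin N → ℝ) (α : ℕ) : ℝ := ∑ k, cosMode N α k * v k

theorem sum_cosMode_mul_dual {N : ℕ} (k l : Fin N) :
    ∑ α ∈ Finset.range N, cosMode N α k * cosMode N α l = if k = l then 1 else 0 := by
  let M : Matrix (Fin N) (Fin N) ℝ := Matrix.of fun α k => cosMode N α k
  have h1 : M * M.transpose = 1 := by
    ext α β
    rw [Matrix.mul_apply, Matrix.one_apply]
    simp only [M, Matrix.transpose_apply, Matrix.of_apply]
    rw [sum_cosMode_mul α.2 β.2]
    simp [Fin.ext_iff]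
  -- Orthonormality of the `N` rows of a square matrix gives that of the columns, hence
  -- completeness.
  have h3 : M.transpose * M = 1 := mul_eq_one_comm.1 h1
  have h2 := congrFun (congrFun h3 k) l
  rw [Matrix.mul_apply, Matrix.one_apply] at h2
  rw [← h2, Finset.sum_range]
  rfl

theorem sum_cosCoeff_mul_cosMode {N : ℕ} (v : Fin N → ℝ) (k : Fin N) :
    ∑ α ∈ Finset.range N, cosCoeff v α * cosMode N α k = v k := by
  simp only [cosCoeff, Finset.sum_mul]
  rw [Finset.sum_comm]
  have e : ∀ l, ∑ α ∈ Finset.range N, cosMode N α l * v l * cosMode N α k =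
      v l * if l = k then 1 else 0 := fun l => by
    rw [← sum_cosMode_mul_dual l k, Finset.mul_sum]
    exact Finset.sum_congr rfl fun α _ => by ring
  simp [e]

theorem sum_sq_eq_sum_cosCoeff_sq {N : ℕ} (v : Fin N → ℝ) :
    ∑ k, v k ^ 2 = ∑ α ∈ Finset.range N, cosCoeff v α ^ 2 := by
  have e : ∀ k, v k ^ 2 = ∑ α ∈ Finset.range N, cosCoeff v α * (cosMode N α k * v k) := fun k => by
    rw [pow_two]
    nth_rewrite 1 [← sum_cosCoeff_mul_cosMode v k]
    rw [Finset.sum_mul]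
    exact Finset.sum_congr rfl fun α _ => by ring
  simp only [e]
  rw [Finset.sum_comm]
  refine Finset.sum_congr rfl fun α _ => ?_
  rw [← Finset.mul_sum, pow_two]
  rfl

/-- The projection to the modes `0, …, ℓ`. -/
noncomputable def lowPart {N : ℕ} (ℓ : ℕ) (v : Fin N → ℝ) (k : Fin N) : ℝ :=
  ∑ α ∈ Finset.range (ℓ + 1), cosCoeff v α * cosMode N α k

theorem cosCoeff_lowPart {N ℓ α : ℕ} (hℓ : ℓ < N) (hα : α < N) (v : Fin N → ℝ) :
    cosCoeff (lowPart ℓ v) α = if α ≤ ℓ then cosCoeff v α else 0 := by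
  have e : cosCoeff (lowPart ℓ v) α = ∑ β ∈ Finset.range (ℓ + 1), cosCoeff v β *
      ∑ k, cosMode N α k * cosMode N β k := by
    simp only [cosCoeff, lowPart, Finset.mul_sum]
    rw [Finset.sum_comm]
    refine Finset.sum_congr rfl fun β _ => Finset.sum_congr rfl fun k _ => ?_
    simp only [Finset.sum_mul, Finset.mul_sum]
    exact Finset.sum_congr rfl fun j _ => by ring
  rw [e]
  have e2 : ∀ β ∈ Finset.range (ℓ + 1), cosCoeff v β * ∑ k, cosMode N α k * cosMode N β k =
      if α = β then cosCoeff v β else 0 := fun β hβ => by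
    have hβ := Finset.mem_range.1 hβ
    rw [sum_cosMode_mul hα (by omega)]
    split_ifs <;> simp
  rw [Finset.sum_congr rfl e2, Finset.sum_ite_eq]
  simp

theorem sum_lowPart_sq {N ℓ : ℕ} (hℓ : ℓ < N) (v : Fin N → ℝ) :
    ∑ k, lowPart ℓ v k ^ 2 = ∑ α ∈ Finset.range (ℓ + 1), cosCoeff v α ^ 2 := by
  rw [sum_sq_eq_sum_cosCoeff_sq]
  have hsub : Finset.range (ℓ + 1) ⊆ Finset.range N := Finset.range_subset_range.2 (by omega)
  rw [← Finset.sum_subset hsub fun α hα hα' => ?_]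
  · refine Finset.sum_congr rfl fun α hα => ?_
    have hα := Finset.mem_range.1 hα
    rw [cosCoeff_lowPart hℓ (by omega), if_pos (by omega)]
  · rw [cosCoeff_lowPart hℓ (Finset.mem_range.1 hα), if_neg (by
      rw [Finset.mem_range] at hα'; omega)]
    simp

theorem cosCoeff_sub {N : ℕ} (v w : Fin N → ℝ) (α : ℕ) :
    cosCoeff (fun k => v k - w k) α = cosCoeff v α - cosCoeff w α := by
  simp [cosCoeff, mul_sub]

theorem sum_highPart_sq {N ℓ : ℕ} (hℓ : ℓ < N) (v : Fin N → ℝ) :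
    ∑ k, (v k - lowPart ℓ v k) ^ 2 = ∑ α ∈ Finset.Ico (ℓ + 1) N, cosCoeff v α ^ 2 := by
  rw [sum_sq_eq_sum_cosCoeff_sq fun k => v k - lowPart ℓ v k]
  have hsub : Finset.Ico (ℓ + 1) N ⊆ Finset.range N := fun α hα => by
    rw [Finset.mem_range]; exact (Finset.mem_Ico.1 hα).2
  rw [← Finset.sum_subset hsub fun α hα hα' => ?_]
  · refine Finset.sum_congr rfl fun α hα => ?_
    have hα := Finset.mem_Ico.1 hα
    rw [cosCoeff_sub, cosCoeff_lowPart hℓ (by omega), if_neg (by omega), sub_zero]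
  · have hα := Finset.mem_range.1 hα
    rw [cosCoeff_sub, cosCoeff_lowPart hℓ hα, if_pos (by rw [Finset.mem_Ico] at hα'; omega)]
    simp

theorem abs_cosMode_le (N α : ℕ) (k : Fin N) : |cosMode N α k| ≤ √2 * (√(N : ℝ))⁻¹ := by
  rw [cosMode, abs_mul, abs_of_nonneg (inv_nonneg.2 (Real.sqrt_nonneg _)), mul_comm]
  refine mul_le_mul_of_nonneg_right ?_ (by positivity)
  split_ifs
  · simp
  · rw [abs_mul, abs_of_nonneg (Real.sqrt_nonneg _)]
    exact mul_le_of_le_one_right (Real.sqrt_nonneg _) (Real.abs_cos_le_one _)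

/-- Delocalization of low modes, by Cauchy–Schwarz: each of the `ℓ + 1` modes has squared entries at
most `2 / N`. -/
theorem lowPart_sq_le {N ℓ : ℕ} (hℓ : ℓ < N) (v : Fin N → ℝ) (k : Fin N) :
    lowPart ℓ v k ^ 2 ≤ 2 * (ℓ + 1) / N * ∑ i, lowPart ℓ v i ^ 2 := by
  have hN' : (0 : ℝ) < N := by
    have : 0 < N := by omega
    exact_mod_cast this
  rw [sum_lowPart_sq hℓ, lowPart, mul_comm]
  refine (Finset.sum_mul_sq_le_sq_mul_sq _ _ _).trans ?_
  refine mul_le_mul_of_nonneg_left ?_ (Finset.sum_nonneg fun _ _ => sq_nonneg _)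
  calc ∑ α ∈ Finset.range (ℓ + 1), cosMode N α k ^ 2
      ≤ ∑ α ∈ Finset.range (ℓ + 1), (2 / N : ℝ) := by
        refine Finset.sum_le_sum fun α _ => ?_
        have := pow_le_pow_left₀ (abs_nonneg _) (abs_cosMode_le N α k) 2
        rwa [sq_abs, mul_pow, inv_pow, Real.sq_sqrt zero_le_two, Real.sq_sqrt hN'.le,
          ← div_eq_mul_inv] at this
    _ = _ := by simp; ring

theorem cosCoeff_zero_sq {N : ℕ} (v : Fin N → ℝ) : cosCoeff v 0 ^ 2 = (∑ k, v k) ^ 2 / N := by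
  simp only [cosCoeff, cosMode, if_pos, mul_one, ← Finset.mul_sum]
  rw [mul_pow, inv_pow, Real.sq_sqrt (Nat.cast_nonneg N), div_eq_inv_mul]

/-! ### Spectral lower bound for the matrix `Q` -/

theorem centeredMod_mem {N : ℕ} (hN : 0 < N) (n : ℤ) :
    centeredMod N n ∈ Finset.Ioc (-(N : ℤ)) N := by
  have h1 := Int.emod_nonneg (n + ((N : ℤ) - 1)) (show (2 * N : ℤ) ≠ 0 by omega)
  have h2 := Int.emod_lt_of_pos (n + ((N : ℤ) - 1)) (show (0 : ℤ) < 2 * N by omega)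
  rw [Finset.mem_Ioc, centeredMod]
  omega

theorem exists_centeredMod_eq (N : ℕ) (n : ℤ) : ∃ m : ℤ, centeredMod N n = n + m * (2 * N) := by
  refine ⟨-((n + ((N : ℤ) - 1)) / (2 * N)), ?_⟩
  have := Int.emod_add_mul_ediv (n + ((N : ℤ) - 1)) (2 * N)
  rw [centeredMod]
  linarith

theorem centeredMod_add_mul (N : ℕ) (n m : ℤ) :
    centeredMod N (n + m * (2 * N)) = centeredMod N n := by
  rw [centeredMod, centeredMod, show n + m * (2 * N) + ((N : ℤ) - 1) =
    n + ((N : ℤ) - 1) + m * (2 * N) by ring, Int.add_mul_emod_self_right]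

theorem centeredMod_of_mem {N : ℕ} {n : ℤ} (hn : n ∈ Finset.Ioc (-(N : ℤ)) N) :
    centeredMod N n = n := by
  rw [Finset.mem_Ioc] at hn
  rw [centeredMod, Int.emod_eq_of_lt (by omega) (by omega)]
  ring

theorem abs_centeredMod_neg {N : ℕ} (hN : 0 < N) (n : ℤ) :
    |centeredMod N (-n)| = |centeredMod N n| := by
  have hmem := centeredMod_mem hN n
  obtain ⟨m, hm⟩ := exists_centeredMod_eq N n
  rw [Finset.mem_Ioc] at hmem
  by_cases h : centeredMod N n = N
  · have : centeredMod N (-n) = N := by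
      rw [show -n = N + (m - 1) * (2 * N) by linarith, centeredMod_add_mul]
      exact centeredMod_of_mem (Finset.mem_Ioc.2 ⟨by omega, le_rfl⟩)
    rw [this, h]
  · have : centeredMod N (-n) = -centeredMod N n := by
      rw [show -n = -centeredMod N n + m * (2 * N) by linarith, centeredMod_add_mul]
      exact centeredMod_of_mem (Finset.mem_Ioc.2 ⟨by omega, by omega⟩)
    rw [this, abs_neg]

theorem sum_Ioc_reflect {N : ℕ} (hN : 0 < N) {f : ℤ → ℝ}
    (hf : ∀ n m : ℤ, f (n + m * (2 * N)) = f n) (a : ℤ) :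
    ∑ l ∈ Finset.Ioc (-(N : ℤ)) N, f (a - l) = ∑ l ∈ Finset.Ioc (-(N : ℤ)) N, f l := by
  have hinv : ∀ l ∈ Finset.Ioc (-(N : ℤ)) N,
      centeredMod N (a - centeredMod N (a - l)) = l := by
    intro l hl
    obtain ⟨m, hm⟩ := exists_centeredMod_eq N (a - l)
    rw [hm, show a - (a - l + m * (2 * N)) = l + -m * (2 * N) by ring, centeredMod_add_mul]
    exact centeredMod_of_mem hl
  refine Finset.sum_nbij' (fun l => centeredMod N (a - l)) (fun l => centeredMod N (a - l))
    (fun l _ => centeredMod_mem hN _) (fun l _ => centeredMod_mem hN _) hinv hinv ?_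
  intro l _
  obtain ⟨m, hm⟩ := exists_centeredMod_eq N (a - l)
  rw [hm, hf]

/-- The involution `l ↦ 1 - l` exchanges `1, …, N` with `0, -1, …, -N + 1`; this is the unfolding
behind the definition of `Q`. -/
theorem sum_Ioc_eq_sum_fin (N : ℕ) (f : ℤ → ℝ) :
    ∑ l ∈ Finset.Ioc (-(N : ℤ)) N, f l = ∑ j : Fin N, (f ((j : ℤ) + 1) + f (1 - ((j : ℤ) + 1))) := by
  rw [Fin.sum_univ_eq_sum_range (fun j : ℕ => f ((j : ℤ) + 1) + f (1 - ((j : ℤ) + 1))) N]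
  induction N with
  | zero => simp
  | succ n ih =>
    have e : Finset.Ioc (-((n + 1 : ℕ) : ℤ)) ((n + 1 : ℕ) : ℤ) =
        insert ((n : ℤ) + 1) (insert (-(n : ℤ)) (Finset.Ioc (-(n : ℤ)) n)) := by
      ext x
      simp only [Finset.mem_Ioc, Finset.mem_insert]
      omega
    rw [e, Finset.sum_insert (by simp only [Finset.mem_insert, Finset.mem_Ioc]; omega),
      Finset.sum_insert (by simp), ih, Finset.sum_range_succ,
      show (1 : ℤ) - ((n : ℤ) + 1) = -n by ring]
    ring

theorem matR_nonneg (N : ℕ) {ε : ℝ} (hε : 0 < ε) (k l : ℤ) : 0 ≤ matR N ε k l := by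
  unfold matR; positivity

theorem matQ_nonneg (N : ℕ) {ε : ℝ} (hε : 0 < ε) (i j : Fin N) : 0 ≤ matQ N ε i j := by
  have := fun k l => matR_nonneg N hε k l
  rw [matQ, matQInt]
  linarith [this ((i : ℤ) + 1) ((j : ℤ) + 1), this (1 - ((i : ℤ) + 1)) ((j : ℤ) + 1),
    this ((i : ℤ) + 1) (1 - ((j : ℤ) + 1)), this (1 - ((i : ℤ) + 1)) (1 - ((j : ℤ) + 1))]

theorem matR_eq_of_abs_eq {N : ℕ} {ε : ℝ} {k l k' l' : ℤ}
    (h : |centeredMod N (k - l)| = |centeredMod N (k' - l')|) :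
    matR N ε k l = matR N ε k' l' := by
  rw [matR, matR, circDist, circDist, h]

theorem matR_eq_sub {N : ℕ} {ε : ℝ} (k l : ℤ) : matR N ε k l = matR N ε (k - l) 0 :=
  matR_eq_of_abs_eq (by rw [sub_zero])

theorem matR_neg {N : ℕ} (hN : 0 < N) {ε : ℝ} (d : ℤ) : matR N ε (-d) 0 = matR N ε d 0 :=
  matR_eq_of_abs_eq (by rw [sub_zero, sub_zero, abs_centeredMod_neg hN])

theorem matR_add_mul {N : ℕ} {ε : ℝ} (d m : ℤ) :
    matR N ε (d + m * (2 * N)) 0 = matR N ε d 0 :=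
  matR_eq_of_abs_eq (by rw [sub_zero, sub_zero, centeredMod_add_mul])

/-- The four terms of `Q` pair up by evenness of the circular distance. -/
theorem matQ_eq {N : ℕ} (ε : ℝ) (i j : Fin N) :
    matQ N ε i j = 2 * (matR N ε ((i : ℤ) + 1 - ((j : ℤ) + 1)) 0 +
      matR N ε ((i : ℤ) + 1 - (1 - ((j : ℤ) + 1))) 0) := by
  have hN : 0 < N := by have := i.2; omega
  rw [matQ, matQInt, matR_eq_sub ((i : ℤ) + 1), matR_eq_sub (1 - ((i : ℤ) + 1)),
    matR_eq_sub ((i : ℤ) + 1), matR_eq_sub (1 - ((i : ℤ) + 1)),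
    ← matR_neg hN (1 - ((i : ℤ) + 1) - ((j : ℤ) + 1)),
    ← matR_neg hN (1 - ((i : ℤ) + 1) - (1 - ((j : ℤ) + 1))),
    show -(1 - ((i : ℤ) + 1) - ((j : ℤ) + 1)) = (i : ℤ) + 1 - (1 - ((j : ℤ) + 1)) by ring,
    show -(1 - ((i : ℤ) + 1) - (1 - ((j : ℤ) + 1))) = (i : ℤ) + 1 - ((j : ℤ) + 1) by ring]
  ring

theorem matQ_comm {N : ℕ} (ε : ℝ) (i j : Fin N) : matQ N ε i j = matQ N ε j i := by
  have hN : 0 < N := by have := i.2; omega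
  rw [matQ_eq, matQ_eq, ← matR_neg hN ((i : ℤ) + 1 - ((j : ℤ) + 1)),
    show -((i : ℤ) + 1 - ((j : ℤ) + 1)) = (j : ℤ) + 1 - ((i : ℤ) + 1) by ring,
    show (i : ℤ) + 1 - (1 - ((j : ℤ) + 1)) = (j : ℤ) + 1 - (1 - ((i : ℤ) + 1)) by ring]

/-- The eigenvalue of the graph Laplacian of `Q` on the mode `α`. -/
noncomputable def matQEigenvalue (N : ℕ) (ε : ℝ) (α : ℕ) : ℝ :=
  2 * ∑ d ∈ Finset.Ioc (-(N : ℤ)) N, matR N ε d 0 * (1 - Real.cos (Real.pi * α / N * d))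

/-- The half-integer cosines extend to functions on the circle of length `2N` that are invariant
under `l ↦ 1 - l`. On such functions `Q` acts as twice convolution with `R`, so they are
eigenvectors of its graph Laplacian. -/
theorem sum_matQ_mul_cos_sub {N : ℕ} (ε : ℝ) (α : ℕ) (i : Fin N) :
    ∑ j : Fin N, matQ N ε i j * (Real.cos (Real.pi * α / N * ((i : ℝ) + 1 / 2)) -
      Real.cos (Real.pi * α / N * ((j : ℝ) + 1 / 2))) =
      matQEigenvalue N ε α * Real.cos (Real.pi * α / N * ((i : ℝ) + 1 / 2)) := by
  have hN : 0 < N := by have := i.2; omega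
  have hN' : (0 : ℝ) < N := by exact_mod_cast hN
  set w : ℤ → ℝ := fun n => Real.cos (Real.pi * α / N * ((n : ℝ) - 1 / 2)) with hw
  have hwper : ∀ n m : ℤ, w (n + m * (2 * N)) = w n := by
    intro n m
    simp only [hw]
    rw [← Real.cos_add_int_mul_two_pi (Real.pi * α / N * ((n : ℝ) - 1 / 2)) (m * α)]
    congr 1
    push_cast
    field_simp
    ring
  have hwrefl : ∀ n : ℤ, w (1 - n) = w n := by
    intro n
    simp only [hw]
    rw [← Real.cos_neg]
    congr 1
    push_cast; ring
  have hwfin : ∀ j : Fin N, Real.cos (Real.pi * α / N * ((j : ℝ) + 1 / 2)) = w ((j : ℤ) + 1) := by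
    intro j
    simp only [hw]
    congr 1
    push_cast; ring
  set n : ℤ := (i : ℤ) + 1 with hn
  set S := Finset.Ioc (-(N : ℤ)) N
  have h1 : ∑ j : Fin N, matQ N ε i j * (w n - w ((j : ℤ) + 1)) =
      2 * ∑ l ∈ S, matR N ε (n - l) 0 * (w n - w l) := by
    rw [sum_Ioc_eq_sum_fin, Finset.mul_sum]
    refine Finset.sum_congr rfl fun j _ => ?_
    rw [matQ_eq, hwrefl]
    ring
  have h2 : ∑ l ∈ S, matR N ε (n - l) 0 * (w n - w l) =
      ∑ d ∈ S, matR N ε d 0 * (w n - w (n - d)) := by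
    rw [← sum_Ioc_reflect hN (f := fun d => matR N ε d 0 * (w n - w (n - d))) ?_ n]
    · simp only [sub_sub_cancel]
      rfl
    · intro d m
      rw [matR_add_mul, show n - (d + m * (2 * N)) = n - d + -m * (2 * N) by ring, hwper]
  -- Averaging the sums over `d` and `-d` brings in `w (n - d) + w (n + d)`, a multiple of `w n`.
  have h3 : ∑ d ∈ S, matR N ε d 0 * (w n - w (n - d)) =
      ∑ d ∈ S, matR N ε d 0 * (w n - w (n + d)) := by
    rw [← sum_Ioc_reflect hN (f := fun d => matR N ε d 0 * (w n - w (n - d))) ?_ 0]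
    · refine Finset.sum_congr rfl fun d _ => ?_
      rw [zero_sub, matR_neg hN, sub_neg_eq_add]
    · intro d m
      rw [matR_add_mul, show n - (d + m * (2 * N)) = n - d + -m * (2 * N) by ring, hwper]
  have h4 : ∀ d : ℤ, w (n - d) + w (n + d) = 2 * w n * Real.cos (Real.pi * α / N * d) := by
    intro d
    simp only [hw]
    rw [show Real.pi * α / N * (((n - d : ℤ) : ℝ) - 1 / 2) =
      Real.pi * α / N * ((n : ℝ) - 1 / 2) - Real.pi * α / N * d by push_cast; ring,
      show Real.pi * α / N * (((n + d : ℤ) : ℝ) - 1 / 2) =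
      Real.pi * α / N * ((n : ℝ) - 1 / 2) + Real.pi * α / N * d by push_cast; ring,
      Real.cos_add, Real.cos_sub]
    ring
  simp only [hwfin]
  rw [h1, h2, two_mul]
  nth_rewrite 2 [h3]
  rw [← Finset.sum_add_distrib, matQEigenvalue, mul_assoc, Finset.sum_mul, Finset.mul_sum]
  refine Finset.sum_congr rfl fun d _ => ?_
  linear_combination (-matR N ε d 0) * h4 d

theorem sum_matQ_mul_cosMode_sub {N : ℕ} (ε : ℝ) (α : ℕ) (i : Fin N) :
    ∑ j : Fin N, matQ N ε i j * (cosMode N α i - cosMode N α j) =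
      matQEigenvalue N ε α * cosMode N α i := by
  have hN : 0 < N := by have := i.2; omega
  by_cases hα : α = 0
  · subst hα
    simp [cosMode, matQEigenvalue]
  · simp only [cosMode, if_neg hα, cos_arg_eq hN]
    rw [show matQEigenvalue N ε α * ((√(N : ℝ))⁻¹ *
      (√2 * Real.cos (Real.pi * α / N * ((i : ℝ) + 1 / 2)))) = (√(N : ℝ))⁻¹ * √2 *
      (matQEigenvalue N ε α * Real.cos (Real.pi * α / N * ((i : ℝ) + 1 / 2))) by ring,
      ← sum_matQ_mul_cos_sub, Finset.mul_sum]
    exact Finset.sum_congr rfl fun j _ => by ring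

theorem sum_matQ_mul_sub_sq {N : ℕ} (ε : ℝ) (v : Fin N → ℝ) :
    ∑ i, ∑ j, matQ N ε i j * (v i - v j) ^ 2 =
      2 * ∑ α ∈ Finset.range N, matQEigenvalue N ε α * cosCoeff v α ^ 2 := by
  have h1 : ∑ i, ∑ j, matQ N ε i j * (v i - v j) ^ 2 =
      2 * ∑ i, v i * ∑ j, matQ N ε i j * (v i - v j) := by
    have hc : ∑ i, ∑ j, matQ N ε i j * (v j * (v i - v j)) =
        -∑ i, ∑ j, matQ N ε i j * (v i * (v i - v j)) := by
      rw [Finset.sum_comm, ← Finset.sum_neg_distrib]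
      refine Finset.sum_congr rfl fun i _ => ?_
      rw [← Finset.sum_neg_distrib]
      refine Finset.sum_congr rfl fun j _ => ?_
      rw [matQ_comm]; ring
    have hs : ∑ i, ∑ j, matQ N ε i j * (v i - v j) ^ 2 =
        ∑ i, ∑ j, matQ N ε i j * (v i * (v i - v j)) -
          ∑ i, ∑ j, matQ N ε i j * (v j * (v i - v j)) := by
      rw [← Finset.sum_sub_distrib]
      refine Finset.sum_congr rfl fun i _ => ?_
      rw [← Finset.sum_sub_distrib]
      exact Finset.sum_congr rfl fun j _ => by ring
    rw [hs, hc, sub_neg_eq_add, ← two_mul]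
    congr 1
    refine Finset.sum_congr rfl fun i _ => ?_
    rw [Finset.mul_sum]
    exact Finset.sum_congr rfl fun j _ => by ring
  have h2 : ∀ i, ∑ j, matQ N ε i j * (v i - v j) =
      ∑ α ∈ Finset.range N, cosCoeff v α * (matQEigenvalue N ε α * cosMode N α i) := by
    intro i
    have : ∀ j, v i - v j =
        ∑ α ∈ Finset.range N, cosCoeff v α * (cosMode N α i - cosMode N α j) := by
      intro j
      simp only [mul_sub, Finset.sum_sub_distrib, sum_cosCoeff_mul_cosMode]
    simp only [this, Finset.mul_sum]
    rw [Finset.sum_comm]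
    refine Finset.sum_congr rfl fun α _ => ?_
    rw [← sum_matQ_mul_cosMode_sub, Finset.mul_sum]
    exact Finset.sum_congr rfl fun j _ => by ring
  rw [h1]
  simp only [h2, Finset.mul_sum]
  rw [Finset.sum_comm]
  refine Finset.sum_congr rfl fun α _ => ?_
  rw [show cosCoeff v α ^ 2 = cosCoeff v α * ∑ k, cosMode N α k * v k from pow_two _]
  simp only [Finset.mul_sum]
  exact Finset.sum_congr rfl fun j _ => by ring

theorem matQEigenvalue_nonneg (N : ℕ) {ε : ℝ} (hε : 0 < ε) (α : ℕ) :
    0 ≤ matQEigenvalue N ε α :=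
  mul_nonneg zero_le_two <| Finset.sum_nonneg fun _ _ =>
    mul_nonneg (matR_nonneg N hε _ _) (sub_nonneg.2 (Real.cos_le_one _))

theorem le_matR {N : ℕ} {ε : ℝ} (hε : 0 < ε) (hε1 : ε ≤ 1) {d : ℕ} (hd : (d : ℝ) ≤ ε * N)
    (hd0 : 0 < d) : ε ^ (2 / 3 : ℝ) / (2 * ε ^ 2 * N) ≤ matR N ε d 0 := by
  have hN : (0 : ℝ) < N := by
    have : (0 : ℝ) < d := by exact_mod_cast hd0
    by_contra h
    have : (N : ℝ) ≤ 0 := not_lt.1 h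
    nlinarith
  have hdN : d ≤ N := by
    have : (d : ℝ) ≤ N := hd.trans (mul_le_of_le_one_left hN.le hε1)
    exact_mod_cast this
  have hc : circDist N d 0 = d := by
    rw [circDist, sub_zero, centeredMod_of_mem (Finset.mem_Ioc.2 ⟨by omega, by omega⟩)]
    simp
  rw [matR, hc]
  have h1 : ((d : ℤ) : ℝ) ^ 2 / (N : ℝ) ^ 2 ≤ ε ^ 2 := by
    rw [Int.cast_natCast, div_le_iff₀ (by positivity), ← mul_pow]
    exact pow_le_pow_left₀ (by positivity) hd 2
  have hp : 0 < ε ^ (2 / 3 : ℝ) := Real.rpow_pos_of_pos hε _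
  calc ε ^ (2 / 3 : ℝ) / (2 * ε ^ 2 * N) = 1 / N * (ε ^ (2 / 3 : ℝ) / (ε ^ 2 + ε ^ 2)) := by
        field_simp; ring
    _ ≤ _ := by gcongr

/-- Only distances `1 ≤ d ≤ εN` are kept, where `R` is at least `ε^{2/3} / (2 ε² N)`. For `α ≥ 2/ε`
the cosine oscillates enough on this range that `1 - cos` sums to at least `εN / 2`. -/
theorem le_matQEigenvalue {N α : ℕ} {ε : ℝ} (hε : 0 < ε) (hε1 : ε ≤ 1) (hN : 2 ≤ ε * N)
    (hα : 2 ≤ ε * α) (hαN : α < N) :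
    ε ^ (2 / 3 : ℝ) / (2 * ε) ≤ matQEigenvalue N ε α := by
  have hN0 : (0 : ℝ) < N := by
    have : 0 < N := by omega
    exact_mod_cast this
  have hα0 : (0 : ℝ) < α := by
    by_contra h
    have : (α : ℝ) ≤ 0 := not_lt.1 h
    nlinarith
  have hαN' : (α : ℝ) < N := by exact_mod_cast hαN
  set D := ⌊ε * N⌋₊
  have hD1 : (D : ℝ) ≤ ε * N := Nat.floor_le (by positivity)
  have hD2 : ε * N < D + 1 := Nat.lt_floor_add_one _
  have hDN : D ≤ N := by
    have : (D : ℝ) ≤ N := hD1.trans (mul_le_of_le_one_left hN0.le hε1)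
    exact_mod_cast this
  set φ := Real.pi * α / N with hφ
  have hsin : (α : ℝ) / N ≤ Real.sin (φ / 2) := by
    have h0 : 0 ≤ φ / 2 := by positivity
    have h1 : φ / 2 ≤ Real.pi / 2 := by
      have : φ ≤ Real.pi := by
        rw [hφ, div_le_iff₀ hN0]
        exact mul_le_mul_of_nonneg_left hαN'.le Real.pi_pos.le
      linarith
    have := Real.mul_le_sin h0 h1
    have e : 2 / Real.pi * (φ / 2) = α / N := by rw [hφ]; field_simp
    rwa [e] at this
  -- The Dirichlet sum is at most `1 / (2 sin (φ/2)) - 1/2`, and Jordan's inequality bounds the sine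
  -- below by `α / N`.
  have hdir : ∑ d ∈ Finset.Icc 1 D, Real.cos (φ * d) ≤ ε * N / 4 - 1 / 2 := by
    have h := two_mul_sin_mul_sum_cos_succ φ D
    set s := Real.sin (φ / 2)
    set T := ∑ d ∈ Finset.Icc 1 D, Real.cos (φ * d)
    have hs0 : 0 < α / (N : ℝ) := by positivity
    have hs : 0 < s := hs0.trans_le hsin
    have h1 : 2 * s * (T + 1 / 2) ≤ 1 := by
      have := Real.sin_le_one (φ * (D + 1 / 2))
      linarith
    have h2 : 1 ≤ 2 * s * (ε * N / 4) := by
      have h3 : α / (N : ℝ) * (ε * N / 4) = ε * α / 4 := by field_simp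
      have h4 := mul_le_mul_of_nonneg_right hsin (show 0 ≤ ε * N / 4 by positivity)
      nlinarith
    have h3 : T + 1 / 2 ≤ ε * N / 4 :=
      le_of_mul_le_mul_left (h1.trans h2) (by positivity)
    linarith
  have hsum : ε * N / 2 ≤ ∑ d ∈ Finset.Icc 1 D, (1 - Real.cos (φ * d)) := by
    rw [Finset.sum_sub_distrib]
    simp only [Finset.sum_const, Nat.card_Icc, Nat.add_sub_cancel, nsmul_eq_mul, mul_one]
    linarith
  have hp : 0 < ε ^ (2 / 3 : ℝ) := Real.rpow_pos_of_pos hε _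
  rw [matQEigenvalue]
  have hemb : ∑ d ∈ Finset.Icc 1 D, matR N ε d 0 * (1 - Real.cos (φ * d)) ≤
      ∑ d ∈ Finset.Ioc (-(N : ℤ)) N, matR N ε d 0 * (1 - Real.cos (φ * d)) := by
    have := Finset.sum_map (Finset.Icc 1 D) Nat.castEmbedding
      (fun d : ℤ => matR N ε d 0 * (1 - Real.cos (φ * d)))
    simp only [Nat.castEmbedding_apply, Int.cast_natCast] at this
    rw [← this]
    refine Finset.sum_le_sum_of_subset_of_nonneg ?_ fun d _ _ =>
      mul_nonneg (matR_nonneg N hε _ _) (sub_nonneg.2 (Real.cos_le_one _))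
    intro d hd
    obtain ⟨m, hm, rfl⟩ := Finset.mem_map.1 hd
    rw [Finset.mem_Icc] at hm
    rw [Finset.mem_Ioc, Nat.castEmbedding_apply]
    omega
  calc ε ^ (2 / 3 : ℝ) / (2 * ε)
      = 2 * (ε ^ (2 / 3 : ℝ) / (2 * ε ^ 2 * N) * (ε * N / 2)) := by field_simp
    _ ≤ 2 * (ε ^ (2 / 3 : ℝ) / (2 * ε ^ 2 * N) *
          ∑ d ∈ Finset.Icc 1 D, (1 - Real.cos (φ * d))) := by gcongr
    _ ≤ 2 * ∑ d ∈ Finset.Icc 1 D, matR N ε d 0 * (1 - Real.cos (φ * d)) := by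
        rw [Finset.mul_sum (Finset.Icc 1 D)]
        refine mul_le_mul_of_nonneg_left (Finset.sum_le_sum fun d hd => ?_) zero_le_two
        rw [Finset.mem_Icc] at hd
        refine mul_le_mul_of_nonneg_right (le_matR hε hε1 ?_ (by omega))
          (sub_nonneg.2 (Real.cos_le_one _))
        exact le_trans (by exact_mod_cast hd.2) hD1
    _ ≤ _ := by linarith

theorem le_sum_matQ_mul_sub_sq {N ℓ : ℕ} {ε : ℝ} (hε : 0 < ε) (hε1 : ε ≤ 1) (hN : 2 ≤ ε * N)
    (hℓ : 2 ≤ ε * ℓ) (hℓN : ℓ < N) (v : Fin N → ℝ) :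
    ε ^ (2 / 3 : ℝ) / ε * ∑ k, (v k - lowPart ℓ v k) ^ 2 ≤
      ∑ i, ∑ j, matQ N ε i j * (v i - v j) ^ 2 := by
  rw [sum_matQ_mul_sub_sq, sum_highPart_sq hℓN, Finset.mul_sum, Finset.mul_sum]
  have hsub : Finset.Ico (ℓ + 1) N ⊆ Finset.range N := fun α hα => by
    rw [Finset.mem_range]; exact (Finset.mem_Ico.1 hα).2
  refine (Finset.sum_le_sum fun α hα => ?_).trans
    (Finset.sum_le_sum_of_subset_of_nonneg hsub fun α _ _ =>
      mul_nonneg zero_le_two (mul_nonneg (matQEigenvalue_nonneg N hε α) (sq_nonneg _)))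
  rw [Finset.mem_Ico] at hα
  have hα' : (ℓ : ℝ) ≤ α := by exact_mod_cast (by omega : ℓ ≤ α)
  have h := le_matQEigenvalue hε hε1 hN
    (hℓ.trans (mul_le_mul_of_nonneg_left hα' hε.le)) hα.2
  have e : ε ^ (2 / 3 : ℝ) / ε = 2 * (ε ^ (2 / 3 : ℝ) / (2 * ε)) := by field_simp
  rw [e, mul_assoc]
  exact mul_le_mul_of_nonneg_left (mul_le_mul_of_nonneg_right h (sq_nonneg _)) zero_le_two

/-! ### Second differences of the convexified Hamiltonian -/

section
variable {θ : ℝ → ℝ}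

/-- No one-sided derivative at `1` is assumed. Since `θ` starts from zero at `1` and stays
nonnegative, the mean value theorem finds points near `1` with `θ' ≥ 0`, and `θ'' ≥ 1` propagates
this to `u`. -/
theorem IsConfining.sub_one_le_deriv (hθ : IsConfining θ) {u : ℝ} (hu : 1 < u) :
    u - 1 ≤ deriv θ u := by
  have habs : ∀ x : ℝ, 1 < x → 1 < |x| := fun x hx => hx.trans_le (le_abs_self x)
  have key : ∀ a ∈ Ioo 1 u, u - a ≤ deriv θ u := by
    intro a ha
    have h1 : 0 ≤ deriv θ a := by
      obtain ⟨ξ, hξ, hξ'⟩ := exists_deriv_eq_slope θ (a := 1) (b := a) ha.1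
        hθ.continuous.continuousOn
        (fun y hy => (hθ.differentiableAt y (habs y hy.1)).differentiableWithinAt)
      have h0 : 0 ≤ deriv θ ξ := by
        rw [hξ', hθ.eq_zero 1 (by simp), sub_zero]
        exact div_nonneg (hθ.nonneg a) (by linarith [ha.1])
      obtain ⟨ζ, hζ, hζ'⟩ := exists_deriv_eq_slope (deriv θ) (a := ξ) (b := a) hξ.2
        (fun y hy => (hθ.differentiableAt_deriv y
          (habs y (hξ.1.trans_le hy.1))).continuousAt.continuousWithinAt)
        (fun y hy => (hθ.differentiableAt_deriv y
          (habs y (hξ.1.trans hy.1))).differentiableWithinAt)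
      have h2 := hθ.one_le ζ (habs ζ (hξ.1.trans hζ.1))
      rw [hζ', le_div_iff₀ (by linarith [hξ.2])] at h2
      linarith [hξ.2]
    obtain ⟨ζ, hζ, hζ'⟩ := exists_deriv_eq_slope (deriv θ) (a := a) (b := u) ha.2
      (fun y hy => (hθ.differentiableAt_deriv y
        (habs y (ha.1.trans_le hy.1))).continuousAt.continuousWithinAt)
      (fun y hy => (hθ.differentiableAt_deriv y
        (habs y (ha.1.trans hy.1))).differentiableWithinAt)
    have h2 := hθ.one_le ζ (habs ζ (ha.1.trans hζ.1))
    rw [hζ', le_div_iff₀ (by linarith [ha.2])] at h2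
    linarith
  by_contra! h
  by_cases h3 : 0 < deriv θ u
  · have h4 := key ((1 + (u - deriv θ u)) / 2) ⟨by linarith, by linarith⟩
    linarith
  · have h4 := key ((1 + u) / 2) ⟨by linarith, by linarith⟩
    linarith

theorem IsConfining.secondDiffGE_comp (hθ : IsConfining θ) {p p' : ℝ → ℝ} {p'' : ℝ}
    (hp : ∀ t, HasDerivAt p (p' t) t) (hp' : HasDerivAt p' p'' 0) (h : 1 < |p 0|) :
    SecondDiffGE (fun t => θ (p t)) 0 1
      (deriv (deriv θ) (p 0) * p' 0 ^ 2 + deriv θ (p 0) * p'') := by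
  refine SecondDiffGE.of_hasDerivAt (h' := fun t => deriv θ (p t) * p' t) ?_ ?_
  · filter_upwards [(hp 0).continuousAt.abs.eventually_const_lt h] with t ht
    exact (hθ.differentiableAt _ ht).hasDerivAt.comp t (hp t)
  · have h1 : HasDerivAt (fun t => deriv θ (p t)) (deriv (deriv θ) (p 0) * p' 0) 0 :=
      (hθ.differentiableAt_deriv _ h).hasDerivAt.comp 0 (hp 0)
    exact (h1.mul hp').congr_deriv (by ring)

/-- Where `|a| ≤ 1` the composition attains its minimum value zero, so the kinks `±1` need no
regularity of `θ`. -/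
theorem IsConfining.secondDiffGE_of_le {E : Type*} [AddCommGroup E] [Module ℝ E]
    (hθ : IsConfining θ) {a : E → ℝ} {x : E} (h : |a x| ≤ 1) (v : E) :
    SecondDiffGE (fun y => θ (a y)) x v 0 := by
  refine SecondDiffGE.of_isMin (Eventually.of_forall fun r => ?_)
  have h1 := hθ.nonneg (a (x + r • v))
  have h2 := hθ.nonneg (a (x - r • v))
  simp only [hθ.eq_zero _ h]
  linarith

end

section
variable {N : ℕ} {x : EuclideanSpace ℝ (Fin N)}

theorem hasDerivAt_coord (x v : EuclideanSpace ℝ (Fin N)) (k : Fin N) (t : ℝ) :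
    HasDerivAt (fun t : ℝ => (x + t • v) k) (v k) t := by
  simp only [PiLp.add_apply, PiLp.smul_apply, smul_eq_mul]
  simpa using ((hasDerivAt_id t).mul_const (v k)).const_add (x k)

theorem secondDiffGE_comp_coord {f : ℝ → ℝ} (hf : ContDiff ℝ 2 f)
    (x v : EuclideanSpace ℝ (Fin N)) (k : Fin N) :
    SecondDiffGE (fun y : EuclideanSpace ℝ (Fin N) => f (y k)) x v
      (deriv (deriv f) (x k) * v k ^ 2) := by
  have hf1 : Differentiable ℝ f := hf.differentiable (by norm_num)
  have hf2 : Differentiable ℝ (deriv f) :=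
    (hf.deriv' (n := 1)).differentiable (by norm_num)
  refine SecondDiffGE.of_line (SecondDiffGE.of_hasDerivAt
    (h' := fun t => deriv f ((x + t • v) k) * v k) (Eventually.of_forall fun t => ?_) ?_)
  · exact (hf1 _).hasDerivAt.comp t (hasDerivAt_coord x v k t)
  · have h1 := ((hf2 _).hasDerivAt.comp (0 : ℝ) (hasDerivAt_coord x v k 0)).mul_const (v k)
    refine h1.congr_deriv ?_
    rw [zero_smul, add_zero]
    ring

theorem secondDiffGE_neg_log (v : EuclideanSpace ℝ (Fin N)) {i j : Fin N} (h : x i < x j) :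
    SecondDiffGE (fun y : EuclideanSpace ℝ (Fin N) => -Real.log (y j - y i)) x v
      ((v j - v i) ^ 2 / (x j - x i) ^ 2) := by
  have hd : ∀ t, HasDerivAt (fun t : ℝ => (x + t • v) j - (x + t • v) i) (v j - v i) t :=
    fun t => (hasDerivAt_coord x v j t).sub (hasDerivAt_coord x v i t)
  have h0 : 0 < (x + (0 : ℝ) • v) j - (x + (0 : ℝ) • v) i := by
    rw [zero_smul, add_zero]; linarith
  refine SecondDiffGE.of_line (SecondDiffGE.of_hasDerivAt
    (h' := fun t => -((v j - v i) / ((x + t • v) j - (x + t • v) i))) ?_ ?_)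
  · filter_upwards [(hd 0).continuousAt.eventually_const_lt h0] with t ht
    exact ((hd t).log ht.ne').neg
  · refine ((hasDerivAt_const (0 : ℝ) (v j - v i)).div (hd 0) h0.ne').neg.congr_deriv ?_
    rw [zero_smul, add_zero]
    ring

theorem secondDiffGE_hamiltonian {V : ℝ → ℝ} (hV : ContDiff ℝ 2 V) (hN : 0 < N)
    (hx : x ∈ openSimplex N) (v : EuclideanSpace ℝ (Fin N)) :
    SecondDiffGE (hamiltonian V N) x v (∑ k, 1 / 2 * (deriv (deriv V) (x k) * v k ^ 2) +
      1 / N * ∑ i, ∑ j ∈ Finset.Ioi i, (v j - v i) ^ 2 / (x j - x i) ^ 2) := by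
  have hN' : (0 : ℝ) < 1 / N := by positivity
  have e : hamiltonian V N = fun y => (∑ k, 1 / 2 * V (y k)) +
      1 / N * ∑ i, ∑ j ∈ Finset.Ioi i, -Real.log (y j - y i) := by
    ext y
    simp only [hamiltonian, Finset.sum_neg_distrib]
    ring
  rw [e]
  refine SecondDiffGE.add (SecondDiffGE.sum _ fun k _ =>
    (secondDiffGE_comp_coord hV x v k).const_mul (by norm_num)) (SecondDiffGE.const_mul
    (SecondDiffGE.sum _ fun i _ => SecondDiffGE.sum _ fun j hj => ?_) hN')
  exact secondDiffGE_neg_log v (hx i j (Finset.mem_Ioi.1 hj))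

theorem hasDerivAt_globalArg (ρ : ℝ → ℝ) (A s : ℝ) (x v : EuclideanSpace ℝ (Fin N)) (t : ℝ) :
    HasDerivAt (fun t : ℝ => globalArg ρ A s N (x + t • v))
      (s / N * ∑ i, 2 * ((x + t • v) i - gammaTilde ρ A N i) * v i) t := by
  refine HasDerivAt.const_mul _ (HasDerivAt.fun_sum fun i _ => ?_)
  refine (((hasDerivAt_coord x v i t).sub_const (gammaTilde ρ A N i)).pow 2).congr_deriv ?_
  simp

/-- The `θ''` term is nonnegative and dropped. The bound comes from `θ' ≥ u - 1` multiplied by the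
Hessian `2s/N` of the quadratic argument and the prefactor `N`. -/
theorem secondDiffGE_psiGlobal {θ : ℝ → ℝ} (hθ : IsConfining θ) (ρ : ℝ → ℝ) (A : ℝ) {s : ℝ}
    (hs : 0 < s) (hN : 0 < N) (x v : EuclideanSpace ℝ (Fin N)) :
    SecondDiffGE (psiGlobal ρ A θ s N) x v
      (2 * s * max (globalArg ρ A s N x - 1) 0 * ∑ i, v i ^ 2) := by
  have hN' : (0 : ℝ) < N := by exact_mod_cast hN
  have hu0 : 0 ≤ globalArg ρ A s N x := by unfold globalArg; positivity
  have hv0 : 0 ≤ ∑ i, v i ^ 2 := by positivity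
  by_cases hu : globalArg ρ A s N x ≤ 1
  · rw [max_eq_right (by linarith), mul_zero, zero_mul]
    have := (hθ.secondDiffGE_of_le (a := globalArg ρ A s N) (x := x)
      (by rwa [abs_of_nonneg hu0]) v).const_mul hN'
    rwa [mul_zero] at this
  · rw [not_le] at hu
    rw [max_eq_left (by linarith)]
    have h2 : HasDerivAt (fun t : ℝ => s / N * ∑ i, 2 * ((x + t • v) i - gammaTilde ρ A N i) * v i)
        (s / N * ∑ i, 2 * v i ^ 2) 0 := by
      refine HasDerivAt.const_mul _ (HasDerivAt.fun_sum fun i _ => ?_)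
      refine ((((hasDerivAt_coord x v i 0).sub_const (gammaTilde ρ A N i)).const_mul 2).mul_const
        (v i)).congr_deriv ?_
      ring
    have h3 := hθ.secondDiffGE_comp (hasDerivAt_globalArg ρ A s x v) h2
      (by rw [zero_smul, add_zero, abs_of_nonneg hu0]; exact hu)
    refine ((SecondDiffGE.of_line h3).const_mul hN').mono ?_
    rw [zero_smul, add_zero]
    have h4 := hθ.one_le _ (hu.trans_le (le_abs_self _))
    have h5 := hθ.sub_one_le_deriv hu
    rw [← Finset.mul_sum (a := (2 : ℝ))]
    have h6 : (globalArg ρ A s N x - 1) * (s / N * (2 * ∑ i, v i ^ 2)) ≤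
        deriv θ (globalArg ρ A s N x) * (s / N * (2 * ∑ i, v i ^ 2)) :=
      mul_le_mul_of_nonneg_right h5 (by positivity)
    have h7 : 0 ≤ deriv (deriv θ) (globalArg ρ A s N x) *
        (s / N * ∑ i, 2 * (x i - gammaTilde ρ A N i) * v i) ^ 2 :=
      mul_nonneg (by linarith) (sq_nonneg _)
    calc 2 * s * (globalArg ρ A s N x - 1) * ∑ i, v i ^ 2
        = N * ((globalArg ρ A s N x - 1) * (s / N * (2 * ∑ i, v i ^ 2))) := by
          field_simp
      _ ≤ _ := by
          refine mul_le_mul_of_nonneg_left ?_ hN'.le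
          linarith

/-- The argument is linear, so only `θ'' ≥ 1` enters. -/
theorem secondDiffGE_psiPair {θ : ℝ → ℝ} (hθ : IsConfining θ) {c₁ ε : ℝ} (hc₁ : 0 < c₁)
    (hε : 0 < ε) (i j : Fin N) (x v : EuclideanSpace ℝ (Fin N)) :
    SecondDiffGE (psiPair θ c₁ ε N i j) x v
      (if 1 < |pairArg c₁ ε N i j x| then c₁ * matQ N ε i j * (v i - v j) ^ 2 else 0) := by
  have hN : 0 < N := by have := i.2; omega
  have hN' : (0 : ℝ) < 1 / N := by positivity
  split_ifs with h
  · have hp : ∀ t, HasDerivAt (fun t : ℝ => pairArg c₁ ε N i j (x + t • v))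
        (√(c₁ * N * matQ N ε i j) * (v i - v j)) t := fun t =>
      ((hasDerivAt_coord x v i t).sub (hasDerivAt_coord x v j t)).const_mul _
    have h3 := hθ.secondDiffGE_comp hp (hasDerivAt_const 0 _)
      (by rw [zero_smul, add_zero]; exact h)
    refine ((SecondDiffGE.of_line h3).const_mul hN').mono ?_
    rw [zero_smul, add_zero, mul_zero, add_zero, mul_pow,
      Real.sq_sqrt (mul_nonneg (by positivity) (matQ_nonneg N hε i j))]
    have h4 := hθ.one_le _ h
    have h5 : 0 ≤ c₁ * N * matQ N ε i j * (v i - v j) ^ 2 :=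
      mul_nonneg (mul_nonneg (by positivity) (matQ_nonneg N hε i j)) (sq_nonneg _)
    calc c₁ * matQ N ε i j * (v i - v j) ^ 2
        = 1 / N * (1 * (c₁ * N * matQ N ε i j * (v i - v j) ^ 2)) := by field_simp
      _ ≤ _ := by gcongr
  · have := (hθ.secondDiffGE_of_le (a := pairArg c₁ ε N i j) (x := x)
      (not_lt.1 h) v).const_mul hN'
    rwa [mul_zero] at this

theorem secondDiffGE_linStat_sq (ρ : ℝ → ℝ) (A : ℝ) {g : ℝ → ℝ} (hg : ContDiff ℝ 2 g)
    (x v : EuclideanSpace ℝ (Fin N)) :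
    SecondDiffGE (fun y => linStat ρ A g N y ^ 2) x v
      (2 * ((√(N : ℝ))⁻¹ * ∑ j, deriv g (x j) * v j) ^ 2 +
        2 * linStat ρ A g N x * ((√(N : ℝ))⁻¹ * ∑ j, deriv (deriv g) (x j) * v j ^ 2)) := by
  have hg1 : Differentiable ℝ g := hg.differentiable (by norm_num)
  have hg2 : Differentiable ℝ (deriv g) :=
    (hg.deriv' (n := 1)).differentiable (by norm_num)
  have h1 : ∀ t, HasDerivAt (fun t : ℝ => linStat ρ A g N (x + t • v))
      ((√(N : ℝ))⁻¹ * ∑ j, deriv g ((x + t • v) j) * v j) t := fun t =>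
    HasDerivAt.const_mul _ (HasDerivAt.fun_sum fun j _ =>
      ((hg1 _).hasDerivAt.comp t (hasDerivAt_coord x v j t)).sub_const _)
  have h2 : HasDerivAt (fun t : ℝ => (√(N : ℝ))⁻¹ * ∑ j, deriv g ((x + t • v) j) * v j)
      ((√(N : ℝ))⁻¹ * ∑ j, deriv (deriv g) (x j) * v j ^ 2) 0 := by
    refine HasDerivAt.const_mul _ (HasDerivAt.fun_sum fun j _ => ?_)
    have := ((hg2 _).hasDerivAt.comp (0 : ℝ) (hasDerivAt_coord x v j 0)).mul_const (v j)
    refine this.congr_deriv ?_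
    rw [zero_smul, add_zero]
    ring
  refine SecondDiffGE.of_line (SecondDiffGE.of_hasDerivAt
    (h' := fun t => 2 * linStat ρ A g N (x + t • v) *
      ((√(N : ℝ))⁻¹ * ∑ j, deriv g ((x + t • v) j) * v j)) (Eventually.of_forall fun t => ?_) ?_)
  · exact ((h1 t).pow 2).congr_deriv (by simp)
  · refine (((h1 0).const_mul 2).mul h2).congr_deriv ?_
    rw [zero_smul, add_zero]
    ring

theorem secondDiffGE_rawHamiltonianNu {V ρ θ : ℝ → ℝ} {A W c₁ ε s : ℝ} {g : ℕ → ℝ → ℝ} {ℓ : ℕ}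
    (hV : ContDiff ℝ 2 V) (hg : ∀ α, 1 ≤ α → ContDiff ℝ 2 (g α)) (hW : 0 ≤ W)
    (hθ : IsConfining θ) (hc₁ : 0 < c₁) (hε : 0 < ε) (hs : 0 < s) (hN : 0 < N)
    (hx : x ∈ openSimplex N) (v : EuclideanSpace ℝ (Fin N)) :
    SecondDiffGE (rawHamiltonianNu V ρ A W g θ c₁ ε s ℓ N) x v
      ((∑ k, 1 / 2 * (deriv (deriv V) (x k) * v k ^ 2) +
        1 / N * ∑ i, ∑ j ∈ Finset.Ioi i, (v j - v i) ^ 2 / (x j - x i) ^ 2) +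
      2 * s * max (globalArg ρ A s N x - 1) 0 * ∑ i, v i ^ 2 +
      (∑ i, ∑ j, if 1 < |pairArg c₁ ε N i j x| then c₁ * matQ N ε i j * (v i - v j) ^ 2 else 0) +
      (W + 1) * ∑ α ∈ Finset.Icc 1 ℓ, (2 * ((√(N : ℝ))⁻¹ * ∑ j, deriv (g α) (x j) * v j) ^ 2 +
        2 * linStat ρ A (g α) N x *
          ((√(N : ℝ))⁻¹ * ∑ j, deriv (deriv (g α)) (x j) * v j ^ 2))) := by
  refine SecondDiffGE.add (SecondDiffGE.add (SecondDiffGE.add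
    (secondDiffGE_hamiltonian hV hN hx v) (secondDiffGE_psiGlobal hθ ρ A hs hN x v)) ?_) ?_
  · exact SecondDiffGE.sum _ fun i _ => SecondDiffGE.sum _ fun j _ =>
      secondDiffGE_psiPair hθ hc₁ hε i j x v
  · exact (SecondDiffGE.sum _ fun α hα => secondDiffGE_linStat_sq ρ A
      (hg α (Finset.mem_Icc.1 hα).1) x v).const_mul (by linarith)

end

/-! ### Regularity of the convexified Hamiltonian -/

section
variable {N : ℕ} {x v : EuclideanSpace ℝ (Fin N)} {H H₁ H₂ : EuclideanSpace ℝ (Fin N) → ℝ}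

theorem convex_openSimplex (N : ℕ) : Convex ℝ (openSimplex N) := by
  intro x hx y hy a b ha hb hab i j hij
  have h1 := hx i j hij
  have h2 := hy i j hij
  simp only [PiLp.add_apply, PiLp.smul_apply, smul_eq_mul]
  rcases ha.eq_or_lt with rfl | ha
  · have : b = 1 := by linarith
    subst this
    linarith
  · nlinarith

theorem TwiceDifferentiableAt.of_contDiffAt (h : ContDiffAt ℝ 2 H x) :
    TwiceDifferentiableAt H x :=
  ⟨(h.eventually (by simp)).mono fun _ hy => hy.differentiableAt (by norm_num),
    (h.fderiv_right (m := 1) (by norm_num)).differentiableAt (by norm_num)⟩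

theorem TwiceDifferentiableAt.congr (h : TwiceDifferentiableAt H₁ x) (he : H₂ =ᶠ[𝓝 x] H₁) :
    TwiceDifferentiableAt H₂ x := by
  refine ⟨?_, h.2.congr_of_eventuallyEq he.fderiv⟩
  filter_upwards [h.1, he.eventuallyEq_nhds] with y hy hy'
  exact hy.congr_of_eventuallyEq hy'

theorem TwiceDifferentiableAt.add (h₁ : TwiceDifferentiableAt H₁ x)
    (h₂ : TwiceDifferentiableAt H₂ x) : TwiceDifferentiableAt (fun y => H₁ y + H₂ y) x := by
  refine ⟨h₁.1.mp (h₂.1.mono fun y hy hy' => hy'.add hy), ?_⟩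
  refine (h₁.2.add h₂.2).congr_of_eventuallyEq ?_
  filter_upwards [h₁.1, h₂.1] with y hy hy'
  exact fderiv_add hy hy'

theorem TwiceDifferentiableAt.const (c : ℝ) :
    TwiceDifferentiableAt (fun _ : EuclideanSpace ℝ (Fin N) => c) x :=
  TwiceDifferentiableAt.of_contDiffAt contDiffAt_const

theorem TwiceDifferentiableAt.const_mul (h : TwiceDifferentiableAt H x) (c : ℝ) :
    TwiceDifferentiableAt (fun y => c * H y) x := by
  refine ⟨h.1.mono fun y hy => hy.const_mul c, (h.2.const_smul c).congr_of_eventuallyEq ?_⟩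
  filter_upwards [h.1] with y hy
  exact fderiv_const_mul hy c

theorem TwiceDifferentiableAt.sum {ι : Type*} (s : Finset ι)
    {F : ι → EuclideanSpace ℝ (Fin N) → ℝ} (h : ∀ i ∈ s, TwiceDifferentiableAt (F i) x) :
    TwiceDifferentiableAt (fun y => ∑ i ∈ s, F i y) x := by
  classical
  induction s using Finset.induction_on with
  | empty => simpa using TwiceDifferentiableAt.const (x := x) 0
  | insert a s ha ih =>
    simp only [Finset.sum_insert ha]
    exact (h a (Finset.mem_insert_self a s)).add
      (ih fun i hi => h i (Finset.mem_insert_of_mem hi))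

/-- Off the kinks the composition is either locally zero or lies where `θ` is twice differentiable.
-/
theorem IsConfining.twiceDifferentiableAt_comp {θ : ℝ → ℝ} (hθ : IsConfining θ)
    {a : EuclideanSpace ℝ (Fin N) → ℝ} (ha : ContDiff ℝ 2 a) (h : |a x| ≠ 1) :
    TwiceDifferentiableAt (fun y => θ (a y)) x := by
  rcases h.lt_or_gt with h | h
  · refine (TwiceDifferentiableAt.const 0).congr ?_
    filter_upwards [ha.continuous.abs.continuousAt.eventually_lt_const h] with y hy
    exact hθ.eq_zero _ hy.le
  · have hev := ha.continuous.abs.continuousAt.eventually_const_lt h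
    have had : Differentiable ℝ a := ha.differentiable (by norm_num)
    refine ⟨hev.mono fun y hy => (hθ.differentiableAt _ hy).comp y (had y), ?_⟩
    have h1 : DifferentiableAt ℝ (fun y => deriv θ (a y) • fderiv ℝ a y) x :=
      ((hθ.differentiableAt_deriv _ h).comp x (had x)).smul
        ((ha.fderiv_right (m := 1) (by norm_num)).differentiable (by norm_num) x)
    refine h1.congr_of_eventuallyEq ?_
    filter_upwards [hev] with y hy
    exact ((hθ.differentiableAt _ hy).hasDerivAt.comp_hasFDerivAt y (had y).hasFDerivAt).fderiv

theorem TwiceDifferentiableAt.le_hessianForm (h : TwiceDifferentiableAt H x) {m : ℝ}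
    (hm : SecondDiffGE H x v m) : m ≤ hessianForm H x v := by
  have hm' : SecondDiffGE H (x + (0 : ℝ) • v) v m := by rwa [zero_smul, add_zero]
  have hline : ∀ t : ℝ, HasDerivAt (fun t : ℝ => x + t • v) v t := fun t => by
    simpa using ((hasDerivAt_id t).smul_const v).const_add x
  have hx : x + (0 : ℝ) • v = x := by rw [zero_smul, add_zero]
  refine hm'.line.le_deriv (h' := fun t => fderiv ℝ H (x + t • v) v) ?_ ?_
  · have hc : Tendsto (fun t : ℝ => x + t • v) (𝓝 0) (𝓝 x) := by
      have := (hline 0).continuousAt.tendsto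
      rwa [hx] at this
    filter_upwards [hc.eventually h.1] with t ht
    exact ht.hasFDerivAt.comp_hasDerivAt t (hline t)
  · have h2 : HasFDerivAt (fderiv ℝ H) (fderiv ℝ (fderiv ℝ H) x) (x + (0 : ℝ) • v) := by
      rw [hx]; exact h.2.hasFDerivAt
    have h3 := h2.comp_hasDerivAt (0 : ℝ) (hline 0)
    exact ((ContinuousLinearMap.apply ℝ ℝ v).hasFDerivAt.comp_hasDerivAt (0 : ℝ) h3)

theorem contDiff_globalArg (ρ : ℝ → ℝ) (A s : ℝ) : ContDiff ℝ 2 (globalArg ρ A s N) := by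
  unfold globalArg; fun_prop

theorem contDiff_pairArg (c₁ ε : ℝ) (i j : Fin N) : ContDiff ℝ 2 (pairArg c₁ ε N i j) := by
  unfold pairArg; fun_prop

theorem contDiff_linStat (ρ : ℝ → ℝ) (A : ℝ) {g : ℝ → ℝ} (hg : ContDiff ℝ 2 g) :
    ContDiff ℝ 2 (linStat ρ A g N) := by
  unfold linStat
  exact contDiff_const.mul (ContDiff.sum fun j _ => (hg.comp (by fun_prop)).sub contDiff_const)

theorem contDiffAt_hamiltonian {V : ℝ → ℝ} (hV : ContDiff ℝ 2 V) (hx : x ∈ openSimplex N) :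
    ContDiffAt ℝ 2 (hamiltonian V N) x := by
  unfold hamiltonian
  refine ContDiffAt.sub (ContDiff.contDiffAt (ContDiff.sum fun k _ =>
    contDiff_const.mul (hV.comp (by fun_prop)))) (contDiffAt_const.mul
    (ContDiffAt.sum fun i _ => ContDiffAt.sum fun j hj => ?_))
  refine ContDiffAt.log (by fun_prop) ?_
  have := hx i j (Finset.mem_Ioi.1 hj)
  linarith

variable {V ρ θ : ℝ → ℝ} {A W c₁ ε s : ℝ} {g : ℕ → ℝ → ℝ} {ℓ : ℕ}

theorem continuousOn_rawHamiltonianNu (hV : ContDiff ℝ 2 V)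
    (hg : ∀ α, 1 ≤ α → ContDiff ℝ 2 (g α)) (hθ : IsConfining θ) :
    ContinuousOn (rawHamiltonianNu V ρ A W g θ c₁ ε s ℓ N) (openSimplex N) := by
  intro x hx
  refine ContinuousAt.continuousWithinAt ?_
  refine ContinuousAt.add (ContinuousAt.add (ContinuousAt.add
    (contDiffAt_hamiltonian hV hx).continuousAt ?_) ?_) ?_
  · exact (continuous_const.mul
      (hθ.continuous.comp (contDiff_globalArg ρ A s).continuous)).continuousAt
  · exact (continuous_finsetSum _ fun i _ => continuous_finsetSum _ fun j _ =>
      continuous_const.mul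
        (hθ.continuous.comp (contDiff_pairArg c₁ ε i j).continuous)).continuousAt
  · exact (continuous_const.mul (continuous_finsetSum _ fun α hα =>
      (contDiff_linStat ρ A (hg α (Finset.mem_Icc.1 hα).1)).continuous.pow 2)).continuousAt

theorem twiceDifferentiableAt_rawHamiltonianNu (hV : ContDiff ℝ 2 V)
    (hg : ∀ α, 1 ≤ α → ContDiff ℝ 2 (g α)) (hθ : IsConfining θ) (hx : x ∈ openSimplex N)
    (hoff : OffKinks ρ A c₁ ε s N x) :
    TwiceDifferentiableAt (rawHamiltonianNu V ρ A W g θ c₁ ε s ℓ N) x := by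
  refine TwiceDifferentiableAt.add (TwiceDifferentiableAt.add (TwiceDifferentiableAt.add
    (.of_contDiffAt (contDiffAt_hamiltonian hV hx)) ?_) ?_) ?_
  · exact (hθ.twiceDifferentiableAt_comp (contDiff_globalArg ρ A s) hoff.1).const_mul _
  · exact .sum _ fun i _ => .sum _ fun j _ =>
      (hθ.twiceDifferentiableAt_comp (contDiff_pairArg c₁ ε i j) (hoff.2 i j)).const_mul _
  · exact .of_contDiffAt (contDiff_const.mul (ContDiff.sum fun α hα =>
      (contDiff_linStat ρ A (hg α (Finset.mem_Icc.1 hα).1)).pow 2)).contDiffAt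

end

/-- A uniform lower bound on second differences of `rawHamiltonianNu` gives both forms of the
convexity of `hamiltonianNu`. -/
theorem convexity_of_secondDiffGE {V ρ θ : ℝ → ℝ} {A W c₁ ε s β c : ℝ} {g : ℕ → ℝ → ℝ}
    {ℓ N : ℕ} (hV : ContDiff ℝ 2 V) (hg : ∀ α, 1 ≤ α → ContDiff ℝ 2 (g α)) (hθ : IsConfining θ)
    (h : ∀ x ∈ openSimplex N, ∀ v, SecondDiffGE (rawHamiltonianNu V ρ A W g θ c₁ ε s ℓ N) x v
      (c * ‖v‖ ^ 2)) :
    (∀ x ∈ openSimplex N, OffKinks ρ A c₁ ε s N x →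
      TwiceDifferentiableAt (hamiltonianNu V ρ A W g θ c₁ ε s β ℓ N) x ∧
      ∀ v : EuclideanSpace ℝ (Fin N),
        c * ‖v‖ ^ 2 ≤ hessianForm (hamiltonianNu V ρ A W g θ c₁ ε s β ℓ N) x v) ∧
    StrongConvexOn (openSimplex N) c (hamiltonianNu V ρ A W g θ c₁ ε s β ℓ N) := by
  have h' : ∀ x ∈ openSimplex N, ∀ v, SecondDiffGE (hamiltonianNu V ρ A W g θ c₁ ε s β ℓ N) x v
      (c * ‖v‖ ^ 2) := fun x hx v => (h x hx v).add_const _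
  refine ⟨fun x hx hoff => ?_, ?_⟩
  · have ht : TwiceDifferentiableAt (hamiltonianNu V ρ A W g θ c₁ ε s β ℓ N) x :=
      (twiceDifferentiableAt_rawHamiltonianNu hV hg hθ hx hoff).add (.const _)
    exact ⟨ht, fun v => ht.le_hessianForm (h' x hx v)⟩
  · exact strongConvexOn_of_secondDiffGE (convex_openSimplex N)
      ((continuousOn_rawHamiltonianNu hV hg hθ).add continuousOn_const) h'

/-! ### Existence of slow modes -/

theorem exists_contDiff_primitive_bounded {φ : ℝ → ℝ} (hφ : ContDiff ℝ 1 φ)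
    (hc : HasCompactSupport φ) (A : ℝ) : ∃ g : ℝ → ℝ, ContDiff ℝ 2 g ∧ deriv g = φ ∧
      ∃ C : ℝ, ∀ x, |g x| ≤ C ∧ |deriv g x| ≤ C ∧ |deriv (deriv g) x| ≤ C := by
  have hcont := hφ.continuous
  have hd : ∀ x, HasDerivAt (fun x => ∫ u in A..x, φ u) (φ x) x := fun x =>
    (hcont.integral_hasStrictDerivAt A x).hasDerivAt
  have hderiv : deriv (fun x => ∫ u in A..x, φ u) = φ := funext fun x => (hd x).deriv
  obtain ⟨C₁, hC₁⟩ := hc.exists_bound_of_continuous hcont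
  obtain ⟨C₂, hC₂⟩ := hc.deriv.exists_bound_of_continuous (hφ.continuous_deriv le_rfl)
  have hint : Integrable φ := hcont.integrable_of_hasCompactSupport hc
  refine ⟨_, ?_, hderiv, max (∫ u, ‖φ u‖) (max C₁ C₂), fun x => ⟨?_, ?_, ?_⟩⟩
  · rw [show (2 : WithTop ℕ∞) = 1 + 1 by norm_num, contDiff_succ_iff_deriv]
    refine ⟨fun x => (hd x).differentiableAt, by simp, ?_⟩
    rwa [hderiv]
  · refine le_trans ?_ (le_max_left _ _)
    exact (intervalIntegral.norm_integral_le_integral_norm_uIoc).trans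
      (setIntegral_le_integral hint.norm (Eventually.of_forall fun u => norm_nonneg _))
  · rw [hderiv]
    exact (hC₁ x).trans ((le_max_left _ _).trans (le_max_right _ _))
  · rw [hderiv]
    exact (hC₂ x).trans ((le_max_right _ _).trans (le_max_right _ _))

theorem IsRegularEquilibriumDensity.exists_isSlowMode {V ρ : ℝ → ℝ} {A B : ℝ}
    (h : IsRegularEquilibriumDensity V ρ A B) (α : ℕ) : ∃ g, IsSlowMode ρ A α g := by
  have hlt := h.lt
  let χ : ContDiffBump ((A + B) / 2) :=
    { rIn := (B - A) / 2, rOut := B - A, rIn_pos := by linarith, rIn_lt_rOut := by linarith }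
  have hχ : ∀ x ∈ Icc A B, χ x = 1 := by
    intro x hx
    refine χ.one_of_mem_closedBall ?_
    rw [Metric.mem_closedBall, Real.dist_eq, abs_le, show χ.rIn = (B - A) / 2 from rfl]
    exact ⟨by linarith [hx.1, hx.2], by linarith [hx.1, hx.2]⟩
  set F : ℝ → ℝ := fun x => ∫ u in A..x, ρ u with hF
  have hF1 : ContDiff ℝ 1 F := by
    rw [contDiff_one_iff_deriv]
    have hd : ∀ x, HasDerivAt F (ρ x) x := fun x =>
      (h.continuous.integral_hasStrictDerivAt A x).hasDerivAt
    refine ⟨fun x => (hd x).differentiableAt, ?_⟩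
    rw [show deriv F = ρ from funext fun x => (hd x).deriv]
    exact h.continuous
  -- `F` is the distribution function, so `F (γ̃_k) = (k - 1/2) / N` for every `N`; this is why one
  -- function serves all `N`. The cutoff, equal to one on the support, makes the primitive bounded.
  obtain ⟨g, hg, hg', C, hC⟩ := exists_contDiff_primitive_bounded
    (φ := fun x => √2 * Real.cos (Real.pi * α * F x) * χ x)
    (((contDiff_const.mul (contDiff_const.mul hF1).cos)).mul χ.contDiff)
    χ.hasCompactSupport.mul_left A
  refine ⟨g, hg, ⟨C, hC⟩, fun N k => ?_⟩
  rw [hg']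
  have hN : 0 < N := by have := k.2; omega
  have hN' : (0 : ℝ) < N := by exact_mod_cast hN
  have hFk : F (gammaTilde ρ A N k) = ((k : ℝ) + 1 - 1 / 2) / N := by
    have hk : (k : ℝ) + 1 ≤ N := by exact_mod_cast k.2
    have hk0 : (0 : ℝ) ≤ k := Nat.cast_nonneg _
    refine h.integral_quantile (div_nonneg (by linarith) hN'.le) ?_
    rw [div_le_one hN']
    linarith
  simp only [hFk]
  rw [hχ _ (h.gammaTilde_mem k), mul_one]
  congr 2
  field_simp

/-! ### Lower bound for the Hessian -/

theorem sum_sum_Ioi_eq_half {N : ℕ} {f : Fin N → Fin N → ℝ} (hf : ∀ i j, f i j = f j i)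
    (h0 : ∀ i, f i i = 0) : ∑ i, ∑ j ∈ Finset.Ioi i, f i j = (∑ i, ∑ j, f i j) / 2 := by
  have h1 := Finset.sum_sum_Ioi_add_eq_sum_sum_off_diag f
  have h2 : ∀ i, ∑ j ∈ ({i} : Finset (Fin N))ᶜ, f j i = ∑ j, f i j := by
    intro i
    rw [← Finset.sum_compl_add_sum {i} (fun j => f i j), Finset.sum_singleton, h0, add_zero]
    exact Finset.sum_congr rfl fun j _ => hf j i
  have h3 : ∀ i, ∑ j ∈ Finset.Ioi i, (f j i + f i j) = 2 * ∑ j ∈ Finset.Ioi i, f i j := by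
    intro i
    rw [Finset.mul_sum]
    exact Finset.sum_congr rfl fun j _ => by rw [hf j i]; ring
  simp only [h2, h3, ← Finset.mul_sum] at h1
  linarith

/-- For each pair, the fraction `1 - η` of the repulsion dominates the truncated kernel. The
remaining fraction, or `θ` if it is active, dominates a multiple of `c₁ Q_{i,j}`. -/
theorem le_repulsion_add_confinement {N : ℕ} {x : EuclideanSpace ℝ (Fin N)}
    (hx : x ∈ openSimplex N) (v : Fin N → ℝ) {η δ c₁ ε : ℝ} (hη0 : 0 ≤ η) (hη1 : η ≤ 1)
    (hc₁ : 0 < c₁) (hε : 0 < ε) :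
    (1 - η) * ((∑ i, ∑ j, cauchyKernel δ (x i - x j) * (v i - v j) ^ 2) / (2 * N)) +
      η / 2 * c₁ * ∑ i, ∑ j, matQ N ε i j * (v i - v j) ^ 2 ≤
    1 / N * ∑ i, ∑ j ∈ Finset.Ioi i, (v j - v i) ^ 2 / (x j - x i) ^ 2 +
      ∑ i, ∑ j, if 1 < |pairArg c₁ ε N i j x| then c₁ * matQ N ε i j * (v i - v j) ^ 2 else 0 := by
  rcases Nat.eq_zero_or_pos N with rfl | hN
  · simp
  have hN' : (0 : ℝ) < N := by exact_mod_cast hN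
  rw [sum_sum_Ioi_eq_half (f := fun i j => (v j - v i) ^ 2 / (x j - x i) ^ 2)
    (fun i j => by rw [← neg_sub (v j), ← neg_sub (x j), neg_sq, neg_sq]) (fun i => by simp),
    show ∀ t : ℝ, 1 / (N : ℝ) * (t / 2) = 1 / (2 * N) * t from fun t => by field_simp,
    show ∀ t : ℝ, (1 - η) * (t / (2 * N)) = (1 - η) * (1 / (2 * N)) * t from fun t => by ring]
  simp only [Finset.mul_sum, ← Finset.sum_add_distrib]
  refine Finset.sum_le_sum fun i _ => Finset.sum_le_sum fun j _ => ?_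
  rcases eq_or_ne i j with rfl | hij
  · simp
  have hne : 0 < (x i - x j) ^ 2 := by
    have : x i - x j ≠ 0 := by
      rcases lt_or_gt_of_ne hij with h | h
      · have := hx i j h; intro h'; linarith
      · have := hx j i h; intro h'; linarith
    positivity
  rw [← neg_sub (v i), ← neg_sub (x i), neg_sq, neg_sq]
  set w := (v i - v j) ^ 2
  set D := (x i - x j) ^ 2
  set Q := matQ N ε i j
  have hw : 0 ≤ w := sq_nonneg _
  have hQ : 0 ≤ Q := matQ_nonneg N hε i j
  have hk : cauchyKernel δ (x i - x j) ≤ 1 / D :=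
    one_div_le_one_div_of_le hne (by have := sq_nonneg δ; linarith)
  have h1 : (1 - η) * (1 / (2 * N)) * (cauchyKernel δ (x i - x j) * w) ≤
      (1 - η) * (1 / (2 * N)) * (w / D) := by
    refine mul_le_mul_of_nonneg_left ?_ (mul_nonneg (by linarith) (by positivity))
    calc cauchyKernel δ (x i - x j) * w ≤ 1 / D * w := mul_le_mul_of_nonneg_right hk hw
      _ = w / D := by ring
  have hpos : 0 ≤ 1 / (2 * (N : ℝ)) * (w / D) := by positivity
  split_ifs with h
  · have h2 : 0 ≤ c₁ * Q * w := by positivity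
    nlinarith
  -- With `θ` inactive the particles are close on the scale set by `Q`, which says precisely that `1
  -- / (N D) ≥ c₁ Q`.
  · have h3 : c₁ * N * Q * D ≤ 1 := by
      have h4 := pow_le_one₀ (n := 2) (abs_nonneg _) (not_lt.1 h)
      rw [sq_abs, pairArg, mul_pow, Real.sq_sqrt (mul_nonneg (by positivity) hQ)] at h4
      exact h4
    have h5 : c₁ * Q ≤ 1 / N * (1 / D) := by
      rw [one_div_mul_one_div, le_div_iff₀ (by positivity)]
      linarith
    have h6 : η / 2 * c₁ * (Q * w) ≤ η * (1 / (2 * N) * (w / D)) := by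
      calc η / 2 * c₁ * (Q * w) = η / 2 * w * (c₁ * Q) := by ring
        _ ≤ η / 2 * w * (1 / N * (1 / D)) := by gcongr
        _ = _ := by field_simp
    linarith

theorem le_static_hessian {N : ℕ} {x : EuclideanSpace ℝ (Fin N)}
    (hx : x ∈ openSimplex N) (v : Fin N → ℝ) {V q : ℝ → ℝ} {W η δ c₁ ε : ℝ} (hη0 : 0 ≤ η)
    (hη1 : η ≤ 1) (hVW : ∀ x, -2 * W ≤ deriv (deriv V) x) (hq : ∀ x, q x ≤ deriv (deriv V) x / 2)
    (hc₁ : 0 < c₁) (hε : 0 < ε) :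
    (1 - η) * pairHessian q (cauchyKernel δ) (fun i => x i) v - η * W * ∑ i, v i ^ 2 +
      η / 2 * c₁ * ∑ i, ∑ j, matQ N ε i j * (v i - v j) ^ 2 ≤
    (∑ k, 1 / 2 * (deriv (deriv V) (x k) * v k ^ 2) +
      1 / N * ∑ i, ∑ j ∈ Finset.Ioi i, (v j - v i) ^ 2 / (x j - x i) ^ 2) +
      ∑ i, ∑ j, if 1 < |pairArg c₁ ε N i j x| then c₁ * matQ N ε i j * (v i - v j) ^ 2 else 0 := by
  have h1 := le_repulsion_add_confinement (δ := δ) hx v hη0 hη1 hc₁ hε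
  have h2 : (1 - η) * ∑ i, q (x i) * v i ^ 2 - η * W * ∑ i, v i ^ 2 ≤
      ∑ k, 1 / 2 * (deriv (deriv V) (x k) * v k ^ 2) := by
    rw [Finset.mul_sum, Finset.mul_sum, ← Finset.sum_sub_distrib]
    refine Finset.sum_le_sum fun k _ => ?_
    have h3 : (1 - η) * q (x k) ≤ (1 - η) * (deriv (deriv V) (x k) / 2) :=
      mul_le_mul_of_nonneg_left (hq _) (by linarith)
    have h4 : η * (-2 * W) ≤ η * deriv (deriv V) (x k) :=
      mul_le_mul_of_nonneg_left (hVW _) hη0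
    have h5 : (1 - η) * q (x k) - η * W ≤ deriv (deriv V) (x k) / 2 := by linarith
    have := mul_le_mul_of_nonneg_right h5 (sq_nonneg (v k))
    linarith
  rw [pairHessian]
  linarith

/-- Cross terms are estimated by Young's inequality with parameter `t`. The form is indefinite but
bounded by `K + 2 / δ²`, thanks to the truncation at scale `δ`. -/
theorem pairHessian_add_ge {q : ℝ → ℝ} {δ K t : ℝ} (hδ : 0 < δ) (ht : 0 < t)
    (hqK : ∀ x, |q x| ≤ K) {N : ℕ} (hN : 0 < N) (x u w : Fin N → ℝ) :
    pairHessian q (cauchyKernel δ) x u - t * (K + 2 / δ ^ 2) * ∑ i, u i ^ 2 -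
      (1 / t + 1) * (K + 2 / δ ^ 2) * ∑ i, w i ^ 2 ≤
    pairHessian q (cauchyKernel δ) x (fun i => u i + w i) := by
  have hN' : (0 : ℝ) < N := by exact_mod_cast hN
  have hK : 0 ≤ K := (abs_nonneg _).trans (hqK 0)
  have young : ∀ a b : ℝ, 2 * |a * b| ≤ t * a ^ 2 + 1 / t * b ^ 2 := by
    intro a b
    have h1 : 0 ≤ t * (|a| - 1 / t * |b|) ^ 2 := by positivity
    have h2 : t * (|a| - 1 / t * |b|) ^ 2 = t * |a| ^ 2 + 1 / t * |b| ^ 2 - 2 * (|a| * |b|) := by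
      field_simp; ring
    rw [h2, sq_abs, sq_abs, ← abs_mul] at h1
    linarith
  have h1 : ∑ i, q (x i) * u i ^ 2 - t * K * ∑ i, u i ^ 2 - (1 / t + 1) * K * ∑ i, w i ^ 2 ≤
      ∑ i, q (x i) * (u i + w i) ^ 2 := by
    simp only [Finset.mul_sum, ← Finset.sum_sub_distrib]
    refine Finset.sum_le_sum fun i _ => ?_
    have h2 : |q (x i) * (2 * (u i * w i) + w i ^ 2)| ≤
        K * (t * u i ^ 2 + 1 / t * w i ^ 2 + w i ^ 2) := by
      rw [abs_mul]
      refine mul_le_mul (hqK _) ?_ (abs_nonneg _) hK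
      refine (abs_add_le _ _).trans ?_
      rw [abs_mul, abs_two, abs_of_nonneg (sq_nonneg (w i))]
      linarith [young (u i) (w i)]
    have h3 := (abs_le.1 h2).1
    nlinarith
  have hker : ∀ y : Fin N → ℝ, ∑ i, ∑ j, cauchyKernel δ (x i - x j) * (y i - y j) ^ 2 ≤
      2 * N * (2 / δ ^ 2 * ∑ i, y i ^ 2) := by
    intro y
    calc ∑ i, ∑ j, cauchyKernel δ (x i - x j) * (y i - y j) ^ 2
        ≤ ∑ i, ∑ j, 1 / δ ^ 2 * (2 * y i ^ 2 + 2 * y j ^ 2) := by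
          refine Finset.sum_le_sum fun i _ => Finset.sum_le_sum fun j _ => ?_
          refine mul_le_mul (cauchyKernel_le hδ _) ?_ (sq_nonneg _) (by positivity)
          nlinarith [sq_nonneg (y i + y j)]
      _ = _ := by
          simp only [← Finset.mul_sum, Finset.sum_add_distrib, Finset.sum_const, Finset.card_univ,
            Fintype.card_fin, nsmul_eq_mul]
          ring
  have h2 : (∑ i, ∑ j, cauchyKernel δ (x i - x j) * (u i - u j) ^ 2) -
      t * (2 * N * (2 / δ ^ 2 * ∑ i, u i ^ 2)) - 1 / t * (2 * N * (2 / δ ^ 2 * ∑ i, w i ^ 2)) ≤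
      ∑ i, ∑ j, cauchyKernel δ (x i - x j) * (u i + w i - (u j + w j)) ^ 2 := by
    have h3 := mul_le_mul_of_nonneg_left (hker u) ht.le
    have h4 := mul_le_mul_of_nonneg_left (hker w) (one_div_pos.2 ht).le
    refine le_trans (b := (∑ i, ∑ j, cauchyKernel δ (x i - x j) * (u i - u j) ^ 2) -
      t * (∑ i, ∑ j, cauchyKernel δ (x i - x j) * (u i - u j) ^ 2) -
      1 / t * (∑ i, ∑ j, cauchyKernel δ (x i - x j) * (w i - w j) ^ 2)) (by linarith) ?_
    simp only [Finset.mul_sum, ← Finset.sum_sub_distrib]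
    refine Finset.sum_le_sum fun i _ => Finset.sum_le_sum fun j _ => ?_
    have h5 := cauchyKernel_pos hδ (x i - x j)
    have h6 := young (u i - u j) (w i - w j)
    have h7 := neg_abs_le ((u i - u j) * (w i - w j))
    have h8 : (u i - u j) ^ 2 - t * (u i - u j) ^ 2 - 1 / t * (w i - w j) ^ 2 ≤
        (u i + w i - (u j + w j)) ^ 2 := by nlinarith [sq_nonneg (w i - w j)]
    have := mul_le_mul_of_nonneg_left h8 h5.le
    linarith
  have h3 := div_le_div_of_nonneg_right h2 (show (0 : ℝ) ≤ 2 * N by positivity)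
  rw [sub_div, sub_div, mul_div_assoc, mul_div_assoc (1 / t), mul_div_cancel_left₀ _
    (by positivity), mul_div_cancel_left₀ _ (by positivity)] at h3
  rw [pairHessian, pairHessian]
  have h4 : 0 ≤ 2 / δ ^ 2 * ∑ i, w i ^ 2 := by positivity
  linarith

theorem sum_abs_sub_le {N : ℕ} {x y : Fin N → ℝ} {a : ℝ} (ha : 0 ≤ a)
    (h : ∑ i, (x i - y i) ^ 2 ≤ N * a ^ 2) : ∑ i, |x i - y i| ≤ N * a := by
  refine le_of_sq_le_sq ?_ (by positivity)
  have h1 := sq_sum_le_card_mul_sum_sq (s := Finset.univ) (f := fun i => |x i - y i|)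
  simp only [sq_abs, Finset.card_univ, Fintype.card_fin] at h1
  refine h1.trans ?_
  calc (N : ℝ) * ∑ i, (x i - y i) ^ 2 ≤ N * (N * a ^ 2) := by gcongr
    _ = _ := by ring

/-- Both coefficients are Lipschitz, and the entries of `u` are of order `N^{-1/2}`, so only the
average displacement enters, bounded by its root mean square. -/
theorem pairHessian_ge_of_close {q : ℝ → ℝ} {δ Λ a b : ℝ} (hδ : 0 < δ) (ha : 0 ≤ a) (hb : 0 ≤ b)
    (hqL : ∀ x y, |q x - q y| ≤ Λ * |x - y|) {N : ℕ} (hN : 0 < N) {x y u : Fin N → ℝ}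
    (h : ∑ i, (x i - y i) ^ 2 ≤ N * a ^ 2) (hu : ∀ i, u i ^ 2 ≤ b / N) :
    pairHessian q (cauchyKernel δ) y u - (Λ + 4 / δ ^ 3) * a * b ≤
      pairHessian q (cauchyKernel δ) x u := by
  have hN' : (0 : ℝ) < N := by exact_mod_cast hN
  have hΛ : 0 ≤ Λ := by
    have := (abs_nonneg _).trans (hqL 0 1)
    simpa using this
  have hs := sum_abs_sub_le ha h
  have h1 : ∑ i, q (y i) * u i ^ 2 - Λ * a * b ≤ ∑ i, q (x i) * u i ^ 2 := by
    have h2 : ∑ i, q (y i) * u i ^ 2 - Λ * (b / N) * ∑ i, |x i - y i| ≤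
        ∑ i, q (x i) * u i ^ 2 := by
      rw [Finset.mul_sum, ← Finset.sum_sub_distrib]
      refine Finset.sum_le_sum fun i _ => ?_
      have h3 := (abs_le.1 (hqL (x i) (y i))).1
      have h4 := mul_le_mul_of_nonneg_right h3 (sq_nonneg (u i))
      have h5 := mul_le_mul_of_nonneg_left (hu i)
        (show 0 ≤ Λ * |x i - y i| by positivity)
      linarith
    have h3 : Λ * (b / N) * ∑ i, |x i - y i| ≤ Λ * (b / N) * (N * a) := by gcongr
    have h4 : Λ * (b / N) * (N * a) = Λ * a * b := by field_simp
    linarith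
  have h2 : (∑ i, ∑ j, cauchyKernel δ (y i - y j) * (u i - u j) ^ 2) -
      2 * N * (4 / δ ^ 3 * a * b) ≤
      ∑ i, ∑ j, cauchyKernel δ (x i - x j) * (u i - u j) ^ 2 := by
    have h3 : (∑ i, ∑ j, cauchyKernel δ (y i - y j) * (u i - u j) ^ 2) -
        1 / δ ^ 3 * (4 * (b / N)) * ∑ i, ∑ j, (|x i - y i| + |x j - y j|) ≤
        ∑ i, ∑ j, cauchyKernel δ (x i - x j) * (u i - u j) ^ 2 := by
      simp only [Finset.mul_sum, ← Finset.sum_sub_distrib]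
      refine Finset.sum_le_sum fun i _ => Finset.sum_le_sum fun j _ => ?_
      have h4 := (abs_le.1 (abs_cauchyKernel_sub_le hδ (x i - x j) (y i - y j))).1
      have h5 : |x i - x j - (y i - y j)| ≤ |x i - y i| + |x j - y j| := by
        rw [show x i - x j - (y i - y j) = (x i - y i) - (x j - y j) by ring]
        exact abs_sub _ _
      have h6 : (u i - u j) ^ 2 ≤ 4 * (b / N) := by
        nlinarith [sq_nonneg (u i + u j), hu i, hu j]
      have h7 : 1 / δ ^ 3 * |x i - x j - (y i - y j)| * (u i - u j) ^ 2 ≤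
          1 / δ ^ 3 * (|x i - y i| + |x j - y j|) * (4 * (b / N)) := by gcongr
      have h8 := mul_le_mul_of_nonneg_right h4 (sq_nonneg (u i - u j))
      linarith
    have h4 : ∑ i, ∑ j, (|x i - y i| + |x j - y j|) = 2 * N * ∑ i, |x i - y i| := by
      simp only [Finset.sum_add_distrib, Finset.sum_const, Finset.card_univ, Fintype.card_fin,
        nsmul_eq_mul, ← Finset.mul_sum]
      ring
    rw [h4] at h3
    have h5 : 1 / δ ^ 3 * (4 * (b / N)) * (2 * N * ∑ i, |x i - y i|) ≤
        1 / δ ^ 3 * (4 * (b / N)) * (2 * N * (N * a)) := by gcongr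
    have h6 : 1 / δ ^ 3 * (4 * (b / N)) * (2 * N * (N * a)) = 2 * N * (4 / δ ^ 3 * a * b) := by
      field_simp
    linarith
  have h3 := div_le_div_of_nonneg_right h2 (show (0 : ℝ) ≤ 2 * N by positivity)
  rw [sub_div, mul_div_cancel_left₀ _ (by positivity)] at h3
  rw [pairHessian, pairHessian]
  linarith

/-- At the classical locations the gradient of `X_α` is exactly the cosine mode. Displacement
changes it by `C a` in norm, handled by Young's inequality with parameter `η`; the term `X_α ∇²X_α`
is of order `a` because `X_α` vanishes at the classical locations. -/
theorem IsSlowMode.le_hessian_linStat_sq {ρ g : ℝ → ℝ} {A C η a : ℝ} {α N : ℕ}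
    (hg : IsSlowMode ρ A α g) (hα : 1 ≤ α)
    (hC : ∀ x, |g x| ≤ C ∧ |deriv g x| ≤ C ∧ |deriv (deriv g) x| ≤ C) (hη : 0 < η) (ha : 0 ≤ a)
    (hN : 0 < N) {x : EuclideanSpace ℝ (Fin N)}
    (hx : ∑ i, (x i - gammaTilde ρ A N i) ^ 2 ≤ N * a ^ 2) (v : Fin N → ℝ) :
    2 * (1 - η) * cosCoeff v α ^ 2 - C ^ 2 * (2 * a + 2 / η * a ^ 2) * ∑ i, v i ^ 2 ≤
      2 * ((√(N : ℝ))⁻¹ * ∑ j, deriv g (x j) * v j) ^ 2 +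
        2 * linStat ρ A g N x * ((√(N : ℝ))⁻¹ * ∑ j, deriv (deriv g) (x j) * v j ^ 2) := by
  have hN' : (0 : ℝ) < N := by exact_mod_cast hN
  have hsqrt : (√(N : ℝ))⁻¹ ^ 2 = 1 / N := by
    rw [inv_pow, Real.sq_sqrt hN'.le, one_div]
  have hC0 : 0 ≤ C := (abs_nonneg _).trans (hC 0).1
  have hg1 : Differentiable ℝ g := hg.contDiff.differentiable (by norm_num)
  have hg2 : Differentiable ℝ (deriv g) :=
    (hg.contDiff.deriv' (n := 1)).differentiable (by norm_num)
  have hL0 : ∀ s t, |g s - g t| ≤ C * |s - t| := fun s t =>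
    convex_univ.norm_image_sub_le_of_norm_deriv_le (fun y _ => hg1 y) (fun y _ => (hC y).2.1)
      (mem_univ t) (mem_univ s)
  have hL1 : ∀ s t, |deriv g s - deriv g t| ≤ C * |s - t| := fun s t =>
    convex_univ.norm_image_sub_le_of_norm_deriv_le (fun y _ => hg2 y) (fun y _ => (hC y).2.2)
      (mem_univ t) (mem_univ s)
  set γ := gammaTilde ρ A N
  set S := ∑ i, v i ^ 2 with hS
  have hS0 : 0 ≤ S := by positivity
  have hcoeff : cosCoeff v α = (√(N : ℝ))⁻¹ * ∑ j, deriv g (γ j) * v j := by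
    rw [cosCoeff, Finset.mul_sum]
    refine Finset.sum_congr rfl fun j _ => ?_
    rw [hg.deriv_gammaTilde, cosMode, if_neg (by omega)]
    ring
  set p := (√(N : ℝ))⁻¹ * ∑ j, deriv g (x j) * v j with hp
  set r := (√(N : ℝ))⁻¹ * ∑ j, deriv (deriv g) (x j) * v j ^ 2 with hr
  have hdiff : (p - cosCoeff v α) ^ 2 ≤ C ^ 2 * a ^ 2 * S := by
    have e : p - cosCoeff v α = (√(N : ℝ))⁻¹ * ∑ j, (deriv g (x j) - deriv g (γ j)) * v j := by
      rw [hcoeff, hp, ← mul_sub, ← Finset.sum_sub_distrib]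
      simp only [sub_mul]
    rw [e, mul_pow, hsqrt]
    have h1 : (∑ j, (deriv g (x j) - deriv g (γ j)) * v j) ^ 2 ≤ (C ^ 2 * (N * a ^ 2)) * S := by
      refine (Finset.sum_mul_sq_le_sq_mul_sq _ _ _).trans ?_
      refine mul_le_mul_of_nonneg_right ?_ hS0
      refine le_trans ?_ (mul_le_mul_of_nonneg_left hx (sq_nonneg C))
      rw [Finset.mul_sum]
      refine Finset.sum_le_sum fun j _ => ?_
      rw [← mul_pow, ← sq_abs, ← sq_abs (C * _), abs_mul C, abs_of_nonneg hC0]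
      exact pow_le_pow_left₀ (abs_nonneg _) (hL1 _ _) 2
    calc 1 / (N : ℝ) * (∑ j, (deriv g (x j) - deriv g (γ j)) * v j) ^ 2
        ≤ 1 / N * ((C ^ 2 * (N * a ^ 2)) * S) := by gcongr
      _ = _ := by field_simp
  have hp2 : (1 - η) * cosCoeff v α ^ 2 - 1 / η * (C ^ 2 * a ^ 2 * S) ≤ p ^ 2 := by
    have h1 : 0 ≤ η * (cosCoeff v α + 1 / η * (p - cosCoeff v α)) ^ 2 := by positivity
    have h2 : η * (cosCoeff v α + 1 / η * (p - cosCoeff v α)) ^ 2 =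
        η * cosCoeff v α ^ 2 + 2 * (cosCoeff v α * (p - cosCoeff v α)) +
          1 / η * (p - cosCoeff v α) ^ 2 := by
      field_simp; ring
    have h3 := mul_le_mul_of_nonneg_left hdiff (one_div_pos.2 hη).le
    nlinarith [sq_nonneg (p - cosCoeff v α)]
  have hXr : |linStat ρ A g N x * r| ≤ C ^ 2 * a * S := by
    have h1 : |∑ j, (g (x j) - g (γ j))| ≤ C * (N * a) := by
      refine (Finset.abs_sum_le_sum_abs _ _).trans ?_
      refine le_trans (Finset.sum_le_sum fun j _ => hL0 (x j) (γ j)) ?_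
      rw [← Finset.mul_sum]
      exact mul_le_mul_of_nonneg_left (sum_abs_sub_le ha hx) hC0
    have h2 : |∑ j, deriv (deriv g) (x j) * v j ^ 2| ≤ C * S := by
      refine (Finset.abs_sum_le_sum_abs _ _).trans ?_
      rw [hS, Finset.mul_sum]
      refine Finset.sum_le_sum fun j _ => ?_
      rw [abs_mul, abs_of_nonneg (sq_nonneg (v j))]
      exact mul_le_mul_of_nonneg_right (hC _).2.2 (sq_nonneg _)
    have e : linStat ρ A g N x * r = 1 / N * ((∑ j, (g (x j) - g (γ j))) *
        ∑ j, deriv (deriv g) (x j) * v j ^ 2) := by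
      rw [← hsqrt, linStat, hr]
      ring
    rw [e, abs_mul, abs_of_pos (by positivity : 0 < 1 / (N : ℝ)), abs_mul]
    calc 1 / (N : ℝ) * (|∑ j, (g (x j) - g (γ j))| * |∑ j, deriv (deriv g) (x j) * v j ^ 2|)
        ≤ 1 / N * (C * (N * a) * (C * S)) := by gcongr
      _ = _ := by field_simp
  have h1 := (abs_le.1 hXr).1
  have e : C ^ 2 * (2 * a + 2 / η * a ^ 2) * S =
      2 * (C ^ 2 * a * S) + 2 * (1 / η * (C ^ 2 * a ^ 2 * S)) := by ring
  rw [e]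
  linarith

theorem le_pairHessian_low_add_high {q : ℝ → ℝ} {δ K Λ c₀ a : ℝ} (hδ : 0 < δ) (ha : 0 ≤ a)
    (hc₀ : 0 < c₀) (hqK : ∀ x, |q x| ≤ K) (hqL : ∀ x y, |q x - q y| ≤ Λ * |x - y|)
    {N ℓ : ℕ} (hℓN : ℓ < N) {x γ : Fin N → ℝ} (h : ∑ i, (x i - γ i) ^ 2 ≤ N * a ^ 2)
    (hγ : ∀ u : Fin N → ℝ, c₀ * ∑ i, u i ^ 2 ≤ pairHessian q (cauchyKernel δ) γ u +
      2 * (∑ i, u i ^ 2 - (∑ i, u i) ^ 2 / N)) (v : Fin N → ℝ) :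
    (3 * c₀ / 4 - (Λ + 4 / δ ^ 3) * (2 * (ℓ + 1)) * a) * ∑ i, lowPart ℓ v i ^ 2 -
      (4 * (K + 2 / δ ^ 2) / c₀ + 1) * (K + 2 / δ ^ 2) * ∑ i, (v i - lowPart ℓ v i) ^ 2 ≤
    pairHessian q (cauchyKernel δ) x v + 2 * ∑ α ∈ Finset.Icc 1 ℓ, cosCoeff v α ^ 2 := by
  have hN : 0 < N := by omega
  have hK : 0 ≤ K := (abs_nonneg _).trans (hqK 0)
  set K' := K + 2 / δ ^ 2 with hK'
  have hK'0 : 0 < K' := by positivity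
  set L := lowPart ℓ v with hL
  -- The Young parameter is chosen so that the cross terms consume exactly `c₀ / 4` of the low-mode
  -- coercivity.
  have h1 := pairHessian_add_ge hδ (show 0 < c₀ / (4 * K') by positivity) hqK hN x L
    fun i => v i - L i
  simp only [add_sub_cancel] at h1
  rw [← hK', show c₀ / (4 * K') * K' = c₀ / 4 by field_simp, one_div_div] at h1
  have h2 := pairHessian_ge_of_close hδ ha
    (show 0 ≤ 2 * ((ℓ : ℝ) + 1) * ∑ i, L i ^ 2 by positivity) hqL hN h (u := L) fun i => by
      refine (lowPart_sq_le hℓN v i).trans (le_of_eq ?_)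
      rw [← hL]; ring
  have h3 := hγ L
  -- Mode zero carries the mean, so penalizing modes `1, …, ℓ` is, for the low part, the same as
  -- penalizing everything orthogonal to constants.
  have h4 : ∑ α ∈ Finset.Icc 1 ℓ, cosCoeff v α ^ 2 = ∑ i, L i ^ 2 - (∑ i, L i) ^ 2 / N := by
    rw [← cosCoeff_zero_sq, hL, sum_lowPart_sq hℓN, cosCoeff_lowPart hℓN hN, if_pos (Nat.zero_le _),
      Finset.sum_range_eq_add_Ico _ (Nat.succ_pos ℓ), add_sub_cancel_left]
    rfl
  rw [h4]
  linarith

/-- Completing the square reduces to `E a²`. If `s a² ≤ 2`, then `s ≥ 32 E / c₀` makes it at most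
`c₀ / 16`; otherwise `s a² - 1 ≥ s a² / 2` and the confinement dominates since `s ≥ max 1 E`. -/
theorem exists_confining_scale {c₀ E₁ E₂ : ℝ} (hc₀ : 0 < c₀) (hE₂ : 0 ≤ E₂) :
    ∃ s > 0, ∀ a : ℝ, E₁ * a + E₂ * a ^ 2 ≤ c₀ / 8 + 2 * s * max (s * a ^ 2 - 1) 0 := by
  set E := 4 * E₁ ^ 2 / c₀ + E₂ with hE
  have hE0 : 0 ≤ E := by positivity
  refine ⟨1 + E + 32 * E / c₀, by positivity, fun a => ?_⟩
  set s := 1 + E + 32 * E / c₀ with hs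
  have hs1 : 1 ≤ s := by rw [hs]; linarith [show 0 ≤ 32 * E / c₀ by positivity]
  have h1 : E₁ * a ≤ c₀ / 16 + 4 * E₁ ^ 2 / c₀ * a ^ 2 := by
    have h2 : 0 ≤ (4 * (4 / c₀)) * (E₁ * a - c₀ / 8) ^ 2 := by positivity
    have h3 : (4 * (4 / c₀)) * (E₁ * a - c₀ / 8) ^ 2 =
        4 * (4 * E₁ ^ 2 / c₀ * a ^ 2) - 4 * (E₁ * a) + c₀ / 4 := by field_simp; ring
    linarith
  have h2 : E * a ^ 2 ≤ c₀ / 16 + 2 * s * max (s * a ^ 2 - 1) 0 := by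
    by_cases hu : s * a ^ 2 ≤ 2
    · have h3 : 32 * E / c₀ * a ^ 2 ≤ 2 := by
        refine le_trans (mul_le_mul_of_nonneg_right ?_ (sq_nonneg a)) hu
        rw [hs]; linarith
      have h4 : 32 * E / c₀ * a ^ 2 = 32 * (E * a ^ 2) / c₀ := by ring
      rw [h4, div_le_iff₀ hc₀] at h3
      have : 0 ≤ 2 * s * max (s * a ^ 2 - 1) 0 := by positivity
      linarith
    · rw [not_le] at hu
      have h3 : s * a ^ 2 - 1 ≤ max (s * a ^ 2 - 1) 0 := le_max_left _ _
      have h4 : E * a ^ 2 ≤ s * a ^ 2 :=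
        mul_le_mul_of_nonneg_right (by rw [hs]; linarith [show 0 ≤ 32 * E / c₀ by positivity])
          (sq_nonneg a)
      nlinarith
  have h3 : E * a ^ 2 = 4 * E₁ ^ 2 / c₀ * a ^ 2 + E₂ * a ^ 2 := by rw [hE]; ring
  linarith

theorem exists_le_rpow_div (R : ℝ) :
    ∃ ε₀ > 0, ε₀ ≤ 1 ∧ ∀ ε : ℝ, 0 < ε → ε < ε₀ → R ≤ ε ^ (2 / 3 : ℝ) / ε := by
  have h : Tendsto (fun ε : ℝ => ε ^ (-(1 / 3) : ℝ)) (𝓝[>] 0) atTop :=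
    tendsto_rpow_neg_nhdsGT_zero (by norm_num)
  obtain ⟨ε₀, hε₀, hsub⟩ := mem_nhdsGT_iff_exists_Ioo_subset.1 (h.eventually_ge_atTop R)
  refine ⟨min ε₀ 1, lt_min hε₀ one_pos, min_le_right _ _, fun ε h0 hε => ?_⟩
  have : R ≤ ε ^ (-(1 / 3) : ℝ) := hsub ⟨h0, hε.trans_le (min_le_left _ _)⟩
  rwa [← Real.rpow_sub_one h0.ne', show (2 / 3 : ℝ) - 1 = -(1 / 3) by norm_num]

theorem sum_lowPart_sq_add_sum_highPart_sq {N ℓ : ℕ} (hℓ : ℓ < N) (v : Fin N → ℝ) :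
    ∑ i, lowPart ℓ v i ^ 2 + ∑ i, (v i - lowPart ℓ v i) ^ 2 = ∑ i, v i ^ 2 := by
  rw [sum_lowPart_sq hℓ, sum_highPart_sq hℓ, sum_sq_eq_sum_cosCoeff_sq v,
    Finset.sum_range_add_sum_Ico _ (by omega)]

/-- The budget: `LL` and `HH` are the low and high parts, `P` the penalized modes, `b` the
displacement. Low modes start with at least `3c₀/8`; the sacrificed fraction of `V''` and the
displacement errors each cost at most `c₀/8`. High modes receive the same `3c₀/8` from `QQ` after
paying `K'`. -/
theorem hessian_bound_of_parts {c₀ η W K' E b Sg PH LL HH S QQ T₁ T₂ T₃ T₄ P R : ℝ}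
    (hc₀ : 0 ≤ c₀) (hη : 0 ≤ η) (hη1 : η ≤ 1 / 2) (hK' : 0 ≤ K') (hE : 0 ≤ E) (hb : 0 ≤ b)
    (hηW : η * W ≤ c₀ / 8) (hLL : 0 ≤ LL) (hHH : 0 ≤ HH) (hS : LL + HH = S)
    (hstatic : (1 - η) * PH - η * W * S + QQ ≤ T₁ + T₃) (hQ : (K' + 3 * c₀ / 8) * HH ≤ QQ)
    (hpair : (3 * c₀ / 4 - E * b) * LL - K' * HH ≤ PH + 2 * P)
    (hpen : 2 * (1 - η) * P - (W + 1) * (Sg * (2 * b + 2 / η * b ^ 2) * S) ≤ T₄)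
    (hscale : (E + (W + 1) * Sg * 2) * b + (W + 1) * Sg * (2 / η) * b ^ 2 ≤ c₀ / 8 + R)
    (hT₂ : T₂ = R * S) : c₀ / 8 * S ≤ T₁ + T₂ + T₃ + T₄ := by
  have hS0 : 0 ≤ S := by linarith
  have h0 := mul_le_mul_of_nonneg_left hpair (show 0 ≤ 1 - η by linarith)
  have h1 : 1 / 2 * (3 * c₀ / 4 * LL) ≤ (1 - η) * (3 * c₀ / 4 * LL) :=
    mul_le_mul_of_nonneg_right (by linarith) (by positivity)
  have h2 : E * b * LL ≤ E * b * S := mul_le_mul_of_nonneg_left (by linarith) (by positivity)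
  have h3 : 0 ≤ η * (E * b * LL) := by positivity
  have h4 : 0 ≤ η * (K' * HH) := by positivity
  have h5 : η * W * S ≤ c₀ / 8 * S := mul_le_mul_of_nonneg_right hηW hS0
  have h6 := mul_le_mul_of_nonneg_right hscale hS0
  subst hT₂
  subst hS
  linarith

/-- Second differences of the convexified Hamiltonian are uniformly bounded below. -/
theorem exists_secondDiffGE {V ρ : ℝ → ℝ} {A B W a r : ℝ} (hV : AnalyticOnNhd ℝ V univ)
    (hW : 0 ≤ W) (hVW : ∀ x, -2 * W ≤ deriv (deriv V) x) (ha : 0 < a)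
    (hgrowth : ∀ x, r ≤ |x| → (2 + a) * Real.log (1 + |x|) < V x)
    (h : IsRegularEquilibriumDensity V ρ A B) {g : ℕ → ℝ → ℝ}
    (hg : ∀ α, 1 ≤ α → IsSlowMode ρ A α (g α)) {c₁ : ℝ} (hc₁ : 0 < c₁) :
    ∃ ε₀ > 0, ∀ ε : ℝ, 0 < ε → ε < ε₀ → ∃ (c s : ℝ) (ℓ N₀ : ℕ), 0 < c ∧ 0 < s ∧ 0 < ℓ ∧
      ∀ N : ℕ, N₀ ≤ N → ∀ θ : ℝ → ℝ, IsConfining θ → ∀ x ∈ openSimplex N, ∀ v,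
        SecondDiffGE (rawHamiltonianNu V ρ A W g θ c₁ ε s ℓ N) x v (c * ‖v‖ ^ 2) := by
  have hV3 : ContDiff ℝ 3 V := hV.contDiff
  have hV2 : ContDiff ℝ 2 V := hV.contDiff
  obtain ⟨q, K, Λ, hqK, hqL, hqle, hqeq⟩ := exists_lipschitz_minorant h.lt hV3 hVW
  obtain ⟨c₀, hc₀, δ, hδ, N₁, hN₁⟩ := h.exists_le_pairHessian hV2 hW hVW hqK hqL hqeq
    (exists_deriv_deriv_ne_zero h.lt hV ha hgrowth)
  have hK : 0 ≤ K := (abs_nonneg _).trans (hqK 0)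
  have hΛ : 0 ≤ Λ := by
    have := (abs_nonneg _).trans (hqL 0 1)
    simpa using this
  choose! Cg hCg using fun α hα => (hg α hα).bounded
  obtain ⟨η, hη, hη1, hηW⟩ : ∃ η > 0, η ≤ 1 / 2 ∧ η * W ≤ c₀ / 8 := by
    refine ⟨min (1 / 2) (c₀ / (8 * (W + 1))), by positivity, min_le_left _ _, ?_⟩
    refine (mul_le_mul_of_nonneg_right (min_le_right _ _) hW).trans ?_
    rw [div_mul_eq_mul_div, div_le_div_iff₀ (by positivity) (by norm_num)]
    nlinarith
  set K'' := (4 * (K + 2 / δ ^ 2) / c₀ + 1) * (K + 2 / δ ^ 2) with hK''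
  have hK''0 : 0 ≤ K'' := by positivity
  -- The constants `c₀`, `δ`, `η` and `K''` precede `ε`, so the high-mode cost is fixed before the
  -- spectral gap `ε^{-1/3}` of `Q` is made to exceed it. Afterwards `ε` fixes `ℓ`, and `ℓ` fixes
  -- `s`, without circularity.
  obtain ⟨ε₀, hε₀, hε₀1, hR⟩ := exists_le_rpow_div ((K'' + 3 * c₀ / 8) / (η / 2 * c₁))
  refine ⟨ε₀, hε₀, fun ε hε hεlt => ?_⟩
  set ℓ := ⌈2 / ε⌉₊ with hℓ
  have hℓ0 : 0 < ℓ := Nat.ceil_pos.2 (by positivity)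
  have hεℓ : 2 ≤ ε * ℓ := by
    have := Nat.le_ceil (2 / ε)
    rwa [div_le_iff₀ hε, mul_comm] at this
  set Sg := ∑ α ∈ Finset.Icc 1 ℓ, Cg α ^ 2 with hSg
  have hSg0 : 0 ≤ Sg := Finset.sum_nonneg fun _ _ => sq_nonneg _
  set Eₗ := (Λ + 4 / δ ^ 3) * (2 * ((ℓ : ℝ) + 1)) with hEₗ
  have hEₗ0 : 0 ≤ Eₗ := by positivity
  obtain ⟨s, hs, hscale⟩ := exists_confining_scale (c₀ := c₀) (E₁ := Eₗ + (W + 1) * Sg * 2)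
    (E₂ := (W + 1) * Sg * (2 / η)) hc₀ (by positivity)
  refine ⟨c₀ / 8, s, ℓ, max N₁ (ℓ + 1), by positivity, hs, hℓ0, fun N hN θ hθ x hx v => ?_⟩
  have hℓN : ℓ < N := (le_max_right _ _).trans hN
  have hN0 : 0 < N := by omega
  have hN' : (0 : ℝ) < N := by exact_mod_cast hN0
  have hεN : 2 ≤ ε * N := hεℓ.trans
    (mul_le_mul_of_nonneg_left (by exact_mod_cast hℓN.le) hε.le)
  refine (secondDiffGE_rawHamiltonianNu hV2 (fun α hα => (hg α hα).contDiff) hW hθ hc₁ hε hs hN0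
    hx v).mono ?_
  rw [EuclideanSpace.real_norm_sq_eq]
  set b := √((∑ i, (x i - gammaTilde ρ A N i) ^ 2) / N) with hb
  have hb0 : 0 ≤ b := Real.sqrt_nonneg _
  have hb2 : b ^ 2 = (∑ i, (x i - gammaTilde ρ A N i) ^ 2) / N :=
    Real.sq_sqrt (by positivity)
  have hclose : ∑ i, (x i - gammaTilde ρ A N i) ^ 2 ≤ N * b ^ 2 := by
    rw [hb2, mul_div_cancel₀ _ hN'.ne']
  have harg : globalArg ρ A s N x = s * b ^ 2 := by
    rw [globalArg, hb2]; ring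
  have hstatic := le_static_hessian (δ := δ) hx (fun i => v i) hη.le (by linarith) hVW hqle hc₁ hε
  have hQ := le_sum_matQ_mul_sub_sq hε (hεlt.le.trans hε₀1) hεN hεℓ hℓN fun i => v i
  have hpair := le_pairHessian_low_add_high hδ hb0 hc₀ hqK hqL hℓN (x := fun i => x i) hclose
    (hN₁ N ((le_max_left _ _).trans hN)) fun i => v i
  have hpen : 2 * (1 - η) * ∑ α ∈ Finset.Icc 1 ℓ, cosCoeff (fun i => v i) α ^ 2 -
      (W + 1) * (Sg * (2 * b + 2 / η * b ^ 2) * ∑ i, v i ^ 2) ≤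
      (W + 1) * ∑ α ∈ Finset.Icc 1 ℓ, (2 * ((√(N : ℝ))⁻¹ * ∑ j, deriv (g α) (x j) * v j) ^ 2 +
        2 * linStat ρ A (g α) N x *
          ((√(N : ℝ))⁻¹ * ∑ j, deriv (deriv (g α)) (x j) * v j ^ 2)) := by
    have h1 : 2 * (1 - η) * ∑ α ∈ Finset.Icc 1 ℓ, cosCoeff (fun i => v i) α ^ 2 -
        Sg * (2 * b + 2 / η * b ^ 2) * ∑ i, v i ^ 2 ≤
        ∑ α ∈ Finset.Icc 1 ℓ, (2 * ((√(N : ℝ))⁻¹ * ∑ j, deriv (g α) (x j) * v j) ^ 2 +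
          2 * linStat ρ A (g α) N x *
            ((√(N : ℝ))⁻¹ * ∑ j, deriv (deriv (g α)) (x j) * v j ^ 2)) := by
      rw [hSg, Finset.sum_mul, Finset.sum_mul, Finset.mul_sum, ← Finset.sum_sub_distrib]
      refine Finset.sum_le_sum fun α hα => ?_
      have hα1 := (Finset.mem_Icc.1 hα).1
      exact (hg α hα1).le_hessian_linStat_sq hα1 (hCg α hα1) hη hb0 hN0 hclose fun i => v i
    have h2 := mul_le_mul_of_nonneg_left h1 (show 0 ≤ W + 1 by linarith)
    -- Of the prefactor `W + 1` only `1` is needed in the main term; the rest is discarded here,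
    -- while the error keeps the full factor.
    have h3 : 0 ≤ W * (2 * (1 - η) *
        ∑ α ∈ Finset.Icc 1 ℓ, cosCoeff (fun i => v i) α ^ 2) :=
      mul_nonneg hW (mul_nonneg (by linarith) (Finset.sum_nonneg fun _ _ => sq_nonneg _))
    linarith
  have hpyth := sum_lowPart_sq_add_sum_highPart_sq hℓN fun i => v i
  have hsc := hscale b
  rw [harg]
  have hLL0 : 0 ≤ ∑ i, lowPart ℓ (fun i => v i) i ^ 2 := Finset.sum_nonneg fun _ _ => sq_nonneg _
  have hHH0 : 0 ≤ ∑ i, (v i - lowPart ℓ (fun i => v i) i) ^ 2 :=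
    Finset.sum_nonneg fun _ _ => sq_nonneg _
  have hG : (K'' + 3 * c₀ / 8) * ∑ i, (v i - lowPart ℓ (fun i => v i) i) ^ 2 ≤
      η / 2 * c₁ * ∑ i, ∑ j, matQ N ε i j * (v i - v j) ^ 2 := by
    have h1 := hR ε hε hεlt
    rw [div_le_iff₀ (by positivity)] at h1
    have h2 := mul_le_mul_of_nonneg_left hQ (show 0 ≤ η / 2 * c₁ by positivity)
    have h3 := mul_le_mul_of_nonneg_right h1 hHH0
    refine h3.trans (le_trans (le_of_eq ?_) h2)
    ring
  simp only [← hK'', ← hEₗ] at hpair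
  exact hessian_bound_of_parts hc₀.le hη.le hη1 hK''0 hEₗ0 hb0 hηW hLL0 hHH0 hpyth hstatic hG
    hpair hpen hsc rfl

end LogGas

theorem mainTheorem4 {V ρ : ℝ → ℝ} {A B W : ℝ}
    (hV : AnalyticOnNhd ℝ V Set.univ)
    (hW : 0 ≤ W) (hVW : ∀ x, -2 * W ≤ deriv (deriv V) x)
    (hgrowth : ∃ a : ℝ, 0 < a ∧ ∃ r : ℝ, ∀ x, r ≤ |x| → (2 + a) * Real.log (1 + |x|) < V x)
    (hρ : LogGas.IsRegularEquilibriumDensity V ρ A B) :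
    (∃ g : ℕ → ℝ → ℝ, ∀ α, 1 ≤ α → LogGas.IsSlowMode ρ A α (g α)) ∧
    ∀ g : ℕ → ℝ → ℝ, (∀ α, 1 ≤ α → LogGas.IsSlowMode ρ A α (g α)) →
    ∀ c₁ : ℝ, 0 < c₁ →
    ∃ ε₀ : ℝ, 0 < ε₀ ∧ ∀ ε : ℝ, 0 < ε → ε < ε₀ →
    ∃ (c s : ℝ) (ℓ N₀ : ℕ), 0 < c ∧ 0 < s ∧ 0 < ℓ ∧
    ∀ N : ℕ, N₀ ≤ N → ∀ β : ℝ, 0 < β → ∀ θ : ℝ → ℝ, LogGas.IsConfining θ →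
      (∀ x ∈ LogGas.openSimplex N, LogGas.OffKinks ρ A c₁ ε s N x →
        LogGas.TwiceDifferentiableAt (LogGas.hamiltonianNu V ρ A W g θ c₁ ε s β ℓ N) x ∧
        ∀ v : EuclideanSpace ℝ (Fin N),
          c * ‖v‖ ^ 2 ≤
            LogGas.hessianForm (LogGas.hamiltonianNu V ρ A W g θ c₁ ε s β ℓ N) x v) ∧
      StrongConvexOn (LogGas.openSimplex N) c
        (LogGas.hamiltonianNu V ρ A W g θ c₁ ε s β ℓ N) := by
  obtain ⟨a, ha, r, hr⟩ := hgrowth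
  refine ⟨?_, fun g hg c₁ hc₁ => ?_⟩
  · choose g hg using fun α => hρ.exists_isSlowMode α
    exact ⟨g, fun α _ => hg α⟩
  · obtain ⟨ε₀, hε₀, h⟩ := LogGas.exists_secondDiffGE hV hW hVW ha hr hρ hg hc₁
    refine ⟨ε₀, hε₀, fun ε hε hεlt => ?_⟩
    obtain ⟨c, s, ℓ, N₀, hc, hs, hℓ, h⟩ := h ε hε hεlt
    refine ⟨c, s, ℓ, N₀, hc, hs, hℓ, fun N hN β _ θ hθ => ?_⟩
    exact LogGas.convexity_of_secondDiffGE hV.contDiff (fun α hα => (hg α hα).contDiff) hθ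
      (h N hN θ hθ)
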